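/- Let $K$ be a field of characteristic $0$ and let $H$ be a Hopf algebra over $K$ with an ad-invariant integral $\lambda$, i.e. a left and right integral $\lambda\in H^*$ ($h_{(1)}\lambda(h_{(2)})=\lambda(h)1_H=\lambda(h_{(1)})h_{(2)}$) with $\lambda(1_H)=1$ and $\lambda(h_{(1)}xS(h_{(2)}))=\varepsilon_H(h)\lambda(x)=\lambda(S(h_{(1)})xh_{(2)})$ for all $h,x\in H$. Let $R=(R,m,u,\Delta,\varepsilon)$ be a pre-bialgebra in the category ${}_H^H\mathcal{YD}$ of left-left Yetter-Drinfeld modules: $(R,\Delta,\varepsilon,u)$ is a coaugmented coalgebra in ${}_H^H\mathcal{YD}$ and $m:R\otimes R\to R$ is a left $H$-linear coalgebra homomorphism with unit $1_R=u(1)$ ($m$ need be neither associative nor $H$-colinear). Assume $R$ is connected, i.e. its coradical (the sum of its simple subcoalgebras) is $K1_R$. Write $\rho(x)=x_{\langle -1\rangle}\otimes x_{\langle 0\rangle}$ for left $H$-coactions and $\Delta(x)=x^{(1)}\otimes x^{(2)}$ for the comultiplication of coalgebras in ${}_H^H\mathcal{YD}$. Tensor powers of $R$ carry the diagonal action, the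 codiagonal coaction and the braided coalgebra structure $\Delta(x\otimes y)=x^{(1)}\otimes x^{(2)}_{\langle -1\rangle}y^{(1)}\otimes x^{(2)}_{\langle 0\rangle}\otimes y^{(2)}$; $*$ denotes convolution. Let $c_{R,H}(r\otimes h)=r_{\langle -1\rangle}h\otimes r_{\langle 0\rangle}$, $c_{H,R}(h\otimes r)=h_{(1)}r\otimes h_{(2)}$, and for linear $\xi:R\otimes R\to H$ let $\Phi(\xi)(z\otimes t)=z^{(1)}\otimes\xi(z^{(2)})t$ for $z\in R\otimes R$, $t\in R$. Let $\Xi$ be the set of cocycles for $R$: the linear maps $\xi:R\otimes R\to H$ such that 1. $\xi$ is left $H$-linear for the left adjoint action on $H$; 2. $\Delta_H\xi=(m_H\otimes\xi)(\xi\otimes\rho_{R\otimes R})\Delta_{R\otimes R}$ and $\varepsilon_H\xi=\varepsilon_{R\otimes R}$; 3. $c_{R,H}(m\otimes\xi)\Delta_{R\otimes R}=(m_H\otimes m)(\xi\otimes\rho_{R\otimes R})\Delta_{R\otimes R}$; 4. $m(R\otimes m)=m(m\otimes R)\Phi(\xi)$; 5. $m_H(\xi\otimes H)[R\otimes(m\otimes\xi)\Delta_{R\otimes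 R}]=m_H(\xi\otimes H)(R\otimes c_{H,R})[(m\otimes\xi)\Delta_{R\otimes R}\otimes R]$; 6. $\xi(r\otimes 1_R)=\xi(1_R\otimes r)=\varepsilon(r)1_H$ for all $r\in R$. Let $\xi\in\Xi$, and let $A=R\#_\xi H$ be the bosonization: the space $R\otimes H$ with $\Delta_A(r\# h)=r^{(1)}\# r^{(2)}_{\langle -1\rangle}h_{(1)}\otimes r^{(2)}_{\langle 0\rangle}\# h_{(2)}$, $\varepsilon_A(r\# h)=\varepsilon(r)\varepsilon_H(h)$ and $m_A=(R\otimes m_H)[(m\otimes\xi)\Delta_{R\otimes R}\otimes m_H](R\otimes c_{H,R}\otimes H)$. Give tensor powers of $A$ the usual tensor product coalgebra structure. For convolution invertible $w:A\otimes A\to K$ put $$\partial_A^2(w)=(\varepsilon_A\otimes w)*w(A\otimes m_A)*w^{-1}(m_A\otimes A)*(w^{-1}\otimes\varepsilon_A).$$ For $v:R\otimes R\to K$ put $\mho^2(v)\big((r\# h)\otimes(s\# l)\big)=v(r\otimes hs)\varepsilon_H(l)$; for $\gamma:A^{\otimes 3}\to K$ put $\Omega^3(\gamma)(r\otimes s\otimes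 t)=\gamma\big((r\#1)\otimes(s\#1)\otimes(t\#1)\big)$; and put $\partial_R^2=\Omega^3\circ\partial_A^2\circ\mho^2$. Let $Z^2_H(R,K)$ be the set of left $H$-linear maps $\nu:R\otimes R\to K$ that are unital ($\nu(r\otimes 1_R)=\nu(1_R\otimes r)=\varepsilon(r)$) and satisfy $$(\varepsilon\otimes\nu)*\nu(R\otimes m)=(\nu\otimes\varepsilon)*[\nu(m\otimes R)\Phi(\xi)].$$ Let $D=R\otimes R\otimes R$, let $\Psi(\alpha)=(H\otimes\alpha)\rho_D$ for $\alpha\in\mathrm{Hom}(D,K)$, and let ${}^{co(H)}D=\{z\in D:\rho_D(z)=1_H\otimes z\}$. Then $\lambda\xi:R\otimes R\to K$ is convolution invertible; let $v:=G(\xi):=(\lambda\xi)^{-1}$. The map $\mho^2(v)$ is convolution invertible as well, so that $\partial^2_R(v)$ is defined, and the following are equivalent: (i) $v\in Z^2_H(R,K)$; (ii) $\partial_R^2(v)=\varepsilon_D$; (iii) $\lambda\circ\Psi(\partial_R^2(v))=\varepsilon_D$; (iv) $\partial_R^2(v)=\varepsilon_D$ on ${}^{co(H)}D$. -/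

import Mathlib

open TensorProduct

noncomputable section

namespace YD

/-! ### Linear algebra: convolution, functionals on tensor products, coradical -/

section LinearAlgebra

variable {K : Type*} [Field K]
variable {V : Type*} [AddCommMonoid V] [Module K V]
variable {W : Type*} [AddCommMonoid W] [Module K W]

/-- The convolution product `f * g = m_B ∘ (f ⊗ g) ∘ Δ` of two linear maps from a coalgebra with
comultiplication `Δ` to an algebra `B`. The comultiplication is an explicit argument since
`R ⊗ R` carries the braided one, which is not the one that Mathlib puts on a tensor product. -/
def conv {B : Type*} [Semiring B] [Algebra K B] (Δ : V →ₗ[K] V ⊗[K] V) (f g : V →ₗ[K] B) :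
    V →ₗ[K] B :=
  LinearMap.mul' K B ∘ₗ TensorProduct.map f g ∘ₗ Δ

/-- `g` is a two-sided convolution inverse of the functional `f`. -/
def IsConvInv (Δ : V →ₗ[K] V ⊗[K] V) (ε : V →ₗ[K] K) (f g : V →ₗ[K] K) : Prop :=
  conv Δ f g = ε ∧ conv Δ g f = ε

/-- `f ∈ Reg(V, K)`: the functional `f` is convolution invertible. -/
def IsReg (Δ : V →ₗ[K] V ⊗[K] V) (ε : V →ₗ[K] K) (f : V →ₗ[K] K) : Prop :=
  ∃ g, IsConvInv Δ ε f g

open Classical in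
/-- The convolution inverse of a functional (`0` if there is none). -/
def convInv (Δ : V →ₗ[K] V ⊗[K] V) (ε : V →ₗ[K] K) (f : V →ₗ[K] K) : V →ₗ[K] K :=
  if h : IsReg Δ ε f then h.choose else 0

/-- The functional `m_K ∘ (f ⊗ g)`, that is `v ⊗ w ↦ f v * g w`. -/
def tensorFun (f : V →ₗ[K] K) (g : W →ₗ[K] K) : V ⊗[K] W →ₗ[K] K :=
  LinearMap.mul' K K ∘ₗ TensorProduct.map f g

/-- The usual (unbraided) comultiplication on a tensor product,
`v ⊗ w ↦ (v₁ ⊗ w₁) ⊗ (v₂ ⊗ w₂)`. -/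
def tensorComul (ΔV : V →ₗ[K] V ⊗[K] V) (ΔW : W →ₗ[K] W ⊗[K] W) :
    V ⊗[K] W →ₗ[K] (V ⊗[K] W) ⊗[K] (V ⊗[K] W) :=
  (TensorProduct.tensorTensorTensorComm K V V W W).toLinearMap ∘ₗ TensorProduct.map ΔV ΔW

variable [Coalgebra K V]

/-- `D` is a subcoalgebra: `Δ(D) ⊆ D ⊗ D`. -/
def IsSubcoalgebra (D : Submodule K V) : Prop :=
  ∀ x ∈ D, Coalgebra.comul (R := K) x ∈
    LinearMap.range (TensorProduct.map D.subtype D.subtype)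

/-- `D` is a simple subcoalgebra. -/
def IsSimpleSubcoalgebra (D : Submodule K V) : Prop :=
  IsSubcoalgebra D ∧ D ≠ ⊥ ∧ ∀ E : Submodule K V, IsSubcoalgebra E → E ≤ D → E = ⊥ ∨ E = D

variable (K V) in
/-- The coradical: the sum of all simple subcoalgebras. -/
def coradical : Submodule K V :=
  sSup {D : Submodule K V | IsSimpleSubcoalgebra D}

end LinearAlgebra

/-! ### The Hopf algebra `H` -/

section Hopf

variable {K : Type*} [Field K] {H : Type*} [Ring H] [HopfAlgebra K H]

variable (K H) in
/-- `(a ⊗ c) x ↦ a x S(c)`. -/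
def sandwich : H ⊗[K] H →ₗ[K] H →ₗ[K] H :=
  TensorProduct.lift (LinearMap.mk₂ K
    (fun a c => LinearMap.mulRight K (HopfAlgebra.antipode K c) ∘ₗ LinearMap.mulLeft K a)
    (fun a a' c => by ext; simp [add_mul])
    (fun k a c => by ext; simp)
    (fun a c c' => by ext; simp [mul_add])
    (fun k a c => by ext; simp))

variable (K H) in
/-- `(a ⊗ c) x ↦ S(a) x c`. -/
def sandwich' : H ⊗[K] H →ₗ[K] H →ₗ[K] H :=
  TensorProduct.lift (LinearMap.mk₂ K
    (fun a c => LinearMap.mulRight K c ∘ₗ LinearMap.mulLeft K (HopfAlgebra.antipode K a))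
    (fun a a' c => by ext; simp [add_mul])
    (fun k a c => by ext; simp)
    (fun a c c' => by ext; simp [mul_add])
    (fun k a c => by ext; simp))

variable (K H) in
/-- The left adjoint action `h ⇀ x = h₁ x S(h₂)` of `H` on itself. -/
def adLeft : H →ₗ[K] H →ₗ[K] H := sandwich K H ∘ₗ Coalgebra.comul

variable (K H) in
/-- The right adjoint action `S(h₁) x h₂` of `h` on `x`. -/
def adRight : H →ₗ[K] H →ₗ[K] H := sandwich' K H ∘ₗ Coalgebra.comul

/-- `lam` is an ad-invariant integral for `H`: a left and right integral in the dual of `H` with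
`lam 1 = 1` which is invariant under the left and the right adjoint action. -/
structure IsAdInvariantIntegral (lam : H →ₗ[K] K) : Prop where
  /-- `h₁ lam(h₂) = lam(h) 1` -/
  left_integral : ∀ h : H,
    TensorProduct.rid K H (lam.lTensor H (Coalgebra.comul h)) = algebraMap K H (lam h)
  /-- `lam(h₁) h₂ = lam(h) 1` -/
  right_integral : ∀ h : H,
    TensorProduct.lid K H (lam.rTensor H (Coalgebra.comul h)) = algebraMap K H (lam h)
  map_one : lam 1 = 1
  adLeft_inv : ∀ h x : H, lam (adLeft K H h x) = Coalgebra.counit (R := K) h * lam x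
  adRight_inv : ∀ h x : H, lam (adRight K H h x) = Coalgebra.counit (R := K) h * lam x

end Hopf

/-! ### Actions, coactions and the braiding -/

section Structures

variable {K : Type*} [Field K] {H : Type*} [Ring H] [HopfAlgebra K H]
variable {V : Type*} [AddCommMonoid V] [Module K V]
variable {W : Type*} [AddCommMonoid W] [Module K W]

/-- The diagonal action `h (v ⊗ w) = h₁ v ⊗ h₂ w`. -/
def tensorAct (μV : H →ₗ[K] V →ₗ[K] V) (μW : H →ₗ[K] W →ₗ[K] W) :
    H →ₗ[K] (V ⊗[K] W) →ₗ[K] (V ⊗[K] W) :=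
  TensorProduct.homTensorHomMap (.id K) V W V W ∘ₗ TensorProduct.map μV μW ∘ₗ Coalgebra.comul

/-- The codiagonal coaction `ρ(v ⊗ w) = v₋₁ w₋₁ ⊗ (v₀ ⊗ w₀)`. -/
def tensorCoact (ρV : V →ₗ[K] H ⊗[K] V) (ρW : W →ₗ[K] H ⊗[K] W) :
    V ⊗[K] W →ₗ[K] H ⊗[K] (V ⊗[K] W) :=
  (LinearMap.mul' K H).rTensor (V ⊗[K] W) ∘ₗ
    (TensorProduct.tensorTensorTensorComm K H V H W).toLinearMap ∘ₗ TensorProduct.map ρV ρW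

/-- The braiding `v ⊗ w ↦ v₋₁ w ⊗ v₀`. -/
def braid (ρV : V →ₗ[K] H ⊗[K] V) (μW : H →ₗ[K] W →ₗ[K] W) : V ⊗[K] W →ₗ[K] W ⊗[K] V :=
  (TensorProduct.lift μW).rTensor V ∘ₗ (TensorProduct.assoc K H W V).symm.toLinearMap ∘ₗ
    (TensorProduct.comm K V W).toLinearMap.lTensor H ∘ₗ
    (TensorProduct.assoc K H V W).toLinearMap ∘ₗ ρV.rTensor W

/-- The comultiplication `v ⊗ w ↦ (v₁ ⊗ (v₂)₋₁ w₁) ⊗ ((v₂)₀ ⊗ w₂)` on the tensor product of an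
`H`-comodule coalgebra `V` and an `H`-module coalgebra `W`. -/
def smashComul (ΔV : V →ₗ[K] V ⊗[K] V) (ρV : V →ₗ[K] H ⊗[K] V)
    (ΔW : W →ₗ[K] W ⊗[K] W) (μW : H →ₗ[K] W →ₗ[K] W) :
    V ⊗[K] W →ₗ[K] (V ⊗[K] W) ⊗[K] (V ⊗[K] W) :=
  (TensorProduct.assoc K V W (V ⊗[K] W)).symm.toLinearMap ∘ₗ
    ((TensorProduct.assoc K W V W).toLinearMap ∘ₗ (braid ρV μW).rTensor W ∘ₗ
      (TensorProduct.assoc K V W W).symm.toLinearMap).lTensor V ∘ₗ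
    (TensorProduct.assoc K V V (W ⊗[K] W)).toLinearMap ∘ₗ TensorProduct.map ΔV ΔW

/-- `Ψ(α) = (H ⊗ α) ∘ ρ`, that is `v ↦ v₋₁ α(v₀)`. -/
def Psi (ρV : V →ₗ[K] H ⊗[K] V) (α : V →ₗ[K] K) : V →ₗ[K] H :=
  (TensorProduct.rid K H).toLinearMap ∘ₗ α.lTensor H ∘ₗ ρV

/-- `Φ(ξ) : V ⊗ W → V ⊗ W`, `v ⊗ w ↦ v₁ ⊗ ξ(v₂) w`. -/
def Phi (ΔV : V →ₗ[K] V ⊗[K] V) (μW : H →ₗ[K] W →ₗ[K] W) (ξ : V →ₗ[K] H) :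
    V ⊗[K] W →ₗ[K] V ⊗[K] W :=
  (TensorProduct.lift (μW ∘ₗ ξ)).lTensor V ∘ₗ (TensorProduct.assoc K V V W).toLinearMap ∘ₗ
    ΔV.rTensor W

/-- The left coinvariants `{v | ρ(v) = 1 ⊗ v}`. -/
def coinvariants (ρV : V →ₗ[K] H ⊗[K] V) : Submodule K V :=
  LinearMap.eqLocus ρV (TensorProduct.mk K H V 1)

/-- A functional `f : V → K` is `H`-linear, for the trivial action on `K`. -/
def IsHLinear (μV : H →ₗ[K] V →ₗ[K] V) (f : V →ₗ[K] K) : Prop :=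
  ∀ (h : H) (v : V), f (μV h v) = Coalgebra.counit (R := K) h * f v

end Structures

/-- The structure of a left-left Yetter-Drinfeld module over `H` on `V`. -/
structure YetterDrinfeld (K H V : Type*) [Field K] [Ring H] [HopfAlgebra K H]
    [AddCommGroup V] [Module K V] where
  /-- the left action -/
  act : H →ₗ[K] V →ₗ[K] V
  one_act : ∀ v, act 1 v = v
  mul_act : ∀ g h v, act (g * h) v = act g (act h v)
  /-- the left coaction -/
  coact : V →ₗ[K] H ⊗[K] V
  counit_coact : ∀ v,
    TensorProduct.lid K V ((Coalgebra.counit (R := K) (A := H)).rTensor V (coact v)) = v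
  coassoc_coact : ∀ v,
    TensorProduct.assoc K H H V ((Coalgebra.comul (R := K) (A := H)).rTensor V (coact v)) =
      coact.lTensor H (coact v)
  /-- `ρ(h v) = h₁ v₋₁ S(h₃) ⊗ h₂ v₀`. The inner map takes `h₁ ⊗ (h₂ ⊗ h₃)` to
  `(h₁ ⊗ h₃) ⊗ h₂`. -/
  coact_act : ∀ h v,
    coact (act h v) =
      TensorProduct.map (TensorProduct.lift (sandwich K H)) (TensorProduct.lift act)
        (TensorProduct.tensorTensorTensorComm K (H ⊗[K] H) H H V
          (((TensorProduct.assoc K H H H).symm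
            ((TensorProduct.comm K H H).toLinearMap.lTensor H
              ((Coalgebra.comul (R := K) (A := H)).lTensor H (Coalgebra.comul h)))) ⊗ₜ[K]
            coact v))

/-- The structure of a pre-bialgebra in the category of left-left Yetter-Drinfeld modules over `H`
on a `K`-coalgebra `R`. The multiplication is not assumed to be associative or `H`-colinear. -/
structure PreBialgebra (K H R : Type*) [Field K] [Ring H] [HopfAlgebra K H]
    [AddCommGroup R] [Module K R] [Coalgebra K R] extends YetterDrinfeld K H R where
  comul_act : ∀ h r, Coalgebra.comul (R := K) (act h r) =
    tensorAct act act h (Coalgebra.comul (R := K) r)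
  counit_act : ∀ h r, Coalgebra.counit (R := K) (act h r) =
    Coalgebra.counit (R := K) h * Coalgebra.counit (R := K) r
  comul_coact : ∀ r, (Coalgebra.comul (R := K) (A := R)).lTensor H (coact r) =
    tensorCoact coact coact (Coalgebra.comul (R := K) r)
  counit_colinear : ∀ r, Psi coact (Coalgebra.counit (R := K) (A := R)) r =
    algebraMap K H (Coalgebra.counit (R := K) r)
  /-- the element `1_R = u_R(1)` -/
  one : R
  comul_one : Coalgebra.comul (R := K) one = one ⊗ₜ[K] one
  counit_one : Coalgebra.counit (R := K) one = 1
  act_one : ∀ h, act h one = Coalgebra.counit (R := K) h • one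
  coact_one : coact one = 1 ⊗ₜ[K] one
  /-- the multiplication -/
  mul : R ⊗[K] R →ₗ[K] R
  mul_linear : ∀ h z, mul (tensorAct act act h z) = act h (mul z)
  comul_mul : Coalgebra.comul ∘ₗ mul =
    TensorProduct.map mul mul ∘ₗ smashComul Coalgebra.comul coact Coalgebra.comul act
  counit_mul : Coalgebra.counit ∘ₗ mul =
    tensorFun (Coalgebra.counit (R := K) (A := R)) (Coalgebra.counit (R := K) (A := R))
  mul_one : ∀ r, mul (r ⊗ₜ[K] one) = r
  one_mul : ∀ r, mul (one ⊗ₜ[K] r) = r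

namespace PreBialgebra

variable {K H R : Type*} [Field K] [Ring H] [HopfAlgebra K H]
  [AddCommGroup R] [Module K R] [Coalgebra K R]

/-- `R` is connected: its coradical is `K 1_R`. -/
def IsConnected (P : PreBialgebra K H R) : Prop :=
  coradical K R = Submodule.span K {P.one}

/-! ### The Yetter-Drinfeld coalgebras `R ⊗ R` and `R ⊗ R ⊗ R` -/

/-- the action on `R ⊗ R` -/
def act₂ (P : PreBialgebra K H R) : H →ₗ[K] (R ⊗[K] R) →ₗ[K] (R ⊗[K] R) :=
  tensorAct P.act P.act

/-- the coaction on `R ⊗ R` -/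
def coact₂ (P : PreBialgebra K H R) : R ⊗[K] R →ₗ[K] H ⊗[K] (R ⊗[K] R) :=
  tensorCoact P.coact P.coact

/-- the braided comultiplication of `R ⊗ R` -/
def comul₂ (P : PreBialgebra K H R) : R ⊗[K] R →ₗ[K] (R ⊗[K] R) ⊗[K] (R ⊗[K] R) :=
  smashComul Coalgebra.comul P.coact Coalgebra.comul P.act

/-- the counit of `R ⊗ R` -/
def counit₂ (_P : PreBialgebra K H R) : R ⊗[K] R →ₗ[K] K :=
  tensorFun Coalgebra.counit Coalgebra.counit

/-- the coaction on `D = R ⊗ R ⊗ R` -/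
def coact₃ (P : PreBialgebra K H R) : R ⊗[K] R ⊗[K] R →ₗ[K] H ⊗[K] (R ⊗[K] R ⊗[K] R) :=
  tensorCoact P.coact₂ P.coact

/-- the braided comultiplication of `D = R ⊗ R ⊗ R` -/
def comul₃ (P : PreBialgebra K H R) :
    R ⊗[K] R ⊗[K] R →ₗ[K] (R ⊗[K] R ⊗[K] R) ⊗[K] (R ⊗[K] R ⊗[K] R) :=
  smashComul P.comul₂ P.coact₂ Coalgebra.comul P.act

/-- the counit of `D = R ⊗ R ⊗ R` -/
def counit₃ (P : PreBialgebra K H R) : R ⊗[K] R ⊗[K] R →ₗ[K] K :=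
  tensorFun P.counit₂ Coalgebra.counit

/-! ### Cocycles of a pre-bialgebra -/

/-- The braiding `c_{R,H}`, `r ⊗ h ↦ r₋₁ h ⊗ r₀`. -/
def braidRH (P : PreBialgebra K H R) : R ⊗[K] H →ₗ[K] H ⊗[K] R :=
  braid P.coact (LinearMap.mul K H)

/-- The braiding `c_{H,R}`, `h ⊗ r ↦ h₁ r ⊗ h₂`. -/
def braidHR (P : PreBialgebra K H R) : H ⊗[K] R →ₗ[K] R ⊗[K] H :=
  braid (Coalgebra.comul (R := K) (A := H)) P.act

/-- `ξ ∈ Ξ`: the map `ξ : R ⊗ R → H` is a cocycle for the pre-bialgebra `R`, so that `(R, ξ)` is a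
pre-bialgebra with cocycle. -/
structure IsCocycle (P : PreBialgebra K H R) (ξ : R ⊗[K] R →ₗ[K] H) : Prop where
  /-- `ξ` is `H`-linear for the left adjoint action on `H` -/
  linear : ∀ h z, ξ (P.act₂ h z) = adLeft K H h (ξ z)
  /-- `Δ_H ξ = (m_H ⊗ ξ)(ξ ⊗ ρ_{R ⊗ R})Δ_{R ⊗ R}` -/
  comul_comp : Coalgebra.comul ∘ₗ ξ =
    TensorProduct.map (LinearMap.mul' K H) ξ ∘ₗ
      (TensorProduct.assoc K H H (R ⊗[K] R)).symm.toLinearMap ∘ₗ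
      TensorProduct.map ξ P.coact₂ ∘ₗ P.comul₂
  counit_comp : Coalgebra.counit ∘ₗ ξ = P.counit₂
  /-- `c_{R,H}(m_R ⊗ ξ)Δ_{R ⊗ R} = (m_H ⊗ m_R)(ξ ⊗ ρ_{R ⊗ R})Δ_{R ⊗ R}` -/
  braid_comp : P.braidRH ∘ₗ TensorProduct.map P.mul ξ ∘ₗ P.comul₂ =
    TensorProduct.map (LinearMap.mul' K H) P.mul ∘ₗ
      (TensorProduct.assoc K H H (R ⊗[K] R)).symm.toLinearMap ∘ₗ
      TensorProduct.map ξ P.coact₂ ∘ₗ P.comul₂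
  /-- `m_R(R ⊗ m_R) = m_R(m_R ⊗ R)Φ(ξ)` -/
  assoc_comp : P.mul ∘ₗ P.mul.lTensor R ∘ₗ (TensorProduct.assoc K R R R).toLinearMap =
    P.mul ∘ₗ P.mul.rTensor R ∘ₗ Phi P.comul₂ P.act ξ
  /-- `m_H(ξ ⊗ H)[R ⊗ (m_R ⊗ ξ)Δ_{R ⊗ R}] =
  m_H(ξ ⊗ H)(R ⊗ c_{H,R})[(m_R ⊗ ξ)Δ_{R ⊗ R} ⊗ R]` -/
  cocycle_comp :
    LinearMap.mul' K H ∘ₗ ξ.rTensor H ∘ₗ (TensorProduct.assoc K R R H).symm.toLinearMap ∘ₗ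
        (TensorProduct.map P.mul ξ ∘ₗ P.comul₂).lTensor R ∘ₗ
        (TensorProduct.assoc K R R R).toLinearMap =
      LinearMap.mul' K H ∘ₗ ξ.rTensor H ∘ₗ (TensorProduct.assoc K R R H).symm.toLinearMap ∘ₗ
        P.braidHR.lTensor R ∘ₗ (TensorProduct.assoc K R H R).toLinearMap ∘ₗ
        (TensorProduct.map P.mul ξ ∘ₗ P.comul₂).rTensor R
  map_one_right : ∀ r, ξ (r ⊗ₜ[K] P.one) = algebraMap K H (Coalgebra.counit r)
  map_one_left : ∀ r, ξ (P.one ⊗ₜ[K] r) = algebraMap K H (Coalgebra.counit r)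

/-- `G(ξ) = (lam ∘ ξ)⁻¹`, the inverse for the convolution on `Hom(R ⊗ R, K)`. -/
def G (P : PreBialgebra K H R) (lam : H →ₗ[K] K) (ξ : R ⊗[K] R →ₗ[K] H) : R ⊗[K] R →ₗ[K] K :=
  convInv P.comul₂ P.counit₂ (lam ∘ₗ ξ)

/-! ### The bosonization `A = R #_ξ H` and the differentials -/

/-- The comultiplication of `A = R #_ξ H`, that of the smash coproduct:
`r # h ↦ (r₁ # (r₂)₋₁ h₁) ⊗ ((r₂)₀ # h₂)`. -/
def smashΔ (P : PreBialgebra K H R) : R ⊗[K] H →ₗ[K] (R ⊗[K] H) ⊗[K] (R ⊗[K] H) :=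
  smashComul Coalgebra.comul P.coact Coalgebra.comul (LinearMap.mul K H)

/-- The counit of `A = R #_ξ H`. -/
def smashε (_P : PreBialgebra K H R) : R ⊗[K] H →ₗ[K] K :=
  tensorFun Coalgebra.counit Coalgebra.counit

/-- The multiplication of `A = R #_ξ H`:
`(R ⊗ m_H)[(m_R ⊗ ξ)Δ_{R ⊗ R} ⊗ m_H](R ⊗ c_{H,R} ⊗ H)`. -/
def smashMul (P : PreBialgebra K H R) (ξ : R ⊗[K] R →ₗ[K] H) :
    (R ⊗[K] H) ⊗[K] (R ⊗[K] H) →ₗ[K] R ⊗[K] H :=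
  (LinearMap.mul' K H).lTensor R ∘ₗ (TensorProduct.assoc K R H H).toLinearMap ∘ₗ
    TensorProduct.map (TensorProduct.map P.mul ξ ∘ₗ P.comul₂) (LinearMap.mul' K H) ∘ₗ
    (TensorProduct.assoc K R R (H ⊗[K] H)).symm.toLinearMap ∘ₗ
    ((TensorProduct.assoc K R H H).toLinearMap ∘ₗ P.braidHR.rTensor H ∘ₗ
      (TensorProduct.assoc K H R H).symm.toLinearMap).lTensor R ∘ₗ
    (TensorProduct.assoc K R H (R ⊗[K] H)).toLinearMap

/-- the comultiplication of `A ⊗ A` -/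
def smashΔ₂ (P : PreBialgebra K H R) :
    (R ⊗[K] H) ⊗[K] (R ⊗[K] H) →ₗ[K]
      ((R ⊗[K] H) ⊗[K] (R ⊗[K] H)) ⊗[K] ((R ⊗[K] H) ⊗[K] (R ⊗[K] H)) :=
  tensorComul P.smashΔ P.smashΔ

/-- the counit of `A ⊗ A` -/
def smashε₂ (P : PreBialgebra K H R) : (R ⊗[K] H) ⊗[K] (R ⊗[K] H) →ₗ[K] K :=
  tensorFun P.smashε P.smashε

/-- the comultiplication of `A ⊗ A ⊗ A` -/
def smashΔ₃ (P : PreBialgebra K H R) :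
    (R ⊗[K] H) ⊗[K] (R ⊗[K] H) ⊗[K] (R ⊗[K] H) →ₗ[K]
      ((R ⊗[K] H) ⊗[K] (R ⊗[K] H) ⊗[K] (R ⊗[K] H)) ⊗[K]
        ((R ⊗[K] H) ⊗[K] (R ⊗[K] H) ⊗[K] (R ⊗[K] H)) :=
  tensorComul P.smashΔ₂ P.smashΔ

/-- `∂²₊(w) = (ε_A ⊗ w) * w(A ⊗ m_A)` on `A ⊗ A ⊗ A`. -/
def dPlusA (P : PreBialgebra K H R) (ξ : R ⊗[K] R →ₗ[K] H)
    (w : (R ⊗[K] H) ⊗[K] (R ⊗[K] H) →ₗ[K] K) :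
    (R ⊗[K] H) ⊗[K] (R ⊗[K] H) ⊗[K] (R ⊗[K] H) →ₗ[K] K :=
  conv P.smashΔ₃
    (tensorFun P.smashε w ∘ₗ
      (TensorProduct.assoc K (R ⊗[K] H) (R ⊗[K] H) (R ⊗[K] H)).toLinearMap)
    (w ∘ₗ (P.smashMul ξ).lTensor (R ⊗[K] H) ∘ₗ
      (TensorProduct.assoc K (R ⊗[K] H) (R ⊗[K] H) (R ⊗[K] H)).toLinearMap)

/-- `∂²₋(w) = w(m_A ⊗ A) * (w ⊗ ε_A)` on `A ⊗ A ⊗ A`. -/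
def dMinusA (P : PreBialgebra K H R) (ξ : R ⊗[K] R →ₗ[K] H)
    (w : (R ⊗[K] H) ⊗[K] (R ⊗[K] H) →ₗ[K] K) :
    (R ⊗[K] H) ⊗[K] (R ⊗[K] H) ⊗[K] (R ⊗[K] H) →ₗ[K] K :=
  conv P.smashΔ₃ (w ∘ₗ (P.smashMul ξ).rTensor (R ⊗[K] H)) (tensorFun w P.smashε)

/-- `∂²_A(w) = ∂²₊(w) * ∂²₋(w⁻¹)`. -/
def dA (P : PreBialgebra K H R) (ξ : R ⊗[K] R →ₗ[K] H)
    (w : (R ⊗[K] H) ⊗[K] (R ⊗[K] H) →ₗ[K] K) :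
    (R ⊗[K] H) ⊗[K] (R ⊗[K] H) ⊗[K] (R ⊗[K] H) →ₗ[K] K :=
  conv P.smashΔ₃ (P.dPlusA ξ w) (P.dMinusA ξ (convInv P.smashΔ₂ P.smashε₂ w))

/-- `℧²(v) : A ⊗ A → K`, `(r # h) ⊗ (s # l) ↦ v(r ⊗ h s) ε(l)`. -/
def mho₂ (P : PreBialgebra K H R) (v : R ⊗[K] R →ₗ[K] K) :
    (R ⊗[K] H) ⊗[K] (R ⊗[K] H) →ₗ[K] K :=
  tensorFun v Coalgebra.counit ∘ₗ
    ((TensorProduct.lift P.act).lTensor R).rTensor H ∘ₗ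
    (TensorProduct.assoc K R H R).toLinearMap.rTensor H ∘ₗ
    (TensorProduct.assoc K (R ⊗[K] H) R H).symm.toLinearMap

/-- `Ω³(γ) : R ⊗ R ⊗ R → K`, `r ⊗ s ⊗ t ↦ γ((r # 1) ⊗ (s # 1) ⊗ (t # 1))`. -/
def Omega₃ (_P : PreBialgebra K H R)
    (γ : (R ⊗[K] H) ⊗[K] (R ⊗[K] H) ⊗[K] (R ⊗[K] H) →ₗ[K] K) : R ⊗[K] R ⊗[K] R →ₗ[K] K :=
  γ ∘ₗ TensorProduct.map
    (TensorProduct.map ((TensorProduct.mk K R H).flip 1) ((TensorProduct.mk K R H).flip 1))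
    ((TensorProduct.mk K R H).flip 1)

/-- `∂²_R = Ω³ ∘ ∂²_A ∘ ℧²`. -/
def dR (P : PreBialgebra K H R) (ξ : R ⊗[K] R →ₗ[K] H) (v : R ⊗[K] R →ₗ[K] K) :
    R ⊗[K] R ⊗[K] R →ₗ[K] K :=
  P.Omega₃ (P.dA ξ (P.mho₂ v))

/-- `Z²_H(R, K)`: the `H`-linear unital maps `ν : R ⊗ R → K` with
`(ε_R ⊗ ν) * ν(R ⊗ m_R) = (ν ⊗ ε_R) * [ν(m_R ⊗ R)Φ(ξ)]`. -/
def Z₂ (P : PreBialgebra K H R) (ξ : R ⊗[K] R →ₗ[K] H) : Set (R ⊗[K] R →ₗ[K] K) :=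
  {ν | IsHLinear P.act₂ ν ∧
    (∀ r, ν (r ⊗ₜ[K] P.one) = Coalgebra.counit r) ∧
    (∀ r, ν (P.one ⊗ₜ[K] r) = Coalgebra.counit r) ∧
    conv P.comul₃
        (tensorFun Coalgebra.counit ν ∘ₗ (TensorProduct.assoc K R R R).toLinearMap)
        (ν ∘ₗ P.mul.lTensor R ∘ₗ (TensorProduct.assoc K R R R).toLinearMap) =
      conv P.comul₃ (tensorFun ν Coalgebra.counit)
        (ν ∘ₗ P.mul.rTensor R ∘ₗ Phi P.comul₂ P.act ξ)}

end PreBialgebra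

end YD

end

/-! Write L = `lam ∘ₗ ξ`, so v = L⁻¹. Applying `lam` to the second leg of the formula for Δ_H ξ and
using that it is a left integral gives ξ * Ψ(L) = L·1_H. Since Ψ turns convolution of functionals
into convolution of H-valued maps, ξ = L·1_H * Ψ(v) (`IsCocycle.eq_conv_Psi`): the cocycle is
determined by L and the coaction.

The maps ε ⊗ R ⊗ R, R ⊗ R ⊗ ε, R ⊗ m and (m ⊗ R)Φ(ξ) are coalgebra maps R ⊗ R ⊗ R → R ⊗ R, and
condition 5 says ξ(R ⊗ m) * (ε ⊗ ξ) = ξ(m ⊗ R)Φ(ξ) * (ξ ⊗ ε). Substituting the factorization of ξ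
and commuting factors past each other (`IsCocycle.conv_Psi_mulRight`, `IsCocycle.conv_Psi_mulLeft`)
leaves an identity between scalar functionals and values of Ψ. Cancelling the invertible scalar part
yields Ψ(∂v) = ∂v·1_H (`IsCocycle.Psi_coboundary`), where ∂v is `dPlus v` convolved with `dMinus ξ
L`. Hence λΨ(∂v) = ∂v, which is (ii) ⇔ (iii). For (i) ⇔ (ii), move the inverse of `dMinus ξ L` to
the other side; v is automatically H-linear and unital. For (iii) ⇔ (iv), λΨ(α)(z) is α evaluated at
λ(z₋₁)z₀, a projection onto the coinvariants.

Two further points are needed. First, ∂²_R(v) really is ∂v: ℧²(v) is v composed with a coalgebra map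
A ⊗ A → R ⊗ R, and the differential on A ⊗ A ⊗ A is pulled back from R ⊗ R ⊗ R along a similar map
(`dR_eq`). Second, L is invertible: L(1 ⊗ 1) = 1, and in the connected coalgebra R a functional
vanishing at 1 acts locally nilpotently, which passes to the braided coalgebra R ⊗ R
(`isReg_of_isConnected`). -/

namespace YD

/-! ### Sweedler calculus -/

section Sweedler

set_option linter.unusedSectionVars false

variable {K : Type*} [Field K]
variable {U V W X M N : Type*} [AddCommMonoid U] [Module K U] [AddCommMonoid V] [Module K V]
  [AddCommMonoid W] [Module K W] [AddCommMonoid X] [Module K X]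
  [AddCommMonoid M] [Module K M] [AddCommMonoid N] [Module K N]

variable (K) in
/-- Unbundled linearity of a map, set up for `fun_prop`. -/
@[fun_prop]
structure IsLin (f : V → W) : Prop where
  add : ∀ x y, f (x + y) = f x + f y
  smul : ∀ (c : K) x, f (c • x) = c • f x

/-- The linear map underlying a map that satisfies `IsLin`. -/
def IsLin.toLin {f : V → W} (hf : IsLin K f) : V →ₗ[K] W := ⟨⟨f, hf.add⟩, hf.smul⟩

/-- The Sweedler sum `∑ f(t₁, t₂)` over a chosen representation `t = ∑ t₁ ⊗ t₂`. -/
noncomputable def sw (t : V ⊗[K] W) (f : V → W → M) : M :=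
  ((TensorProduct.exists_multiset t).choose.map fun p => f p.1 p.2).sum

@[fun_prop] theorem IsLin.id' : IsLin K (fun x : V => x) := ⟨fun _ _ => rfl, fun _ _ => rfl⟩

@[fun_prop] theorem IsLin.comp' {f : W → X} {g : V → W} (hf : IsLin K f) (hg : IsLin K g) :
    IsLin K (fun x => f (g x)) :=
  ⟨fun x y => by rw [hg.add, hf.add], fun c x => by rw [hg.smul, hf.smul]⟩

@[fun_prop] theorem IsLin.map (L : V →ₗ[K] W) {f : X → V} (hf : IsLin K f) :
    IsLin K (fun x => L (f x)) :=
  ⟨fun x y => by rw [hf.add, map_add], fun c x => by rw [hf.smul, map_smul]⟩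

@[fun_prop] theorem IsLin.equiv (L : V ≃ₗ[K] W) {f : X → V} (hf : IsLin K f) :
    IsLin K (fun x => L (f x)) :=
  ⟨fun x y => by rw [hf.add, map_add], fun c x => by rw [hf.smul, map_smul]⟩

@[fun_prop] theorem IsLin.apply {f : X → (V →ₗ[K] W)} (hf : IsLin K f) (v : V) :
    IsLin K (fun x => f x v) :=
  ⟨fun x y => by rw [hf.add, LinearMap.add_apply], fun c x => by
    rw [hf.smul, LinearMap.smul_apply]⟩

@[fun_prop] theorem IsLin.tmul_left {f : X → V} (hf : IsLin K f) (w : W) :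
    IsLin K (fun x => f x ⊗ₜ[K] w) :=
  ⟨fun x y => by rw [hf.add, add_tmul], fun c x => by rw [hf.smul, smul_tmul']⟩

@[fun_prop] theorem IsLin.tmul_right {f : X → W} (v : V) (hf : IsLin K f) :
    IsLin K (fun x => v ⊗ₜ[K] f x) :=
  ⟨fun x y => by rw [hf.add, tmul_add], fun c x => by rw [hf.smul, tmul_smul]⟩

@[fun_prop] theorem IsLin.smul_left {f : X → K} (hf : IsLin K f) (w : W) :
    IsLin K (fun x => f x • w) :=
  ⟨fun x y => by rw [hf.add, add_smul], fun c x => by rw [hf.smul, smul_assoc]⟩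

@[fun_prop] theorem IsLin.smul_right {f : X → W} (c : K) (hf : IsLin K f) :
    IsLin K (fun x => c • f x) :=
  ⟨fun x y => by rw [hf.add, smul_add], fun d x => by rw [hf.smul, smul_comm]⟩

section Alg
variable {B : Type*} [Ring B] [Algebra K B]

@[fun_prop] theorem IsLin.mul_left {f : X → B} (hf : IsLin K f) (w : B) :
    IsLin K (fun x => f x * w) :=
  ⟨fun x y => by rw [hf.add, add_mul], fun c x => by rw [hf.smul, smul_mul_assoc]⟩

@[fun_prop] theorem IsLin.mul_right {f : X → B} (c : B) (hf : IsLin K f) :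
    IsLin K (fun x => c * f x) :=
  ⟨fun x y => by rw [hf.add, mul_add], fun d x => by rw [hf.smul, mul_smul_comm]⟩

end Alg

theorem eq_sw (t : V ⊗[K] W) : sw t (fun a b => a ⊗ₜ[K] b) = t :=
  (TensorProduct.exists_multiset t).choose_spec.symm

theorem map_eq_sw (L : V ⊗[K] W →ₗ[K] M) (t : V ⊗[K] W) :
    L t = sw t fun a b => L (a ⊗ₜ[K] b) := by
  conv_lhs => rw [← eq_sw t, sw, map_multiset_sum, Multiset.map_map]
  rfl

/-- The value of a Sweedler sum of a bilinear function. -/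
theorem sw_eq_lift (t : V ⊗[K] W) (f : V → W → M) (h₁ : ∀ b, IsLin K fun a => f a b)
    (h₂ : ∀ a, IsLin K fun b => f a b) :
    sw t f = TensorProduct.lift (LinearMap.mk₂ K f (fun a a' b => (h₁ b).add a a')
      (fun c a b => (h₁ b).smul c a) (fun a b b' => (h₂ a).add b b')
      (fun c a b => (h₂ a).smul c b)) t := by
  rw [map_eq_sw]; simp

theorem sw_tmul (v : V) (w : W) (f : V → W → M) (h₁ : ∀ b, IsLin K fun a => f a b)
    (h₂ : ∀ a, IsLin K fun b => f a b) : sw (v ⊗ₜ[K] w) f = f v w := by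
  rw [sw_eq_lift _ _ h₁ h₂]; simp

@[fun_prop] theorem IsLin.sw_left {T : X → V ⊗[K] W} (f : V → W → M) (hT : IsLin K T)
    (h₁ : ∀ b, IsLin K fun a => f a b) (h₂ : ∀ a, IsLin K fun b => f a b) :
    IsLin K (fun x => sw (T x) f) := by
  simp only [sw_eq_lift _ _ h₁ h₂]; fun_prop

@[fun_prop] theorem IsLin.sw_right (t : V ⊗[K] W) {f : X → V → W → M}
    (h : ∀ a b, IsLin K fun x => f x a b) : IsLin K (fun x => sw t (f x)) := by
  constructor
  · intro x y; simp only [sw, (h _ _).add, Multiset.sum_map_add]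
  · intro c x; simp only [sw, (h _ _).smul, Multiset.smul_sum, Multiset.map_map,
      Function.comp_def]

theorem IsLin.map_sw {L : M → N} (hL : IsLin K L) (t : V ⊗[K] W) (f : V → W → M) :
    L (sw t f) = sw t fun a b => L (f a b) := by
  have := map_multiset_sum hL.toLin ((TensorProduct.exists_multiset t).choose.map
    fun p => f p.1 p.2)
  rw [Multiset.map_map] at this
  exact this

theorem map_sw (L : M →ₗ[K] N) (t : V ⊗[K] W) (f : V → W → M) :
    L (sw t f) = sw t fun a b => L (f a b) :=
  (IsLin.map L IsLin.id').map_sw t f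

theorem sw_tmul_right (t : V ⊗[K] W) (f : V → W → M) (n : N) :
    sw t f ⊗ₜ[K] n = sw t fun a b => f a b ⊗ₜ[K] n :=
  (IsLin.tmul_left IsLin.id' n).map_sw t f

theorem tmul_sw (t : V ⊗[K] W) (f : V → W → M) (n : N) :
    n ⊗ₜ[K] sw t f = sw t fun a b => n ⊗ₜ[K] f a b :=
  (IsLin.tmul_right n IsLin.id').map_sw t f

theorem smul_sw (t : V ⊗[K] W) (f : V → W → M) (c : K) :
    c • sw t f = sw t fun a b => c • f a b :=
  (IsLin.smul_right c IsLin.id').map_sw t f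

theorem sw_smul (t : V ⊗[K] W) (f : V → W → K) (m : M) :
    sw t f • m = sw t fun a b => f a b • m :=
  (IsLin.smul_left IsLin.id' m).map_sw t f

theorem sw_apply (t : V ⊗[K] W) (f : V → W → (M →ₗ[K] N)) (m : M) :
    sw t f m = sw t fun a b => f a b m :=
  (IsLin.apply IsLin.id' m).map_sw t f

theorem sw_mul {B : Type*} [Ring B] [Algebra K B] (t : V ⊗[K] W) (f : V → W → B) (m : B) :
    sw t f * m = sw t fun a b => f a b * m :=
  (IsLin.mul_left (K := K) IsLin.id' m).map_sw t f

theorem mul_sw {B : Type*} [Ring B] [Algebra K B] (t : V ⊗[K] W) (f : V → W → B) (m : B) :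
    m * sw t f = sw t fun a b => m * f a b :=
  (IsLin.mul_right (K := K) m IsLin.id').map_sw t f

/-- Both sides are finite sums over the same fixed representations of `s` and `t`, so no bilinearity
is required. -/
theorem sw_comm (s : U ⊗[K] V) (t : W ⊗[K] X) (f : U → V → W → X → M) :
    sw s (fun a b => sw t fun c d => f a b c d) = sw t fun c d => sw s fun a b => f a b c d := by
  simp only [sw]; exact Multiset.sum_map_sum_map _ _

theorem sw_sw (t : U ⊗[K] V) (g : U → V → W ⊗[K] X) (f : W → X → M)
    (h₁ : ∀ b, IsLin K fun a => f a b) (h₂ : ∀ a, IsLin K fun b => f a b) :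
    sw (sw t g) f = sw t fun a b => sw (g a b) f :=
  (IsLin.sw_left f (IsLin.id' (K := K)) h₁ h₂).map_sw t g

end Sweedler

end YD

/-! ### Element formulas for actions, coactions, braidings and smash coproducts. -/

namespace YD

section Expansions

set_option linter.unusedSectionVars false

variable {K : Type*} [Field K]
variable {U V W X Y Z M N : Type*} [AddCommMonoid U] [Module K U] [AddCommMonoid V] [Module K V]
  [AddCommMonoid W] [Module K W] [AddCommMonoid X] [Module K X] [AddCommMonoid Y] [Module K Y]
  [AddCommMonoid Z] [Module K Z] [AddCommMonoid M] [Module K M] [AddCommMonoid N] [Module K N]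

theorem IsLin.congr_sw {t : V ⊗[K] W} {f g : V → W → M} (h : ∀ a b, f a b = g a b) :
    sw t f = sw t g := by
  congr 1; funext a b; exact h a b

theorem assoc_rTensor_eq_sw (δ : V →ₗ[K] X ⊗[K] Y) (t : V ⊗[K] W) :
    TensorProduct.assoc K X Y W (δ.rTensor W t) =
      sw t fun a b => sw (δ a) fun c d => c ⊗ₜ[K] (d ⊗ₜ[K] b) := by
  have := map_eq_sw ((TensorProduct.assoc K X Y W).toLinearMap ∘ₗ δ.rTensor W) t
  refine this.trans (IsLin.congr_sw fun a b => ?_)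
  have := map_eq_sw ((TensorProduct.assoc K X Y W).toLinearMap ∘ₗ
    (TensorProduct.mk K (X ⊗[K] Y) W).flip b) (δ a)
  simpa using this

theorem lTensor_eq_sw (δ : W →ₗ[K] X) (t : V ⊗[K] W) :
    δ.lTensor V t = sw t fun a b => a ⊗ₜ[K] δ b := by
  rw [map_eq_sw]; simp

theorem rTensor_eq_sw (δ : V →ₗ[K] X) (t : V ⊗[K] W) :
    δ.rTensor W t = sw t fun a b => δ a ⊗ₜ[K] b := by
  rw [map_eq_sw]; simp

theorem lTensor_eq_sw_sw (δ : W →ₗ[K] X ⊗[K] Y) (t : V ⊗[K] W) :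
    δ.lTensor V t = sw t fun a b => sw (δ b) fun c d => a ⊗ₜ[K] (c ⊗ₜ[K] d) := by
  rw [map_eq_sw]
  refine IsLin.congr_sw fun a b => ?_
  have := map_eq_sw (TensorProduct.mk K V (X ⊗[K] Y) a) (δ b)
  simpa using this

/-- The two maps `δ` and `δ'` may differ, so the same statement serves coassociativity of a
coalgebra and of a coaction. -/
theorem sw_assoc {δ : U →ₗ[K] X ⊗[K] Y} {δ' : V →ₗ[K] Y ⊗[K] W} {t : U ⊗[K] W} {s : X ⊗[K] V}
    (h : TensorProduct.assoc K X Y W (δ.rTensor W t) = δ'.lTensor X s) (F : X → Y → W → M)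
    (h₁ : ∀ b c, IsLin K fun a => F a b c) (h₂ : ∀ a c, IsLin K fun b => F a b c)
    (h₃ : ∀ a b, IsLin K fun c => F a b c) :
    (sw t fun a b => sw (δ a) fun c d => F c d b) =
      sw s fun a b => sw (δ' b) fun c d => F a c d := by
  rw [assoc_rTensor_eq_sw, lTensor_eq_sw_sw] at h
  have := congrArg (fun z => sw z fun a u => sw u fun c d => F a c d) h
  simp (disch := fun_prop) only [sw_sw, sw_tmul] at this
  exact this

end Expansions

section Structures

set_option linter.unusedSectionVars false

variable {K : Type*} [Field K] {H : Type*} [Ring H] [HopfAlgebra K H]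
variable {V W M B : Type*} [AddCommMonoid V] [Module K V]
  [AddCommMonoid W] [Module K W] [AddCommMonoid M] [Module K M] [Ring B] [Algebra K B]

/-- `(V, Δ, ε)` is a coalgebra. -/
structure IsCoalg (Δ : V →ₗ[K] V ⊗[K] V) (ε : V →ₗ[K] K) : Prop where
  coassoc : ∀ x, TensorProduct.assoc K V V V (Δ.rTensor V (Δ x)) = Δ.lTensor V (Δ x)
  counit_left : ∀ x, (sw (Δ x) fun a b => ε a • b) = x
  counit_right : ∀ x, (sw (Δ x) fun a b => ε b • a) = x

/-- `(V, Δ, ε)` is a comodule coalgebra for the coaction `ρ`. -/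
structure IsComodCoalg (Δ : V →ₗ[K] V ⊗[K] V) (ε : V →ₗ[K] K) (ρ : V →ₗ[K] H ⊗[K] V) :
    Prop where
  counit_coact : ∀ v, (sw (ρ v) fun k a => Coalgebra.counit (R := K) k • a) = v
  coassoc_coact : ∀ v, TensorProduct.assoc K H H V
    ((Coalgebra.comul (R := K) (A := H)).rTensor V (ρ v)) = ρ.lTensor H (ρ v)
  comul_coact : ∀ v, Δ.lTensor H (ρ v) = tensorCoact ρ ρ (Δ v)
  counit_colinear : ∀ v, (sw (ρ v) fun k a => ε a • k) = ε v • 1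

/-- `(V, Δ, ε)` is a module coalgebra for the action `μ`. -/
structure IsModCoalg (Δ : V →ₗ[K] V ⊗[K] V) (ε : V →ₗ[K] K) (μ : H →ₗ[K] V →ₗ[K] V) :
    Prop where
  one_act : ∀ v, μ 1 v = v
  mul_act : ∀ g h v, μ (g * h) v = μ g (μ h v)
  comul_act : ∀ h v, Δ (μ h v) = tensorAct μ μ h (Δ v)
  counit_act : ∀ h v, ε (μ h v) = Coalgebra.counit (R := K) h * ε v

/-- The compatibility `(h₁ v)₋₁ h₂ ⊗ (h₁ v)₀ = h₁ v₋₁ ⊗ h₂ v₀` of an action with a coaction. -/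
def IsCompat (μ : H →ₗ[K] V →ₗ[K] V) (ρ : V →ₗ[K] H ⊗[K] V) : Prop :=
  ∀ h v, (sw (Coalgebra.comul (R := K) h) fun a b => sw (ρ (μ a v)) fun k u =>
      (k * b) ⊗ₜ[K] u) =
    sw (Coalgebra.comul (R := K) h) fun a b => sw (ρ v) fun k u => (a * k) ⊗ₜ[K] μ b u

variable {ΔV : V →ₗ[K] V ⊗[K] V} {εV : V →ₗ[K] K} {ρV : V →ₗ[K] H ⊗[K] V}
  {μV : H →ₗ[K] V →ₗ[K] V}
variable {ΔW : W →ₗ[K] W ⊗[K] W} {εW : W →ₗ[K] K} {ρW : W →ₗ[K] H ⊗[K] W}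
  {μW : H →ₗ[K] W →ₗ[K] W}

theorem IsCompat.sw_compat (hc : IsCompat μV ρV) (F : H → V → M)
    (h₁ : ∀ b, IsLin K fun a => F a b) (h₂ : ∀ a, IsLin K fun b => F a b) (h : H) (v : V) :
    (sw (Coalgebra.comul (R := K) h) fun a b => sw (ρV (μV a v)) fun k u => F (k * b) u) =
      sw (Coalgebra.comul (R := K) h) fun a b => sw (ρV v) fun k u => F (a * k) (μV b u) := by
  have := congrArg (fun z => sw z F) (hc h v)
  simp (disch := fun_prop) only [sw_sw, sw_tmul] at this
  exact this

theorem tensorAct_tmul (h : H) (v : V) (w : W) :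
    tensorAct μV μW h (v ⊗ₜ[K] w) =
      sw (Coalgebra.comul (R := K) h) fun a b => μV a v ⊗ₜ[K] μW b w := by
  simp only [tensorAct, LinearMap.comp_apply]
  have := map_eq_sw (((TensorProduct.homTensorHomMap (.id K) V W V W ∘ₗ
    TensorProduct.map μV μW)).flip (v ⊗ₜ[K] w)) (Coalgebra.comul (R := K) h)
  simpa using this

theorem tensorCoact_tmul (v : V) (w : W) :
    tensorCoact ρV ρW (v ⊗ₜ[K] w) =
      sw (ρV v) fun k v₀ => sw (ρW w) fun l w₀ => (k * l) ⊗ₜ[K] (v₀ ⊗ₜ[K] w₀) := by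
  conv_lhs => rw [tensorCoact, LinearMap.comp_apply, LinearMap.comp_apply, map_tmul,
    ← eq_sw (ρV v), ← eq_sw (ρW w)]
  have h₁ : IsLin K fun s => ((LinearMap.mul' K H).rTensor (V ⊗[K] W))
    ((TensorProduct.tensorTensorTensorComm K H V H W).toLinearMap (s ⊗ₜ[K]
      sw (ρW w) fun a b => a ⊗ₜ[K] b)) := by fun_prop
  rw [h₁.map_sw]
  refine IsLin.congr_sw fun a b => ?_
  have h₂ : IsLin K fun s => ((LinearMap.mul' K H).rTensor (V ⊗[K] W))
    ((TensorProduct.tensorTensorTensorComm K H V H W).toLinearMap ((a ⊗ₜ[K] b) ⊗ₜ[K] s)) := by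
    fun_prop
  rw [h₂.map_sw]
  refine IsLin.congr_sw fun c d => ?_
  simp

theorem braid_tmul (v : V) (w : W) :
    braid ρV μW (v ⊗ₜ[K] w) = sw (ρV v) fun k v₀ => μW k w ⊗ₜ[K] v₀ := by
  conv_lhs => simp only [braid, LinearMap.comp_apply, LinearMap.rTensor_tmul]
  conv_lhs => rw [← eq_sw (ρV v)]
  have h₁ : IsLin K fun s => ((TensorProduct.lift μW).rTensor V)
    ((TensorProduct.assoc K H W V).symm.toLinearMap
    ((TensorProduct.comm K V W).toLinearMap.lTensor H
    ((TensorProduct.assoc K H V W).toLinearMap (s ⊗ₜ[K] w)))) := by fun_prop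
  rw [h₁.map_sw]
  refine IsLin.congr_sw fun c d => ?_
  simp

theorem smashComul_tmul (v : V) (w : W) :
    smashComul ΔV ρV ΔW μW (v ⊗ₜ[K] w) = sw (ΔV v) fun v₁ v₂ => sw (ρV v₂) fun k v₀ =>
      sw (ΔW w) fun w₁ w₂ => (v₁ ⊗ₜ[K] μW k w₁) ⊗ₜ[K] (v₀ ⊗ₜ[K] w₂) := by
  conv_lhs => simp only [smashComul, LinearMap.comp_apply, map_tmul]
  conv_lhs => rw [← eq_sw (ΔV v), ← eq_sw (ΔW w)]
  have h₁ : ∀ t, IsLin K fun s => (TensorProduct.assoc K V W (V ⊗[K] W)).symm.toLinearMap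
    (((TensorProduct.assoc K W V W).toLinearMap ∘ₗ (braid ρV μW).rTensor W ∘ₗ
      (TensorProduct.assoc K V W W).symm.toLinearMap).lTensor V
    ((TensorProduct.assoc K V V (W ⊗[K] W)).toLinearMap (s ⊗ₜ[K] t))) := by fun_prop
  have h₂ : ∀ s, IsLin K fun t => (TensorProduct.assoc K V W (V ⊗[K] W)).symm.toLinearMap
    (((TensorProduct.assoc K W V W).toLinearMap ∘ₗ (braid ρV μW).rTensor W ∘ₗ
      (TensorProduct.assoc K V W W).symm.toLinearMap).lTensor V
    ((TensorProduct.assoc K V V (W ⊗[K] W)).toLinearMap (s ⊗ₜ[K] t))) := by fun_prop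
  rw [(h₁ _).map_sw]
  refine IsLin.congr_sw fun a b => ?_
  rw [(h₂ _).map_sw, sw_comm]
  refine IsLin.congr_sw fun c d => ?_
  simp only [LinearEquiv.coe_coe, assoc_tmul, assoc_symm_tmul, LinearMap.lTensor_tmul,
    LinearMap.comp_apply, LinearMap.rTensor_tmul, braid_tmul]
  have h₃ : IsLin K fun s => (TensorProduct.assoc K V W (V ⊗[K] W)).symm.toLinearMap
    (a ⊗ₜ[K] (TensorProduct.assoc K W V W).toLinearMap (s ⊗ₜ[K] d)) := by fun_prop
  exact h₃.map_sw _ _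

theorem tensorComul_tmul (v : V) (w : W) :
    tensorComul ΔV ΔW (v ⊗ₜ[K] w) = sw (ΔV v) fun v₁ v₂ => sw (ΔW w) fun w₁ w₂ =>
      (v₁ ⊗ₜ[K] w₁) ⊗ₜ[K] (v₂ ⊗ₜ[K] w₂) := by
  conv_lhs => rw [tensorComul, LinearMap.comp_apply, map_tmul,
    ← eq_sw (ΔV v), ← eq_sw (ΔW w)]
  have h₁ : ∀ t, IsLin K fun s =>
    (TensorProduct.tensorTensorTensorComm K V V W W).toLinearMap (s ⊗ₜ[K] t) := by fun_prop
  have h₂ : ∀ s, IsLin K fun t =>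
    (TensorProduct.tensorTensorTensorComm K V V W W).toLinearMap (s ⊗ₜ[K] t) := by fun_prop
  rw [(h₁ _).map_sw]
  refine IsLin.congr_sw fun a b => ?_
  rw [(h₂ _).map_sw]
  refine IsLin.congr_sw fun c d => ?_
  simp

theorem conv_eq_sw (f g : V →ₗ[K] B) (v : V) :
    conv ΔV f g v = sw (ΔV v) fun a b => f a * g b := by
  simp only [conv, LinearMap.comp_apply]
  have := map_eq_sw (LinearMap.mul' K B ∘ₗ TensorProduct.map f g) (ΔV v)
  simpa using this

theorem Psi_eq_sw (α : V →ₗ[K] K) (v : V) :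
    Psi ρV α v = sw (ρV v) fun k a => α a • k := by
  simp only [Psi, LinearMap.comp_apply]
  have := map_eq_sw ((TensorProduct.rid K H).toLinearMap ∘ₗ α.lTensor H) (ρV v)
  simpa using this

theorem Phi_tmul (ξ : V →ₗ[K] H) (v : V) (w : W) :
    Phi ΔV μW ξ (v ⊗ₜ[K] w) = sw (ΔV v) fun a b => a ⊗ₜ[K] μW (ξ b) w := by
  conv_lhs => simp only [Phi, LinearMap.comp_apply, LinearMap.rTensor_tmul]
  conv_lhs => rw [← eq_sw (ΔV v)]
  have h₁ : IsLin K fun s => ((TensorProduct.lift (μW ∘ₗ ξ)).lTensor V)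
    ((TensorProduct.assoc K V V W).toLinearMap (s ⊗ₜ[K] w)) := by fun_prop
  rw [h₁.map_sw]
  simp

section Rewriting

variable (F : V ⊗[K] W → V ⊗[K] W → M) (h₁ : ∀ b, IsLin K fun a => F a b)
  (h₂ : ∀ a, IsLin K fun b => F a b)
include h₁ h₂

theorem sw_smashComul (v : V) (w : W) :
    sw (smashComul ΔV ρV ΔW μW (v ⊗ₜ[K] w)) F = sw (ΔV v) fun v₁ v₂ => sw (ρV v₂) fun k v₀ =>
      sw (ΔW w) fun w₁ w₂ => F (v₁ ⊗ₜ[K] μW k w₁) (v₀ ⊗ₜ[K] w₂) := by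
  rw [smashComul_tmul]
  simp (disch := fun_prop) only [sw_sw, sw_tmul]

theorem sw_tensorComul (v : V) (w : W) :
    sw (tensorComul ΔV ΔW (v ⊗ₜ[K] w)) F = sw (ΔV v) fun v₁ v₂ => sw (ΔW w) fun w₁ w₂ =>
      F (v₁ ⊗ₜ[K] w₁) (v₂ ⊗ₜ[K] w₂) := by
  rw [tensorComul_tmul]
  simp (disch := fun_prop) only [sw_sw, sw_tmul]

end Rewriting

theorem sw_tensorCoact (F : H → V ⊗[K] W → M) (h₁ : ∀ b, IsLin K fun a => F a b)
    (h₂ : ∀ a, IsLin K fun b => F a b) (v : V) (w : W) :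
    sw (tensorCoact ρV ρW (v ⊗ₜ[K] w)) F = sw (ρV v) fun k v₀ => sw (ρW w) fun l w₀ =>
      F (k * l) (v₀ ⊗ₜ[K] w₀) := by
  rw [tensorCoact_tmul]
  simp (disch := fun_prop) only [sw_sw, sw_tmul]

theorem sw_tensorAct (F : V → W → M) (h₁ : ∀ b, IsLin K fun a => F a b)
    (h₂ : ∀ a, IsLin K fun b => F a b) (h : H) (t : V ⊗[K] W) :
    sw (tensorAct μV μW h t) F = sw (Coalgebra.comul (R := K) h) fun a b =>
      sw t fun v w => F (μV a v) (μW b w) := by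
  conv_lhs => rw [map_eq_sw (tensorAct μV μW h) t]
  simp (disch := fun_prop) only [tensorAct_tmul, sw_sw, sw_tmul]
  rw [sw_comm]

namespace IsCoalg

variable (hV : IsCoalg ΔV εV)
include hV

theorem sw_coassoc (F : V → V → V → M) (h₁ : ∀ b c, IsLin K fun a => F a b c)
    (h₂ : ∀ a c, IsLin K fun b => F a b c) (h₃ : ∀ a b, IsLin K fun c => F a b c) (x : V) :
    (sw (ΔV x) fun a b => sw (ΔV a) fun c d => F c d b) =
      sw (ΔV x) fun a b => sw (ΔV b) fun c d => F a c d :=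
  sw_assoc (hV.coassoc x) F h₁ h₂ h₃

theorem sw_counit_left (F : V → M) (hF : IsLin K F) (x : V) :
    (sw (ΔV x) fun a b => εV a • F b) = F x := by
  conv_rhs => rw [← hV.counit_left x, hF.map_sw]
  simp only [hF.smul]

theorem sw_counit_right (F : V → M) (hF : IsLin K F) (x : V) :
    (sw (ΔV x) fun a b => εV b • F a) = F x := by
  conv_rhs => rw [← hV.counit_right x, hF.map_sw]
  simp only [hF.smul]

end IsCoalg

namespace IsComodCoalg

variable (hV : IsComodCoalg ΔV εV ρV)
include hV

theorem sw_coassoc_coact (F : H → H → V → M) (h₁ : ∀ b c, IsLin K fun a => F a b c)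
    (h₂ : ∀ a c, IsLin K fun b => F a b c) (h₃ : ∀ a b, IsLin K fun c => F a b c) (x : V) :
    (sw (ρV x) fun a b => sw (ρV b) fun c d => F a c d) =
      sw (ρV x) fun a b => sw (Coalgebra.comul (R := K) a) fun c d => F c d b :=
  (sw_assoc (hV.coassoc_coact x) F h₁ h₂ h₃).symm

theorem sw_counit_coact (F : V → M) (hF : IsLin K F) (x : V) :
    (sw (ρV x) fun a b => Coalgebra.counit (R := K) a • F b) = F x := by
  conv_rhs => rw [← hV.counit_coact x, hF.map_sw]
  simp only [hF.smul]

theorem sw_comul_coact (F : H → V → V → M) (h₁ : ∀ b c, IsLin K fun a => F a b c)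
    (h₂ : ∀ a c, IsLin K fun b => F a b c) (h₃ : ∀ a b, IsLin K fun c => F a b c) (x : V) :
    (sw (ρV x) fun k v => sw (ΔV v) fun a b => F k a b) =
      sw (ΔV x) fun a b => sw (ρV a) fun k a₀ => sw (ρV b) fun l b₀ => F (k * l) a₀ b₀ := by
  have := hV.comul_coact x
  rw [lTensor_eq_sw_sw, map_eq_sw (tensorCoact ρV ρV)] at this
  simp only [tensorCoact_tmul] at this
  have := congrArg (fun z => sw z fun a u => sw u fun c d => F a c d) this
  simp (disch := fun_prop) only [sw_sw, sw_tmul] at this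
  exact this

theorem sw_counit_colinear (F : H → M) (hF : IsLin K F) (x : V) :
    (sw (ρV x) fun k a => εV a • F k) = εV x • F 1 := by
  rw [← hF.smul, ← hV.counit_colinear x, hF.map_sw]
  simp only [hF.smul]

end IsComodCoalg

namespace IsModCoalg

variable (hV : IsModCoalg ΔV εV μV)
include hV

theorem sw_comul_act (F : V → V → M) (h₁ : ∀ b, IsLin K fun a => F a b)
    (h₂ : ∀ a, IsLin K fun b => F a b) (h : H) (x : V) :
    sw (ΔV (μV h x)) F = sw (Coalgebra.comul (R := K) h) fun a b =>
      sw (ΔV x) fun v w => F (μV a v) (μV b w) := by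
  rw [hV.comul_act, sw_tensorAct _ h₁ h₂]

end IsModCoalg

theorem isCoalg_coalgebra (V : Type*) [AddCommMonoid V] [Module K V] [Coalgebra K V] :
    IsCoalg (Coalgebra.comul (R := K) (A := V)) Coalgebra.counit where
  coassoc := Coalgebra.coassoc_apply
  counit_left x := by
    have := Coalgebra.rTensor_counit_comul (R := K) x
    rw [map_eq_sw] at this
    have := congrArg (TensorProduct.lid K V) this
    rw [(show IsLin K fun z => TensorProduct.lid K V z from ⟨map_add _, map_smul _⟩).map_sw]
      at this
    simpa using this
  counit_right x := by
    have := Coalgebra.lTensor_counit_comul (R := K) x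
    rw [map_eq_sw] at this
    have := congrArg (TensorProduct.rid K V) this
    rw [(show IsLin K fun z => TensorProduct.rid K V z from ⟨map_add _, map_smul _⟩).map_sw]
      at this
    simpa using this

end Structures

end YD

/-! ### Smash coproducts of Yetter-Drinfeld coalgebras. -/

namespace YD

section Smash

set_option linter.unusedSectionVars false

variable {K : Type*} [Field K] {H : Type*} [Ring H] [HopfAlgebra K H]
variable {V W M B : Type*} [AddCommMonoid V] [Module K V]
  [AddCommMonoid W] [Module K W] [AddCommMonoid M] [Module K M] [Ring B] [Algebra K B]
variable {ΔV : V →ₗ[K] V ⊗[K] V} {εV : V →ₗ[K] K} {ρV : V →ₗ[K] H ⊗[K] V}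
  {μV : H →ₗ[K] V →ₗ[K] V}
variable {ΔW : W →ₗ[K] W ⊗[K] W} {εW : W →ₗ[K] K} {ρW : W →ₗ[K] H ⊗[K] W}
  {μW : H →ₗ[K] W →ₗ[K] W}

theorem IsLin.eq_of_tmul {f g : V ⊗[K] W → M} (hf : IsLin K f) (hg : IsLin K g)
    (h : ∀ v w, f (v ⊗ₜ[K] w) = g (v ⊗ₜ[K] w)) (x : V ⊗[K] W) : f x = g x :=
  LinearMap.congr_fun (f := hf.toLin) (g := hg.toLin) (TensorProduct.ext' h) x

theorem sw_comul_mul (F : H → H → M) (h₁ : ∀ b, IsLin K fun a => F a b)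
    (h₂ : ∀ a, IsLin K fun b => F a b) (g h : H) :
    sw (Coalgebra.comul (R := K) (g * h)) F = sw (Coalgebra.comul (R := K) g) fun g₁ g₂ =>
      sw (Coalgebra.comul (R := K) h) fun h₁ h₂ => F (g₁ * h₁) (g₂ * h₂) := by
  have : Coalgebra.comul (R := K) (g * h) = sw (Coalgebra.comul (R := K) g) fun g₁ g₂ =>
      sw (Coalgebra.comul (R := K) h) fun h₁ h₂ => (g₁ * h₁) ⊗ₜ[K] (g₂ * h₂) := by
    rw [Bialgebra.comul_mul]
    conv_lhs => rw [← eq_sw (Coalgebra.comul (R := K) g), ← eq_sw (Coalgebra.comul (R := K) h)]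
    rw [(show IsLin K fun z : H ⊗[K] H => z * _ by fun_prop).map_sw]
    refine IsLin.congr_sw fun a b => ?_
    rw [(show IsLin K fun z : H ⊗[K] H => (a ⊗ₜ[K] b) * z by fun_prop).map_sw]
    refine IsLin.congr_sw fun c d => ?_
    simp
  rw [this]
  simp (disch := fun_prop) only [sw_sw, sw_tmul]

theorem tensorFun_tmul (f : V →ₗ[K] K) (g : W →ₗ[K] K) (v : V) (w : W) :
    tensorFun f g (v ⊗ₜ[K] w) = f v * g w := by
  simp [tensorFun]

/-- Only the coaction on `V` and the action on `W` enter. This generality covers R ⊗ R, (R ⊗ R) ⊗ R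
and the smash coproduct R # H at once. -/
theorem isCoalg_smashComul (hV : IsCoalg ΔV εV) (hVc : IsComodCoalg ΔV εV ρV)
    (hW : IsCoalg ΔW εW) (hWm : IsModCoalg ΔW εW μW) :
    IsCoalg (smashComul ΔV ρV ΔW μW) (tensorFun εV εW) where
  coassoc := by
    refine LinearMap.congr_fun (f := (TensorProduct.assoc K _ _ _).toLinearMap ∘ₗ
      LinearMap.rTensor _ _ ∘ₗ _) (g := LinearMap.lTensor _ _ ∘ₗ _)
      (TensorProduct.ext' fun v w => ?_)
    simp only [LinearMap.comp_apply, LinearEquiv.coe_coe]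
    rw [assoc_rTensor_eq_sw, lTensor_eq_sw_sw]
    simp (disch := fun_prop) only [sw_smashComul, hWm.sw_comul_act]
    simp only [sw_comm (ΔW w)]
    simp (disch := fun_prop) only [hVc.sw_comul_coact, hVc.sw_coassoc_coact, ← hV.sw_coassoc,
      ← hW.sw_coassoc]
    simp only [hWm.mul_act]
    refine IsLin.congr_sw fun a b => ?_
    rw [sw_comm]
    refine IsLin.congr_sw fun c d => ?_
    rw [sw_comm]
  counit_left := by
    refine fun x => ((?_ : IsLin K fun x => sw (smashComul ΔV ρV ΔW μW x)
      fun a b => tensorFun εV εW a • b).eq_of_tmul IsLin.id' (fun v w => ?_) x)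
    · fun_prop
    simp (disch := fun_prop) only [sw_smashComul, tensorFun_tmul, hWm.counit_act]
    have h : ∀ v₁ v₂, (sw (ρV v₂) fun k v₀ => sw (ΔW w) fun w₁ w₂ =>
        (εV v₁ * (Coalgebra.counit (R := K) k * εW w₁)) • v₀ ⊗ₜ[K] w₂) =
        εV v₁ • v₂ ⊗ₜ[K] w := fun v₁ v₂ => by
      simp only [mul_smul]
      rw [← hVc.sw_counit_coact (fun v₂ => εV v₁ • v₂ ⊗ₜ[K] w) (by fun_prop)]
      refine IsLin.congr_sw fun k v₀ => ?_
      rw [← hW.sw_counit_left (fun w => Coalgebra.counit (R := K) k • εV v₁ • v₀ ⊗ₜ[K] w)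
        (by fun_prop)]
      refine IsLin.congr_sw fun a b => ?_
      simp only [smul_smul]; congr 1; ring
    simp only [h]
    exact hV.sw_counit_left (fun v => v ⊗ₜ[K] w) (by fun_prop) v
  counit_right := by
    refine fun x => ((?_ : IsLin K fun x => sw (smashComul ΔV ρV ΔW μW x)
      fun a b => tensorFun εV εW b • a).eq_of_tmul IsLin.id' (fun v w => ?_) x)
    · fun_prop
    simp (disch := fun_prop) only [sw_smashComul, tensorFun_tmul, mul_smul]
    have h : ∀ v₁ v₂ : V, (sw (ρV v₂) fun k v₀ => sw (ΔW w) fun w₁ w₂ =>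
        εV v₀ • εW w₂ • v₁ ⊗ₜ[K] μW k w₁) = εV v₂ • v₁ ⊗ₜ[K] w := fun v₁ v₂ => by
      have := hVc.sw_counit_colinear (fun k => v₁ ⊗ₜ[K] μW k w) (by fun_prop) v₂
      rw [hWm.one_act] at this
      rw [← this]
      refine IsLin.congr_sw fun k v₀ => ?_
      refine (IsLin.congr_sw fun _ _ => smul_comm _ _ _).trans ?_
      exact hW.sw_counit_right (fun w => εV v₀ • v₁ ⊗ₜ[K] μW k w) (by fun_prop) w
    simp only [h]
    exact hV.sw_counit_right (fun v => v ⊗ₜ[K] w) (by fun_prop) v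

theorem isComodCoalg_tensorCoact (hVc : IsComodCoalg ΔV εV ρV) (hWc : IsComodCoalg ΔW εW ρW)
    (hcW : IsCompat μW ρW) :
    IsComodCoalg (smashComul ΔV ρV ΔW μW) (tensorFun εV εW) (tensorCoact ρV ρW) where
  counit_coact := by
    refine fun x => ((?_ : IsLin K fun x => sw (tensorCoact ρV ρW x)
      fun a b => Coalgebra.counit (R := K) a • b).eq_of_tmul IsLin.id' (fun v w => ?_) x)
    · fun_prop
    simp (disch := fun_prop) only [sw_tensorCoact, Bialgebra.counit_mul, mul_smul]
    rw [← hVc.sw_counit_coact (fun v => v ⊗ₜ[K] w) (by fun_prop)]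
    refine IsLin.congr_sw fun k v₀ => ?_
    refine (IsLin.congr_sw fun _ _ => smul_comm _ _ _).trans ?_
    exact hWc.sw_counit_coact (fun w => Coalgebra.counit (R := K) k • v₀ ⊗ₜ[K] w)
      (by fun_prop) w
  coassoc_coact := by
    refine LinearMap.congr_fun (f := (TensorProduct.assoc K _ _ _).toLinearMap ∘ₗ
      LinearMap.rTensor _ _ ∘ₗ _) (g := LinearMap.lTensor _ _ ∘ₗ _)
      (TensorProduct.ext' fun v w => ?_)
    simp only [LinearMap.comp_apply, LinearEquiv.coe_coe]
    rw [assoc_rTensor_eq_sw, lTensor_eq_sw_sw]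
    simp (disch := fun_prop) only [sw_tensorCoact, sw_comul_mul]
    simp only [sw_comm (ρW w)]
    simp (disch := fun_prop) only [hVc.sw_coassoc_coact, hWc.sw_coassoc_coact]
  comul_coact := by
    refine LinearMap.congr_fun (f := LinearMap.lTensor _ _ ∘ₗ _) (g := tensorCoact _ _ ∘ₗ _)
      (TensorProduct.ext' fun v w => ?_)
    simp only [LinearMap.comp_apply]
    rw [lTensor_eq_sw_sw, map_eq_sw (tensorCoact (tensorCoact ρV ρW) _)]
    rw [sw_tensorCoact _ (by fun_prop) (by fun_prop)]
    simp only [tensorCoact_tmul]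
    simp (disch := fun_prop) only [sw_tensorCoact, sw_smashComul]
    simp only [sw_comm (ρW w)]
    simp (disch := fun_prop) only [hVc.sw_comul_coact, hWc.sw_comul_coact]
    refine IsLin.congr_sw fun v₁ v₂ => ?_
    simp only [sw_comm _ (ρV v₁)]
    simp only [sw_comm _ (ΔW w)]
    refine IsLin.congr_sw fun w₁ w₂ => IsLin.congr_sw fun k v₁ => ?_
    simp only [sw_comm _ (ρW w₂)]
    refine IsLin.congr_sw fun l w₂ => ?_
    have h : ∀ k' v₂, (sw (ρW (μW k' w₁)) fun l' w₀ => sw (ρV v₂) fun m v₃ =>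
        (k * l' * (m * l)) ⊗ₜ[K] (v₁ ⊗ₜ[K] w₀ ⊗ₜ[K] (v₃ ⊗ₜ[K] w₂))) =
        sw (ρV v₂) fun m v₃ => sw (ρW (μW k' w₁)) fun l' w₀ =>
        (k * l' * (m * l)) ⊗ₜ[K] (v₁ ⊗ₜ[K] w₀ ⊗ₜ[K] (v₃ ⊗ₜ[K] w₂)) := fun _ _ => sw_comm _ _ _
    simp only [h]
    simp (disch := fun_prop) only [hVc.sw_coassoc_coact]
    refine IsLin.congr_sw fun m v₃ => ?_
    -- Both sides now differ only by the order of acting on `w₁` and coacting on it; the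
    -- Yetter-Drinfeld condition on `W` settles this.
    have := hcW.sw_compat (fun x w₀ => (k * x * l) ⊗ₜ[K] (v₁ ⊗ₜ[K] w₀ ⊗ₜ[K] (v₃ ⊗ₜ[K] w₂)))
      (by fun_prop) (by fun_prop) m w₁
    simp only [mul_assoc] at this ⊢
    exact this.symm
  counit_colinear := by
    refine fun x => ((?_ : IsLin K fun x => sw (tensorCoact ρV ρW x)
      fun a b => tensorFun εV εW b • a).eq_of_tmul (?_ : IsLin K fun x =>
        tensorFun εV εW x • (1 : H)) (fun v w => ?_) x)
    · fun_prop
    · fun_prop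
    simp (disch := fun_prop) only [sw_tensorCoact, tensorFun_tmul, mul_smul]
    have h : ∀ k, (sw (ρW w) fun l w₀ => εW w₀ • (k * l)) = εW w • (k * 1) := fun k =>
      hWc.sw_counit_colinear (fun l => k * l) (by fun_prop) w
    have h' := hVc.sw_counit_colinear (fun l => εW w • l) (by fun_prop) v
    rw [← h']
    refine IsLin.congr_sw fun k v₀ => ?_
    rw [← mul_one k, ← h, (IsLin.smul_right (εV v₀) IsLin.id').map_sw]
    simp

/-- The compatibility is applied to h₁ ⊗ h₂ while a third leg of h is carried along; coassociativity
of H allows this. -/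
theorem IsCompat.sw_compat₃ (hc : IsCompat μV ρV) (F : H → V → H → M)
    (h₁ : ∀ b c, IsLin K fun a => F a b c) (h₂ : ∀ a c, IsLin K fun b => F a b c)
    (h₃ : ∀ a b, IsLin K fun c => F a b c) (h : H) (v : V) :
    (sw (Coalgebra.comul (R := K) h) fun a b => sw (Coalgebra.comul (R := K) b) fun c d =>
      sw (ρV (μV a v)) fun k u => F (k * c) u d) =
    sw (Coalgebra.comul (R := K) h) fun a b => sw (Coalgebra.comul (R := K) b) fun c d =>
      sw (ρV v) fun k u => F (a * k) (μV c u) d := by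
  have hH := isCoalg_coalgebra (K := K) H
  simp (disch := fun_prop) only [← hH.sw_coassoc]
  refine IsLin.congr_sw fun a b => ?_
  exact hc.sw_compat (fun k u => F k u b) (by fun_prop) (by fun_prop) a v

/-- In h(v ⊗ w), the leg of h on v₂ is followed by the coaction, whose H-part then acts on w₁.
Reordering this is exactly the Yetter-Drinfeld condition on `V`. -/
theorem comul_act_smashComul (hV : IsModCoalg ΔV εV μV) (hc : IsCompat μV ρV)
    (hW : IsModCoalg ΔW εW μW) (h : H) (z : V ⊗[K] W) :
    smashComul ΔV ρV ΔW μW (tensorAct μV μW h z) =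
      tensorAct (tensorAct μV μW) (tensorAct μV μW) h (smashComul ΔV ρV ΔW μW z) := by
  refine LinearMap.congr_fun (f := smashComul ΔV ρV ΔW μW ∘ₗ tensorAct μV μW h) (g := _ ∘ₗ _)
    (TensorProduct.ext' fun v w => ?_) z
  simp only [LinearMap.comp_apply]
  have hH := isCoalg_coalgebra (K := K) H
  rw [map_eq_sw (tensorAct (tensorAct μV μW) (tensorAct μV μW) h)]
  simp only [tensorAct_tmul, map_sw, smashComul_tmul]
  simp (disch := fun_prop) only [sw_sw, sw_tmul, hV.sw_comul_act, hW.sw_comul_act]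
  simp only [tensorAct_tmul, ← hW.mul_act, sw_tmul_right, tmul_sw]
  simp only [sw_comm _ (ΔV v)]
  refine IsLin.congr_sw fun v₁ v₂ => ?_
  simp only [sw_comm _ (ΔW w)]
  refine IsLin.congr_sw fun w₁ w₂ => ?_
  simp (disch := fun_prop) only [hH.sw_coassoc]
  conv_rhs => enter [2, k, u, 2, a, b]; rw [sw_comm]
  simp (disch := fun_prop) only [hH.sw_coassoc]
  simp only [sw_comm (ρV v₂)]
  refine IsLin.congr_sw fun a b => ?_
  conv_lhs => enter [2, c, d]; rw [sw_comm]
  exact hc.sw_compat₃ (fun k u d => (μV a v₁ ⊗ₜ[K] μW k w₁) ⊗ₜ[K] (u ⊗ₜ[K] μW d w₂))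
    (by fun_prop) (by fun_prop) (by fun_prop) b v₂

end Smash

end YD

/-! ### Convolution algebras, coalgebra maps and the map Ψ. -/

namespace YD

section Convolution

set_option linter.unusedSectionVars false

variable {K : Type*} [Field K] {H : Type*} [Ring H] [HopfAlgebra K H]
variable {V W X M B : Type*} [AddCommMonoid V] [Module K V]
  [AddCommMonoid W] [Module K W] [AddCommMonoid X] [Module K X]
  [AddCommMonoid M] [Module K M] [Ring B] [Algebra K B]
variable {ΔV : V →ₗ[K] V ⊗[K] V} {εV : V →ₗ[K] K} {ρV : V →ₗ[K] H ⊗[K] V}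
  {μV : H →ₗ[K] V →ₗ[K] V}
variable {ΔW : W →ₗ[K] W ⊗[K] W} {εW : W →ₗ[K] K} {ρW : W →ₗ[K] H ⊗[K] W}
  {μW : H →ₗ[K] W →ₗ[K] W} {ΔX : X →ₗ[K] X ⊗[K] X}

variable (B) in
/-- A functional viewed as a map to the scalars of an algebra `B`. -/
noncomputable def scalar (f : V →ₗ[K] K) : V →ₗ[K] B := Algebra.linearMap K B ∘ₗ f

theorem scalar_apply (f : V →ₗ[K] K) (x : V) : scalar B f x = f x • 1 := by
  simp [scalar, Algebra.algebraMap_eq_smul_one]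

theorem conv_scalar (f g : V →ₗ[K] K) :
    conv ΔV (scalar B f) (scalar B g) = scalar B (conv ΔV f g) := by
  ext x
  simp [conv_eq_sw, scalar_apply, sw_smul, smul_smul, mul_comm]

theorem IsCoalg.conv_assoc (hV : IsCoalg ΔV εV) (f g h : V →ₗ[K] B) :
    conv ΔV (conv ΔV f g) h = conv ΔV f (conv ΔV g h) := by
  ext x
  simp only [conv_eq_sw, sw_mul, mul_sw, mul_assoc]
  exact hV.sw_coassoc (fun a b c => f a * (g b * h c)) (by fun_prop) (by fun_prop)
    (by fun_prop) x

theorem IsCoalg.scalar_counit_conv (hV : IsCoalg ΔV εV) (f : V →ₗ[K] B) :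
    conv ΔV (scalar B εV) f = f := by
  ext x
  simp only [conv_eq_sw, scalar_apply, smul_mul_assoc, one_mul]
  exact hV.sw_counit_left f (by fun_prop) x

theorem IsCoalg.conv_scalar_counit (hV : IsCoalg ΔV εV) (f : V →ₗ[K] B) :
    conv ΔV f (scalar B εV) = f := by
  ext x
  simp only [conv_eq_sw, scalar_apply, mul_smul_comm, mul_one]
  exact hV.sw_counit_right f (by fun_prop) x

theorem IsCoalg.counit_conv (hV : IsCoalg ΔV εV) (f : V →ₗ[K] K) : conv ΔV εV f = f :=
  hV.scalar_counit_conv f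

theorem IsCoalg.conv_counit (hV : IsCoalg ΔV εV) (f : V →ₗ[K] K) : conv ΔV f εV = f :=
  hV.conv_scalar_counit f

theorem IsCoalg.isConvInv_unique (hV : IsCoalg ΔV εV) {f g g' : V →ₗ[K] K}
    (h : IsConvInv ΔV εV f g) (h' : IsConvInv ΔV εV f g') : g = g' := by
  rw [← hV.conv_counit g, ← h'.1, ← hV.conv_assoc, h.2, hV.counit_conv]

theorem IsCoalg.convInv_eq (hV : IsCoalg ΔV εV) {f g : V →ₗ[K] K}
    (h : IsConvInv ΔV εV f g) : convInv ΔV εV f = g := by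
  have h' : IsReg ΔV εV f := ⟨g, h⟩
  rw [convInv, dif_pos h']
  exact hV.isConvInv_unique h'.choose_spec h

theorem IsConvInv.symm {f g : V →ₗ[K] K} (h : IsConvInv ΔV εV f g) : IsConvInv ΔV εV g f :=
  ⟨h.2, h.1⟩

theorem IsCoalg.isConvInv_conv (hV : IsCoalg ΔV εV) {f g f' g' : V →ₗ[K] K}
    (h : IsConvInv ΔV εV f g) (h' : IsConvInv ΔV εV f' g') :
    IsConvInv ΔV εV (conv ΔV f f') (conv ΔV g' g) := by
  constructor
  · rw [hV.conv_assoc, ← hV.conv_assoc f', h'.1, hV.counit_conv, h.1]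
  · rw [hV.conv_assoc, ← hV.conv_assoc g, h.2, hV.counit_conv, h'.2]

theorem IsReg.isConvInv_convInv {f : V →ₗ[K] K} (h : IsReg ΔV εV f) :
    IsConvInv ΔV εV f (convInv ΔV εV f) := by
  rw [convInv, dif_pos h]; exact h.choose_spec

/-- The comultiplications of `V` and `W` are compatible with `f : V → W`. -/
def IsComulMap (ΔV : V →ₗ[K] V ⊗[K] V) (ΔW : W →ₗ[K] W ⊗[K] W) (f : V →ₗ[K] W) : Prop :=
  ∀ x, ΔW (f x) = sw (ΔV x) fun a b => f a ⊗ₜ[K] f b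

theorem IsComulMap.sw_map {f : V →ₗ[K] W} (hf : IsComulMap ΔV ΔW f) (F : W → W → M)
    (h₁ : ∀ b, IsLin K fun a => F a b) (h₂ : ∀ a, IsLin K fun b => F a b) (x : V) :
    sw (ΔW (f x)) F = sw (ΔV x) fun a b => F (f a) (f b) := by
  rw [hf x]
  simp (disch := fun_prop) only [sw_sw, sw_tmul]

theorem IsComulMap.comp {f : V →ₗ[K] W} {g : W →ₗ[K] X} (hg : IsComulMap ΔW ΔX g)
    (hf : IsComulMap ΔV ΔW f) : IsComulMap ΔV ΔX (g ∘ₗ f) := fun x => by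
  rw [LinearMap.comp_apply, hg, hf.sw_map _ (by fun_prop) (by fun_prop)]
  rfl

theorem IsComulMap.conv_comp {π : V →ₗ[K] W} (hπ : IsComulMap ΔV ΔW π) (f g : W →ₗ[K] B) :
    conv ΔV (f ∘ₗ π) (g ∘ₗ π) = conv ΔW f g ∘ₗ π := by
  ext x
  rw [LinearMap.comp_apply, conv_eq_sw, conv_eq_sw, hπ.sw_map _ (by fun_prop) (by fun_prop)]
  rfl

theorem IsConvInv.comp {π : V →ₗ[K] W} (hπ : IsComulMap ΔV ΔW π) (hε : εW ∘ₗ π = εV)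
    {f g : W →ₗ[K] K} (h : IsConvInv ΔW εW f g) : IsConvInv ΔV εV (f ∘ₗ π) (g ∘ₗ π) := by
  constructor
  · rw [hπ.conv_comp, h.1, hε]
  · rw [hπ.conv_comp, h.2, hε]

/-- Colinearity of Δ identifies the product of the H-parts of x₁ and x₂ with the H-part of x. With
`Psi_counit`, this makes Ψ an algebra map from functionals to H-valued maps. -/
theorem IsComodCoalg.conv_Psi (hV : IsComodCoalg ΔV εV ρV) (f g : V →ₗ[K] K) :
    conv ΔV (Psi ρV f) (Psi ρV g) = Psi ρV (conv ΔV f g) := by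
  ext x
  simp only [conv_eq_sw, Psi_eq_sw, sw_mul, mul_sw, sw_smul, smul_mul_smul_comm]
  rw [hV.sw_comul_coact (fun k a b => (f a * g b) • k) (by fun_prop) (by fun_prop)
    (by fun_prop)]
  exact IsLin.congr_sw fun _ _ => sw_comm _ _ _

theorem IsComodCoalg.Psi_counit (hV : IsComodCoalg ΔV εV ρV) :
    Psi ρV εV = scalar H εV := by
  ext x
  rw [Psi_eq_sw, hV.counit_colinear, scalar_apply]

/-- Expand g(kx) as g(k₁x₁) f(x₂) g(x₃) with ε(k₂) inserted. Linearity of f turns the middle into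
f(k₂x₂), and then g * f = ε collapses the first two factors at k x₁. No antipode is needed. -/
theorem IsHLinear.isConvInv (hV : IsCoalg ΔV εV) (hVm : IsModCoalg ΔV εV μV)
    {f g : V →ₗ[K] K} (hf : IsHLinear μV f) (h : IsConvInv ΔV εV f g) : IsHLinear μV g := by
  intro k x
  have hH := isCoalg_coalgebra (K := K) H
  have e₁ : ∀ y, (sw (ΔV y) fun a b => f a * g b) = εV y := fun y => by
    rw [← conv_eq_sw, h.1]
  have e₂ : ∀ l y, (sw (Coalgebra.comul (R := K) l) fun p q => sw (ΔV y) fun a b =>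
      g (μV p a) * f (μV q b)) = Coalgebra.counit (R := K) l * εV y := fun l y => by
    rw [← hVm.counit_act, ← h.2, conv_eq_sw,
      hVm.sw_comul_act _ (by fun_prop) (by fun_prop)]
  calc g (μV k x) = sw (ΔV x) fun a b => εV b • g (μV k a) :=
        (hV.sw_counit_right (fun a => g (μV k a)) (by fun_prop) x).symm
    _ = sw (ΔV x) fun a b => sw (Coalgebra.comul (R := K) k) fun p q =>
          Coalgebra.counit (R := K) q • εV b • g (μV p a) := by
        refine IsLin.congr_sw fun a b => ?_
        rw [hH.sw_counit_right (fun p => εV b • g (μV p a)) (by fun_prop)]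
    _ = sw (ΔV x) fun a b => sw (Coalgebra.comul (R := K) k) fun p q =>
          sw (ΔV b) fun c d => g (μV p a) * f (μV q c) * g d := by
        refine IsLin.congr_sw fun a b => IsLin.congr_sw fun p q => ?_
        simp only [hf q _, ← e₁ b, smul_eq_mul, sw_mul, mul_sw]
        refine IsLin.congr_sw fun c d => ?_
        ring
    _ = sw (ΔV x) fun a b => sw (ΔV b) fun c d => sw (Coalgebra.comul (R := K) k) fun p q =>
          g (μV p a) * f (μV q c) * g d := by
        refine IsLin.congr_sw fun a b => sw_comm _ _ _
    _ = sw (ΔV x) fun b d => sw (ΔV b) fun a c => sw (Coalgebra.comul (R := K) k) fun p q =>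
          g (μV p a) * f (μV q c) * g d := by
        rw [hV.sw_coassoc (fun a c d => sw (Coalgebra.comul (R := K) k) fun p q =>
          g (μV p a) * f (μV q c) * g d) (by fun_prop) (by fun_prop) (by fun_prop)]
    _ = sw (ΔV x) fun b d => (Coalgebra.counit (R := K) k * εV b) * g d := by
        refine IsLin.congr_sw fun b d => ?_
        rw [← e₂, sw_comm, sw_mul]
        refine IsLin.congr_sw fun a c => ?_
        rw [sw_mul]
    _ = Coalgebra.counit (R := K) k * g x := by
        rw [← hV.sw_counit_left g (by fun_prop) x, mul_sw]
        refine IsLin.congr_sw fun b d => ?_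
        simp [mul_assoc]

/-- The usual tensor product of two coalgebras is a coalgebra. -/
theorem isCoalg_tensorComul (hV : IsCoalg ΔV εV) (hW : IsCoalg ΔW εW) :
    IsCoalg (tensorComul ΔV ΔW) (tensorFun εV εW) where
  coassoc := by
    refine LinearMap.congr_fun (f := (TensorProduct.assoc K _ _ _).toLinearMap ∘ₗ
      LinearMap.rTensor _ _ ∘ₗ _) (g := LinearMap.lTensor _ _ ∘ₗ _)
      (TensorProduct.ext' fun v w => ?_)
    simp only [LinearMap.comp_apply, LinearEquiv.coe_coe]
    rw [assoc_rTensor_eq_sw, lTensor_eq_sw_sw]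
    simp (disch := fun_prop) only [sw_tensorComul]
    simp only [sw_comm (ΔW w)]
    simp (disch := fun_prop) only [hV.sw_coassoc, hW.sw_coassoc]
  counit_left := by
    refine fun x => ((?_ : IsLin K fun x => sw (tensorComul ΔV ΔW x)
      fun a b => tensorFun εV εW a • b).eq_of_tmul IsLin.id' (fun v w => ?_) x)
    · fun_prop
    simp (disch := fun_prop) only [sw_tensorComul, tensorFun_tmul, mul_smul]
    rw [← hV.sw_counit_left (fun v => v ⊗ₜ[K] w) (by fun_prop) v]
    refine IsLin.congr_sw fun a b => ?_
    rw [← hW.sw_counit_left (fun w => εV a • b ⊗ₜ[K] w) (by fun_prop) w]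
    exact IsLin.congr_sw fun _ _ => smul_comm _ _ _
  counit_right := by
    refine fun x => ((?_ : IsLin K fun x => sw (tensorComul ΔV ΔW x)
      fun a b => tensorFun εV εW b • a).eq_of_tmul IsLin.id' (fun v w => ?_) x)
    · fun_prop
    simp (disch := fun_prop) only [sw_tensorComul, tensorFun_tmul, mul_smul]
    rw [← hV.sw_counit_right (fun v => v ⊗ₜ[K] w) (by fun_prop) v]
    refine IsLin.congr_sw fun a b => ?_
    rw [← hW.sw_counit_right (fun w => εV b • a ⊗ₜ[K] w) (by fun_prop) w]
    exact IsLin.congr_sw fun _ _ => smul_comm _ _ _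

end Convolution

end YD

/-! ### The Yetter-Drinfeld coalgebras R ⊗ R and R ⊗ R ⊗ R. -/

namespace YD

set_option linter.unusedSectionVars false

theorem equiv_sw {K V W M N : Type*} [Field K] [AddCommMonoid V] [Module K V] [AddCommMonoid W]
    [Module K W] [AddCommMonoid M] [Module K M] [AddCommMonoid N] [Module K N] (L : M ≃ₗ[K] N)
    (t : V ⊗[K] W) (f : V → W → M) : L (sw t f) = sw t fun a b => L (f a b) :=
  map_sw L.toLinearMap t f

section

variable {K : Type*} [Field K] {H : Type*} [Ring H] [HopfAlgebra K H]

theorem sandwich_tmul (a c x : H) :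
    sandwich K H (a ⊗ₜ[K] c) x = a * x * HopfAlgebra.antipode K c := by
  simp [sandwich]

theorem sw_antipode_mul {M : Type*} [AddCommMonoid M] [Module K M] (F : H → M) (hF : IsLin K F)
    (h : H) : (sw (Coalgebra.comul (R := K) h) fun a b => F (HopfAlgebra.antipode K a * b)) =
      Coalgebra.counit (R := K) h • F 1 := by
  have := HopfAlgebra.mul_antipode_rTensor_comul_apply (R := K) h
  rw [rTensor_eq_sw, map_sw] at this
  simp only [LinearMap.mul'_apply] at this
  rw [← hF.smul, ← Algebra.algebraMap_eq_smul_one, ← this, hF.map_sw]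

/-- This makes the smash coproduct results applicable with `W` equal to H, hence to the
bosonization. -/
theorem isModCoalg_mul : IsModCoalg (Coalgebra.comul (R := K) (A := H)) Coalgebra.counit
    (LinearMap.mul K H) where
  one_act := by simp
  mul_act := by simp [mul_assoc]
  comul_act h v := by
    rw [map_eq_sw (tensorAct _ _ h)]
    simp only [tensorAct_tmul, LinearMap.mul_apply']
    rw [sw_comm, ← eq_sw (Coalgebra.comul (h * v)),
      sw_comul_mul _ (by fun_prop) (by fun_prop)]
  counit_act := by simp

end

section TensorAct

variable {K : Type*} [Field K] {H : Type*} [Ring H] [HopfAlgebra K H]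
variable {V W : Type*} [AddCommMonoid V] [Module K V] [AddCommMonoid W] [Module K W]
variable {ΔV : V →ₗ[K] V ⊗[K] V} {εV : V →ₗ[K] K} {ρV : V →ₗ[K] H ⊗[K] V}
  {μV : H →ₗ[K] V →ₗ[K] V}
variable {ΔW : W →ₗ[K] W ⊗[K] W} {εW : W →ₗ[K] K} {μW : H →ₗ[K] W →ₗ[K] W}

theorem isModCoalg_tensorAct (hV : IsModCoalg ΔV εV μV) (hc : IsCompat μV ρV)
    (hW : IsModCoalg ΔW εW μW) :
    IsModCoalg (smashComul ΔV ρV ΔW μW) (tensorFun εV εW) (tensorAct μV μW) where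
  one_act := by
    refine fun x => IsLin.eq_of_tmul (f := fun x => tensorAct μV μW 1 x) (by fun_prop)
      IsLin.id' (fun v w => ?_) x
    rw [tensorAct_tmul, Bialgebra.comul_one, Algebra.TensorProduct.one_def,
      sw_tmul _ _ _ (by fun_prop) (by fun_prop), hV.one_act, hW.one_act]
  mul_act g h := by
    refine LinearMap.congr_fun (f := tensorAct μV μW (g * h)) (g := tensorAct μV μW g ∘ₗ _)
      (TensorProduct.ext' fun v w => ?_)
    simp only [LinearMap.comp_apply, tensorAct_tmul, map_sw]
    rw [sw_comul_mul _ (by fun_prop) (by fun_prop), sw_comm]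
    simp only [hV.mul_act, hW.mul_act]
  comul_act := comul_act_smashComul hV hc hW
  counit_act h := by
    refine fun x => IsLin.eq_of_tmul (f := fun x => tensorFun εV εW (tensorAct μV μW h x))
      (by fun_prop) (g := fun x => Coalgebra.counit (R := K) h * tensorFun εV εW x)
      (by fun_prop) (fun v w => ?_) x
    simp only [tensorAct_tmul, map_sw, tensorFun_tmul, hV.counit_act, hW.counit_act]
    rw [← (isCoalg_coalgebra (K := K) H).sw_counit_left (fun h =>
      Coalgebra.counit (R := K) h * (εV v * εW w)) (by fun_prop) h]
    refine IsLin.congr_sw fun a b => ?_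
    rw [smul_eq_mul]; ring

end TensorAct

namespace PreBialgebra

variable {K H R : Type*} [Field K] [Ring H] [HopfAlgebra K H]
  [AddCommGroup R] [Module K R] [Coalgebra K R] (P : PreBialgebra K H R)

theorem isModCoalg : IsModCoalg (Coalgebra.comul (R := K) (A := R)) Coalgebra.counit P.act where
  one_act := P.one_act
  mul_act := P.mul_act
  comul_act := P.comul_act
  counit_act := P.counit_act

theorem isComodCoalg :
    IsComodCoalg (Coalgebra.comul (R := K) (A := R)) Coalgebra.counit P.coact where
  counit_coact v := by
    have := P.counit_coact v
    rw [rTensor_eq_sw, equiv_sw] at this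
    simpa using this
  coassoc_coact := P.coassoc_coact
  comul_coact := P.comul_coact
  counit_colinear v := by
    rw [← Algebra.algebraMap_eq_smul_one, ← P.counit_colinear, Psi_eq_sw]

theorem coact_act_eq_sw (h : H) (v : R) :
    P.coact (P.act h v) = sw (Coalgebra.comul (R := K) h) fun a c =>
      sw (Coalgebra.comul (R := K) c) fun b d => sw (P.coact v) fun k u =>
        (a * k * HopfAlgebra.antipode K d) ⊗ₜ[K] P.act b u := by
  rw [P.coact_act, lTensor_eq_sw_sw (Coalgebra.comul (R := K) (A := H))]
  conv_lhs => rw [← eq_sw (P.coact v)]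
  simp only [map_sw, equiv_sw, sw_tmul_right, tmul_sw, LinearMap.lTensor_tmul,
    LinearEquiv.coe_coe, comm_tmul, assoc_symm_tmul, tensorTensorTensorComm_tmul, map_tmul,
    lift.tmul, sandwich_tmul]
  simp only [sw_comm (P.coact v)]

/-- Multiplying the H-part of ρ(h₁v) by h₂ on the right makes the antipode in the Yetter-Drinfeld
axiom cancel. The arguments on tensor products use only this antipode-free form. -/
theorem isCompat : IsCompat P.act P.coact := by
  intro h v
  have hH := isCoalg_coalgebra (K := K) H
  simp (disch := fun_prop) only [coact_act_eq_sw, sw_sw, sw_tmul, hH.sw_coassoc]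
  refine IsLin.congr_sw fun a b => ?_
  have hS : ∀ a' c, (sw (Coalgebra.comul (R := K) c) fun c d => sw (P.coact v) fun k u =>
      (a * k * HopfAlgebra.antipode K c * d) ⊗ₜ[K] P.act a' u) =
      Coalgebra.counit (R := K) c • sw (P.coact v) fun k u => (a * k) ⊗ₜ[K] P.act a' u := by
    intro a' c
    have := sw_antipode_mul (fun x => sw (P.coact v) fun k u =>
      (a * k * x) ⊗ₜ[K] P.act a' u) (by fun_prop) c
    simpa only [_root_.mul_one, ← mul_assoc] using this
  simp only [hS]
  exact hH.sw_counit_right (fun b => sw (P.coact v) fun k u => (a * k) ⊗ₜ[K] P.act b u)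
    (by fun_prop) b

theorem isCoalg₂ : IsCoalg P.comul₂ P.counit₂ :=
  isCoalg_smashComul (isCoalg_coalgebra R) P.isComodCoalg (isCoalg_coalgebra R) P.isModCoalg

theorem isComodCoalg₂ : IsComodCoalg P.comul₂ P.counit₂ P.coact₂ :=
  isComodCoalg_tensorCoact P.isComodCoalg P.isComodCoalg P.isCompat

theorem isModCoalg₂ : IsModCoalg P.comul₂ P.counit₂ P.act₂ :=
  isModCoalg_tensorAct P.isModCoalg P.isCompat P.isModCoalg

theorem isCoalg₃ : IsCoalg P.comul₃ P.counit₃ :=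
  isCoalg_smashComul P.isCoalg₂ P.isComodCoalg₂ (isCoalg_coalgebra R) P.isModCoalg

theorem isComodCoalg₃ : IsComodCoalg P.comul₃ P.counit₃ P.coact₃ :=
  isComodCoalg_tensorCoact P.isComodCoalg₂ P.isComodCoalg P.isCompat

section Sw

variable {M : Type*} [AddCommMonoid M] [Module K M]

theorem sw_comul₂ (F : R ⊗[K] R → R ⊗[K] R → M) (h₁ : ∀ b, IsLin K fun a => F a b)
    (h₂ : ∀ a, IsLin K fun b => F a b) (r s : R) :
    sw (P.comul₂ (r ⊗ₜ[K] s)) F = sw (Coalgebra.comul (R := K) r) fun r₁ r₂ =>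
      sw (P.coact r₂) fun k r₀ => sw (Coalgebra.comul (R := K) s) fun s₁ s₂ =>
        F (r₁ ⊗ₜ[K] P.act k s₁) (r₀ ⊗ₜ[K] s₂) :=
  sw_smashComul F h₁ h₂ r s

theorem sw_coact₂ (F : H → R ⊗[K] R → M) (h₁ : ∀ b, IsLin K fun a => F a b)
    (h₂ : ∀ a, IsLin K fun b => F a b) (r s : R) :
    sw (P.coact₂ (r ⊗ₜ[K] s)) F = sw (P.coact r) fun k r₀ => sw (P.coact s) fun l s₀ =>
        F (k * l) (r₀ ⊗ₜ[K] s₀) :=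
  sw_tensorCoact F h₁ h₂ r s

theorem sw_comul₃ (F : R ⊗[K] R ⊗[K] R → R ⊗[K] R ⊗[K] R → M)
    (h₁ : ∀ b, IsLin K fun a => F a b) (h₂ : ∀ a, IsLin K fun b => F a b) (x : R ⊗[K] R) (t : R) :
    sw (P.comul₃ (x ⊗ₜ[K] t)) F = sw (P.comul₂ x) fun x₁ x₂ =>
      sw (P.coact₂ x₂) fun k x₀ => sw (Coalgebra.comul (R := K) t) fun t₁ t₂ =>
        F (x₁ ⊗ₜ[K] P.act k t₁) (x₀ ⊗ₜ[K] t₂) :=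
  sw_smashComul F h₁ h₂ x t

theorem sw_coact₃ (F : H → R ⊗[K] R ⊗[K] R → M) (h₁ : ∀ b, IsLin K fun a => F a b)
    (h₂ : ∀ a, IsLin K fun b => F a b) (x : R ⊗[K] R) (t : R) :
    sw (P.coact₃ (x ⊗ₜ[K] t)) F = sw (P.coact₂ x) fun k x₀ => sw (P.coact t) fun l t₀ =>
        F (k * l) (x₀ ⊗ₜ[K] t₀) :=
  sw_tensorCoact F h₁ h₂ x t

theorem sw_coact₃_assoc_symm (F : H → R ⊗[K] R ⊗[K] R → M) (h₁ : ∀ b, IsLin K fun a => F a b)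
    (h₂ : ∀ a, IsLin K fun b => F a b) (r : R) (y : R ⊗[K] R) :
    sw (P.coact₃ ((TensorProduct.assoc K R R R).symm (r ⊗ₜ[K] y))) F =
      sw (P.coact r) fun k r₀ => sw (P.coact₂ y) fun l y₀ =>
        F (k * l) ((TensorProduct.assoc K R R R).symm (r₀ ⊗ₜ[K] y₀)) := by
  refine IsLin.eq_of_tmul (f := fun y => sw (P.coact₃
    ((TensorProduct.assoc K R R R).symm (r ⊗ₜ[K] y))) F) (by fun_prop)
    (g := fun y => sw (P.coact r) fun k r₀ => sw (P.coact₂ y) fun l y₀ =>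
        F (k * l) ((TensorProduct.assoc K R R R).symm (r₀ ⊗ₜ[K] y₀)))
    (by fun_prop) (fun s t => ?_) y
  simp (disch := fun_prop) only [assoc_symm_tmul, sw_coact₃, sw_coact₂,
    mul_assoc]

/-- The coproduct of (R ⊗ R) ⊗ R agrees with that of R ⊗ (R ⊗ R): moving r₂ past s₁ ⊗ t₁ in two
steps uses two iterated coactions, and their coassociativity turns these into one diagonal action.
This bracketing suits maps that treat the first factor separately. -/
theorem sw_comul₃_assoc_symm (F : R ⊗[K] R ⊗[K] R → R ⊗[K] R ⊗[K] R → M)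
    (h₁ : ∀ b, IsLin K fun a => F a b) (h₂ : ∀ a, IsLin K fun b => F a b) (r : R) (y : R ⊗[K] R) :
    sw (P.comul₃ ((TensorProduct.assoc K R R R).symm (r ⊗ₜ[K] y))) F =
      sw (Coalgebra.comul (R := K) r) fun r₁ r₂ => sw (P.coact r₂) fun k r₀ =>
        sw (P.comul₂ y) fun y₁ y₂ =>
          F ((TensorProduct.assoc K R R R).symm (r₁ ⊗ₜ[K] P.act₂ k y₁))
            ((TensorProduct.assoc K R R R).symm (r₀ ⊗ₜ[K] y₂)) := by
  refine IsLin.eq_of_tmul (f := fun y => sw (P.comul₃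
    ((TensorProduct.assoc K R R R).symm (r ⊗ₜ[K] y))) F) (by fun_prop)
    (g := fun y => sw (Coalgebra.comul (R := K) r) fun r₁ r₂ => sw (P.coact r₂) fun k r₀ =>
        sw (P.comul₂ y) fun y₁ y₂ =>
          F ((TensorProduct.assoc K R R R).symm (r₁ ⊗ₜ[K] P.act₂ k y₁))
            ((TensorProduct.assoc K R R R).symm (r₀ ⊗ₜ[K] y₂)))
    (by fun_prop) (fun s t => ?_) y
  simp (disch := fun_prop) only [assoc_symm_tmul, sw_comul₃, sw_comul₂,
    sw_coact₂]
  simp only [act₂, tensorAct_tmul, sw_comm _ (Coalgebra.comul (R := K) s)]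
  refine IsLin.congr_sw fun s₁ s₂ => IsLin.congr_sw fun r₁ r₂ => ?_
  have h : ∀ b (t : H ⊗[K] H) f, F (sw t f) b = sw t fun x y => F (f x y) b :=
    fun b => (h₁ b).map_sw
  simp (disch := fun_prop) only [P.isComodCoalg.sw_coassoc_coact, tmul_sw, equiv_sw, h,
    assoc_symm_tmul, ← P.mul_act]
  refine IsLin.congr_sw fun a b => ?_
  simp only [sw_comm (Coalgebra.comul (R := K) a)]

end Sw

end PreBialgebra

end YD

/-! ### Four coalgebra maps from R ⊗ R ⊗ R to R ⊗ R. -/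

namespace YD

set_option linter.unusedSectionVars false

namespace PreBialgebra

variable {K H R : Type*} [Field K] [Ring H] [HopfAlgebra K H]
  [AddCommGroup R] [Module K R] [Coalgebra K R] (P : PreBialgebra K H R)
variable {M : Type*} [AddCommMonoid M] [Module K M]

theorem counit₂_tmul (r s : R) : P.counit₂ (r ⊗ₜ[K] s) =
    Coalgebra.counit (R := K) r * Coalgebra.counit (R := K) s := tensorFun_tmul _ _ _ _

theorem counit₃_tmul (x : R ⊗[K] R) (t : R) : P.counit₃ (x ⊗ₜ[K] t) =
    P.counit₂ x * Coalgebra.counit (R := K) t := tensorFun_tmul _ _ _ _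

theorem sw_comul_mul (F : R → R → M) (h₁ : ∀ b, IsLin K fun a => F a b)
    (h₂ : ∀ a, IsLin K fun b => F a b) (z : R ⊗[K] R) :
    sw (Coalgebra.comul (R := K) (P.mul z)) F = sw (P.comul₂ z) fun a b =>
      F (P.mul a) (P.mul b) := by
  have := LinearMap.congr_fun P.comul_mul z
  simp only [LinearMap.comp_apply] at this
  rw [this, map_eq_sw]
  simp (disch := fun_prop) only [map_tmul, sw_sw, sw_tmul]
  rfl

section Maps

/-- The map `ε ⊗ R ⊗ R`. -/
noncomputable def counitLeft : R ⊗[K] R ⊗[K] R →ₗ[K] R ⊗[K] R :=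
  (TensorProduct.lid K (R ⊗[K] R)).toLinearMap ∘ₗ
    (Coalgebra.counit (R := K) (A := R)).rTensor (R ⊗[K] R) ∘ₗ
    (TensorProduct.assoc K R R R).toLinearMap

/-- The map `R ⊗ R ⊗ ε`. -/
noncomputable def counitRight : R ⊗[K] R ⊗[K] R →ₗ[K] R ⊗[K] R :=
  (TensorProduct.rid K (R ⊗[K] R)).toLinearMap ∘ₗ
    (Coalgebra.counit (R := K) (A := R)).lTensor (R ⊗[K] R)

/-- The map `R ⊗ m`. -/
def mulRight : R ⊗[K] R ⊗[K] R →ₗ[K] R ⊗[K] R :=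
  P.mul.lTensor R ∘ₗ (TensorProduct.assoc K R R R).toLinearMap

/-- The map `(m ⊗ R)Φ(ξ)`. -/
def mulLeft (ξ : R ⊗[K] R →ₗ[K] H) : R ⊗[K] R ⊗[K] R →ₗ[K] R ⊗[K] R :=
  P.mul.rTensor R ∘ₗ Phi P.comul₂ P.act ξ

theorem counitLeft_assoc_symm (r : R) (y : R ⊗[K] R) :
    counitLeft ((TensorProduct.assoc K R R R).symm (r ⊗ₜ[K] y)) =
      Coalgebra.counit (R := K) r • y := by
  simp [counitLeft]

theorem counitRight_tmul (x : R ⊗[K] R) (t : R) :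
    counitRight (x ⊗ₜ[K] t) = Coalgebra.counit (R := K) t • x := by
  simp [counitRight]

theorem mulRight_assoc_symm (r : R) (y : R ⊗[K] R) :
    P.mulRight ((TensorProduct.assoc K R R R).symm (r ⊗ₜ[K] y)) = r ⊗ₜ[K] P.mul y := by
  simp [mulRight]

theorem mulLeft_tmul (ξ : R ⊗[K] R →ₗ[K] H) (x : R ⊗[K] R) (t : R) :
    P.mulLeft ξ (x ⊗ₜ[K] t) = sw (P.comul₂ x) fun a b => P.mul a ⊗ₜ[K] P.act (ξ b) t := by
  rw [mulLeft, LinearMap.comp_apply, Phi_tmul, map_sw]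
  simp

theorem tensorFun_counit_left (ν : R ⊗[K] R →ₗ[K] K) :
    tensorFun Coalgebra.counit ν ∘ₗ (TensorProduct.assoc K R R R).toLinearMap =
      ν ∘ₗ counitLeft := by
  ext r s t
  simp [tensorFun_tmul, counitLeft]

theorem tensorFun_counit_right (ν : R ⊗[K] R →ₗ[K] K) :
    tensorFun ν Coalgebra.counit = ν ∘ₗ counitRight := by
  ext r s t
  simp [tensorFun_tmul, counitRight, mul_comm]

theorem exists_assoc_symm {p : R ⊗[K] R ⊗[K] R → Prop}
    (h : ∀ y, p ((TensorProduct.assoc K R R R).symm y)) (x : R ⊗[K] R ⊗[K] R) : p x := by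
  simpa using h ((TensorProduct.assoc K R R R) x)

theorem hom_ext_assoc_symm {f g : R ⊗[K] R ⊗[K] R →ₗ[K] M}
    (h : ∀ r y, f ((TensorProduct.assoc K R R R).symm (r ⊗ₜ[K] y)) =
      g ((TensorProduct.assoc K R R R).symm (r ⊗ₜ[K] y))) : f = g := by
  ext r s t
  simpa using h r (s ⊗ₜ[K] t)

/-- The braiding disappears: the counit hits the coacted leg of r, and colinearity of ε replaces the
H-part by 1. -/
theorem sw_comul₃_counitLeft (F : R ⊗[K] R ⊗[K] R → R ⊗[K] R → M)
    (h₁ : ∀ b, IsLin K fun a => F a b) (h₂ : ∀ a, IsLin K fun b => F a b) (r : R)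
    (y : R ⊗[K] R) :
    (sw (P.comul₃ ((TensorProduct.assoc K R R R).symm (r ⊗ₜ[K] y))) fun a b =>
      F a (counitLeft b)) = sw (P.comul₂ y) fun y₁ y₂ =>
        F ((TensorProduct.assoc K R R R).symm (r ⊗ₜ[K] y₁)) y₂ := by
  simp (disch := fun_prop) only [sw_comul₃_assoc_symm, counitLeft_assoc_symm, (h₂ _).smul,
    sw_comm _ (P.comul₂ y)]
  refine IsLin.congr_sw fun y₁ y₂ => ?_
  rw [← (isCoalg_coalgebra R).sw_counit_right (fun r =>
    F ((TensorProduct.assoc K R R R).symm (r ⊗ₜ[K] y₁)) y₂) (by fun_prop)]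
  refine IsLin.congr_sw fun r₁ r₂ => ?_
  rw [P.isComodCoalg.sw_counit_colinear (fun k =>
    F ((TensorProduct.assoc K R R R).symm (r₁ ⊗ₜ[K] P.act₂ k y₁)) y₂) (by fun_prop),
    P.isModCoalg₂.one_act]

/-- With the counit on the left leg, the H-part of r₂ still acts on y₁. Only H-linearity of `f`
turns this action into a counit. -/
theorem sw_comul₃_counitLeft_left (f : R ⊗[K] R →ₗ[K] K) (hf : IsHLinear P.act₂ f)
    (F : R ⊗[K] R ⊗[K] R → M) (hF : IsLin K F) (r : R) (y : R ⊗[K] R) :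
    (sw (P.comul₃ ((TensorProduct.assoc K R R R).symm (r ⊗ₜ[K] y))) fun a b =>
      f (counitLeft a) • F b) = sw (P.comul₂ y) fun y₁ y₂ =>
        f y₁ • F ((TensorProduct.assoc K R R R).symm (r ⊗ₜ[K] y₂)) := by
  simp (disch := fun_prop) only [sw_comul₃_assoc_symm, counitLeft_assoc_symm, map_smul,
    sw_comm _ (P.comul₂ y), hf _ _]
  refine IsLin.congr_sw fun y₁ y₂ => ?_
  rw [← (isCoalg_coalgebra R).sw_counit_left (fun r =>
    f y₁ • F ((TensorProduct.assoc K R R R).symm (r ⊗ₜ[K] y₂))) (by fun_prop)]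
  refine IsLin.congr_sw fun r₁ r₂ => ?_
  rw [← P.isComodCoalg.sw_counit_coact (fun r => Coalgebra.counit (R := K) r₁ •
    f y₁ • F ((TensorProduct.assoc K R R R).symm (r ⊗ₜ[K] y₂))) (by fun_prop)]
  refine IsLin.congr_sw fun k r₀ => ?_
  simp only [smul_smul, smul_eq_mul]
  congr 1; ring

/-- Here the braiding survives: t has to move past x₂, so the H-part of x₂ acts on it. This is the
source of the action inside Φ(ξ) in the cocycle identity. -/
theorem sw_comul₃_counitRight (F : R ⊗[K] R ⊗[K] R → R ⊗[K] R → M)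
    (h₁ : ∀ b, IsLin K fun a => F a b) (h₂ : ∀ a, IsLin K fun b => F a b) (x : R ⊗[K] R)
    (t : R) :
    (sw (P.comul₃ (x ⊗ₜ[K] t)) fun a b => F a (counitRight b)) =
      sw (P.comul₂ x) fun x₁ x₂ => sw (P.coact₂ x₂) fun k x₀ =>
        F (x₁ ⊗ₜ[K] P.act k t) x₀ := by
  simp (disch := fun_prop) only [sw_comul₃, counitRight_tmul, (h₂ _).smul]
  refine IsLin.congr_sw fun x₁ x₂ => IsLin.congr_sw fun k x₀ => ?_
  exact (isCoalg_coalgebra R).sw_counit_right (fun t => F (x₁ ⊗ₜ[K] P.act k t) x₀)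
    (by fun_prop) t

theorem sw_comul₃_counitRight_left (F : R ⊗[K] R → R ⊗[K] R ⊗[K] R → M)
    (h₁ : ∀ b, IsLin K fun a => F a b) (h₂ : ∀ a, IsLin K fun b => F a b) (x : R ⊗[K] R)
    (t : R) :
    (sw (P.comul₃ (x ⊗ₜ[K] t)) fun a b => F (counitRight a) b) =
      sw (P.comul₂ x) fun x₁ x₂ => F x₁ (x₂ ⊗ₜ[K] t) := by
  simp (disch := fun_prop) only [sw_comul₃, counitRight_tmul, (h₁ _).smul,
    P.isModCoalg.counit_act, mul_smul]
  refine IsLin.congr_sw fun x₁ x₂ => ?_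
  rw [← P.isComodCoalg₂.sw_counit_coact (fun x₂ => F x₁ (x₂ ⊗ₜ[K] t)) (by fun_prop)]
  refine IsLin.congr_sw fun k x₀ => ?_
  refine (IsLin.congr_sw fun _ _ => smul_comm _ _ _).trans ?_
  exact (isCoalg_coalgebra R).sw_counit_left (fun t =>
    Coalgebra.counit (R := K) k • F x₁ (x₀ ⊗ₜ[K] t)) (by fun_prop) t

theorem isComulMap_counitLeft : IsComulMap P.comul₃ P.comul₂ counitLeft := by
  refine exists_assoc_symm fun z => ?_
  refine IsLin.eq_of_tmul (f := fun z => P.comul₂ (counitLeft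
    ((TensorProduct.assoc K R R R).symm z))) (g := fun z => sw (P.comul₃
    ((TensorProduct.assoc K R R R).symm z)) fun a b => counitLeft a ⊗ₜ[K] counitLeft b)
    (by fun_prop) (by fun_prop) (fun r y => ?_) z
  rw [P.sw_comul₃_counitLeft (fun a b => counitLeft a ⊗ₜ[K] b) (by fun_prop) (by fun_prop)]
  simp only [counitLeft_assoc_symm, ← smul_tmul', ← smul_sw, eq_sw, map_smul]

theorem isComulMap_counitRight : IsComulMap P.comul₃ P.comul₂ counitRight := by
  refine fun z => IsLin.eq_of_tmul (f := fun z => P.comul₂ (counitRight z))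
    (g := fun z => sw (P.comul₃ z) fun a b => counitRight a ⊗ₜ[K] counitRight b)
    (by fun_prop) (by fun_prop) (fun x t => ?_) z
  rw [P.sw_comul₃_counitRight_left (fun a b => a ⊗ₜ[K] counitRight b) (by fun_prop)
    (by fun_prop)]
  simp only [counitRight_tmul, tmul_smul, ← smul_sw, eq_sw, map_smul]

theorem isComulMap_mulRight : IsComulMap P.comul₃ P.comul₂ P.mulRight := by
  refine exists_assoc_symm fun z => ?_
  refine IsLin.eq_of_tmul (f := fun z => P.comul₂ (P.mulRight
    ((TensorProduct.assoc K R R R).symm z))) (g := fun z => sw (P.comul₃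
    ((TensorProduct.assoc K R R R).symm z)) fun a b => P.mulRight a ⊗ₜ[K] P.mulRight b)
    (by fun_prop) (by fun_prop) (fun r y => ?_) z
  rw [mulRight_assoc_symm, ← eq_sw (P.comul₂ (r ⊗ₜ[K] P.mul y))]
  simp (disch := fun_prop) only [sw_comul₂, sw_comul₃_assoc_symm, sw_comul_mul,
    mulRight_assoc_symm]
  simp only [act₂, P.mul_linear]

theorem counit₂_counitLeft : P.counit₂ ∘ₗ counitLeft = P.counit₃ := by
  ext r s t
  simp [counitLeft, counit₂_tmul, counit₃_tmul, mul_assoc]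

theorem counit₂_counitRight : P.counit₂ ∘ₗ counitRight = P.counit₃ := by
  ext r s t
  simp [counitRight, counit₂_tmul, counit₃_tmul, mul_comm]

theorem counit_mul_apply (x : R ⊗[K] R) :
    Coalgebra.counit (R := K) (P.mul x) = P.counit₂ x := LinearMap.congr_fun P.counit_mul x

theorem counit₂_mulRight : P.counit₂ ∘ₗ P.mulRight = P.counit₃ := by
  ext r s t
  simp [mulRight, counit₂_tmul, counit₃_tmul, counit_mul_apply, mul_assoc]

end Maps

namespace IsCocycle

variable {P} {ξ : R ⊗[K] R →ₗ[K] H} (hξ : P.IsCocycle ξ)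
include hξ

theorem counit_apply (z : R ⊗[K] R) : Coalgebra.counit (R := K) (ξ z) = P.counit₂ z :=
  LinearMap.congr_fun hξ.counit_comp z

theorem sw_comul (F : H → H → M) (h₁ : ∀ b, IsLin K fun a => F a b)
    (h₂ : ∀ a, IsLin K fun b => F a b) (z : R ⊗[K] R) :
    sw (Coalgebra.comul (R := K) (ξ z)) F = sw (P.comul₂ z) fun a b =>
      sw (P.coact₂ b) fun k b₀ => F (ξ a * k) (ξ b₀) := by
  have := LinearMap.congr_fun hξ.comul_comp z
  simp only [LinearMap.comp_apply] at this
  rw [this, map_eq_sw (map ξ P.coact₂)]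
  have e : ∀ a b, map ξ P.coact₂ (a ⊗ₜ[K] b) = sw (P.coact₂ b) fun k b₀ =>
      ξ a ⊗ₜ[K] (k ⊗ₜ[K] b₀) := fun a b => by
    rw [map_tmul, ← tmul_sw, eq_sw]
  simp only [e, map_sw, LinearEquiv.coe_coe, assoc_symm_tmul, map_tmul, LinearMap.mul'_apply]
  simp (disch := fun_prop) only [sw_sw, sw_tmul]

theorem sw_braid (F : H → R → M) (h₁ : ∀ b, IsLin K fun a => F a b)
    (h₂ : ∀ a, IsLin K fun b => F a b) (z : R ⊗[K] R) :
    (sw (P.comul₂ z) fun a b => sw (P.coact (P.mul a)) fun k u => F (k * ξ b) u) =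
      sw (P.comul₂ z) fun a b => sw (P.coact₂ b) fun k b₀ => F (ξ a * k) (P.mul b₀) := by
  have := LinearMap.congr_fun hξ.braid_comp z
  simp only [LinearMap.comp_apply] at this
  rw [map_eq_sw (map ξ P.coact₂), map_eq_sw (map P.mul ξ)] at this
  have e : ∀ a b, map ξ P.coact₂ (a ⊗ₜ[K] b) = sw (P.coact₂ b) fun k b₀ =>
      ξ a ⊗ₜ[K] (k ⊗ₜ[K] b₀) := fun a b => by
    rw [map_tmul, ← tmul_sw, eq_sw]
  simp only [e, map_sw, LinearEquiv.coe_coe, assoc_symm_tmul, map_tmul, LinearMap.mul'_apply,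
    braidRH, braid_tmul, LinearMap.mul_apply'] at this
  have := congrArg (fun z => sw z F) this
  simp (disch := fun_prop) only [sw_sw, sw_tmul] at this
  exact this

theorem sw_cocycle (r s t : R) :
    (sw (P.comul₂ (s ⊗ₜ[K] t)) fun a b => ξ (r ⊗ₜ[K] P.mul a) * ξ b) =
      sw (P.comul₂ (r ⊗ₜ[K] s)) fun a b => sw (Coalgebra.comul (R := K) (ξ b)) fun h k =>
        ξ (P.mul a ⊗ₜ[K] P.act h t) * k := by
  have := LinearMap.congr_fun hξ.cocycle_comp ((r ⊗ₜ[K] s) ⊗ₜ[K] t)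
  simp only [LinearMap.comp_apply, LinearEquiv.coe_coe, assoc_tmul, LinearMap.lTensor_tmul,
    LinearMap.rTensor_tmul] at this
  rw [map_eq_sw (map P.mul ξ), map_eq_sw (map P.mul ξ)] at this
  simpa only [map_tmul, tmul_sw, sw_tmul_right, equiv_sw, map_sw, assoc_symm_tmul, assoc_tmul,
    LinearMap.rTensor_tmul, LinearMap.lTensor_tmul, LinearMap.mul'_apply, braidHR, braid_tmul]
    using this

/-- The formula for Δ_H ξ splits the action of ξ on t. The coproduct of m(x₁) ⊗ ξ(x₂)t then contains
the coaction of a product followed by ξ, which condition 3 replaces by ξ followed by the coaction of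
R ⊗ R; this is what the braided coproduct of the source gives. -/
theorem isComulMap_mulLeft : IsComulMap P.comul₃ P.comul₂ (P.mulLeft ξ) := by
  have hC := P.isCoalg₂
  have h₁ : ∀ a b t, P.comul₂ (P.mul a ⊗ₜ[K] P.act (ξ b) t) = sw (P.comul₂ b) fun e f =>
      sw (P.comul₂ a) fun c d => sw (P.coact (P.mul d)) fun k u =>
      sw (P.coact₂ f) fun l f₀ => sw (Coalgebra.comul (R := K) t) fun t₁ t₂ =>
      (P.mul c ⊗ₜ[K] P.act (k * ξ e * l) t₁) ⊗ₜ[K] (u ⊗ₜ[K] P.act (ξ f₀) t₂) := fun a b t => by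
    rw [← eq_sw (P.comul₂ (P.mul a ⊗ₜ[K] P.act (ξ b) t))]
    simp (disch := fun_prop) only [P.sw_comul₂, P.sw_comul_mul, P.isModCoalg.sw_comul_act,
      hξ.sw_comul]
    simp only [sw_comm _ (P.comul₂ b), ← P.mul_act, mul_assoc]
  have h₂ : ∀ e t c f, (sw (P.comul₂ e) fun d e => sw (P.coact (P.mul d)) fun k u =>
      sw (P.coact₂ f) fun l f₀ => sw (Coalgebra.comul (R := K) t) fun t₁ t₂ =>
      (P.mul c ⊗ₜ[K] P.act (k * ξ e * l) t₁) ⊗ₜ[K] (u ⊗ₜ[K] P.act (ξ f₀) t₂)) =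
      sw (P.comul₂ e) fun d e => sw (P.coact₂ e) fun k u =>
      sw (P.coact₂ f) fun l f₀ => sw (Coalgebra.comul (R := K) t) fun t₁ t₂ =>
      (P.mul c ⊗ₜ[K] P.act (ξ d * k * l) t₁) ⊗ₜ[K] (P.mul u ⊗ₜ[K] P.act (ξ f₀) t₂) :=
    fun e t c f => hξ.sw_braid (fun k u => sw (P.coact₂ f) fun l f₀ =>
      sw (Coalgebra.comul (R := K) t) fun t₁ t₂ => (P.mul c ⊗ₜ[K] P.act (k * l) t₁) ⊗ₜ[K]
      (u ⊗ₜ[K] P.act (ξ f₀) t₂)) (by fun_prop) (by fun_prop) e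
  refine fun z => IsLin.eq_of_tmul (f := fun z => P.comul₂ (P.mulLeft ξ z))
    (g := fun z => sw (P.comul₃ z) fun a b => P.mulLeft ξ a ⊗ₜ[K] P.mulLeft ξ b)
    (by fun_prop) (by fun_prop) (fun x t => ?_) z
  simp (disch := fun_prop) only [P.sw_comul₃, mulLeft_tmul, map_sw, h₁, sw_tmul_right, tmul_sw]
  conv_lhs => enter [2, a, b]; rw [sw_comm]
  simp (disch := fun_prop) only [hC.sw_coassoc]
  simp (disch := fun_prop) only [← hC.sw_coassoc, h₂]
  conv_rhs => enter [2, x₁, x₂, 2, k, x₀]; rw [sw_comm]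
  simp (disch := fun_prop) only [P.isComodCoalg₂.sw_comul_coact, ← hC.sw_coassoc]
  conv_rhs => enter [2, y, f, 2, a, e]; simp only [sw_comm _ (P.comul₂ a)]
  simp only [← P.mul_act, mul_assoc]

theorem counit₂_mulLeft : P.counit₂ ∘ₗ P.mulLeft ξ = P.counit₃ := by
  refine TensorProduct.ext' fun x t => ?_
  simp only [LinearMap.comp_apply, mulLeft_tmul, map_sw, counit₂_tmul, counit₃_tmul,
    P.isModCoalg.counit_act, hξ.counit_apply, P.counit_mul_apply]
  rw [← P.isCoalg₂.sw_counit_left (fun x => P.counit₂ x * Coalgebra.counit (R := K) t)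
    (by fun_prop) x]
  rfl

end IsCocycle

end PreBialgebra

end YD

/-! ### The integral, the factorization of ξ and the colinearity of the coboundary. -/

namespace YD

set_option linter.unusedSectionVars false

section Integral

variable {K H : Type*} [Field K] [Ring H] [HopfAlgebra K H]
variable {M : Type*} [AddCommMonoid M] [Module K M]
variable {lam : H →ₗ[K] K} (hlam : IsAdInvariantIntegral lam)
include hlam

theorem IsAdInvariantIntegral.sw_left (F : H → M) (hF : IsLin K F) (h : H) :
    (sw (Coalgebra.comul (R := K) h) fun a b => lam b • F a) = lam h • F 1 := by
  have := hlam.left_integral h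
  rw [lTensor_eq_sw, equiv_sw, Algebra.algebraMap_eq_smul_one] at this
  rw [← hF.smul, ← this, hF.map_sw]
  simp [hF.smul]

theorem IsAdInvariantIntegral.sw_right (F : H → M) (hF : IsLin K F) (h : H) :
    (sw (Coalgebra.comul (R := K) h) fun a b => lam a • F b) = lam h • F 1 := by
  have := hlam.right_integral h
  rw [rTensor_eq_sw, equiv_sw, Algebra.algebraMap_eq_smul_one] at this
  rw [← hF.smul, ← this, hF.map_sw]
  simp [hF.smul]

end Integral

namespace PreBialgebra

variable {K H R : Type*} [Field K] [Ring H] [HopfAlgebra K H]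
  [AddCommGroup R] [Module K R] [Coalgebra K R] {P : PreBialgebra K H R}
variable {lam : H →ₗ[K] K}  {ξ : R ⊗[K] R →ₗ[K] H}

theorem IsCocycle.isHLinear_integral (hlam : IsAdInvariantIntegral lam) (hξ : P.IsCocycle ξ) :
    IsHLinear P.act₂ (lam ∘ₗ ξ) := fun h z => by
  rw [LinearMap.comp_apply, hξ.linear, hlam.adLeft_inv, LinearMap.comp_apply]

/-- The left integral property applied to Δ_H ξ gives ξ * Ψ(λξ) = λξ·1_H. Multiplying on the right
by Ψ(v), the inverse of Ψ(λξ), isolates ξ. -/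
theorem IsCocycle.eq_conv_Psi (hlam : IsAdInvariantIntegral lam) (hξ : P.IsCocycle ξ)
    {v : R ⊗[K] R →ₗ[K] K} (hv : IsConvInv P.comul₂ P.counit₂ (lam ∘ₗ ξ) v) :
    ξ = conv P.comul₂ (scalar H (lam ∘ₗ ξ)) (Psi P.coact₂ v) := by
  have h : conv P.comul₂ ξ (Psi P.coact₂ (lam ∘ₗ ξ)) = scalar H (lam ∘ₗ ξ) := by
    refine LinearMap.ext fun z => ?_
    rw [scalar_apply, LinearMap.comp_apply, ← hlam.sw_left (fun h => h) (by fun_prop),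
      hξ.sw_comul _ (by fun_prop) (by fun_prop), conv_eq_sw]
    simp [Psi_eq_sw, mul_sw]
  rw [← h, P.isCoalg₂.conv_assoc, P.isComodCoalg₂.conv_Psi, hv.1, P.isComodCoalg₂.Psi_counit,
    P.isCoalg₂.conv_scalar_counit]

variable (P) in
/-- `(ε ⊗ v) * v(R ⊗ m)` -/
noncomputable def dPlus (v : R ⊗[K] R →ₗ[K] K) : R ⊗[K] R ⊗[K] R →ₗ[K] K :=
  conv P.comul₃ (v ∘ₗ counitLeft) (v ∘ₗ P.mulRight)

variable (P ξ) in
/-- `v(m ⊗ R)Φ(ξ) * (v ⊗ ε)` -/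
noncomputable def dMinus (v : R ⊗[K] R →ₗ[K] K) : R ⊗[K] R ⊗[K] R →ₗ[K] K :=
  conv P.comul₃ (v ∘ₗ P.mulLeft ξ) (v ∘ₗ counitRight)

theorem Psi_counitRight (v : R ⊗[K] R →ₗ[K] K) :
    Psi P.coact₃ (v ∘ₗ counitRight) = Psi P.coact₂ v ∘ₗ counitRight := by
  refine TensorProduct.ext' fun x t => ?_
  rw [LinearMap.comp_apply, Psi_eq_sw, P.sw_coact₃ _ (by fun_prop) (by fun_prop),
    counitRight_tmul, map_smul, Psi_eq_sw, smul_sw]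
  refine IsLin.congr_sw fun k x₀ => ?_
  have := P.isComodCoalg.sw_counit_colinear (fun l => v x₀ • (k * l)) (by fun_prop) t
  rw [_root_.mul_one] at this
  rw [← this]
  refine IsLin.congr_sw fun l t₀ => ?_
  simp [counitRight_tmul, smul_smul]

theorem Psi_assoc_symm (α : R ⊗[K] R ⊗[K] R →ₗ[K] K) (r : R) (y : R ⊗[K] R) :
    Psi P.coact₃ α ((TensorProduct.assoc K R R R).symm (r ⊗ₜ[K] y)) =
      sw (P.coact r) fun k r₀ => sw (P.coact₂ y) fun l y₀ =>
        α ((TensorProduct.assoc K R R R).symm (r₀ ⊗ₜ[K] y₀)) • (k * l) := by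
  rw [Psi_eq_sw, P.sw_coact₃_assoc_symm _ (by fun_prop) (by fun_prop)]

/-- Condition 3 moves ξ to the left of the H-part of the product. The factorization `he` of ξ then
leaves v' as a scalar in front, and the remaining H-parts assemble, by colinearity of the coproduct
of R ⊗ R, into Ψ of (ε ⊗ v) * v(R ⊗ m). -/
theorem IsCocycle.conv_Psi_mulRight (hξ : P.IsCocycle ξ) {v v' : R ⊗[K] R →ₗ[K] K}
    (hv : IsHLinear P.act₂ v) (hv' : IsHLinear P.act₂ v')
    (he : ξ = conv P.comul₂ (scalar H v') (Psi P.coact₂ v)) :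
    conv P.comul₃ (Psi P.coact₂ v ∘ₗ P.mulRight) (ξ ∘ₗ counitLeft) =
      conv P.comul₃ (scalar H (v' ∘ₗ counitLeft)) (Psi P.coact₃ (P.dPlus v)) := by
  have hξe : ∀ a, ξ a = sw (P.comul₂ a) fun c d => sw (P.coact₂ d) fun p d₀ =>
      v' c • v d₀ • p := fun a => by
    conv_lhs => rw [he]
    simp only [conv_eq_sw, scalar_apply, Psi_eq_sw, mul_sw, smul_mul_assoc, _root_.one_mul]
  have hC := P.isCoalg₂
  refine hom_ext_assoc_symm fun r y => ?_
  simp only [conv_eq_sw, LinearMap.comp_apply, scalar_apply, smul_mul_assoc, _root_.one_mul]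
  rw [P.sw_comul₃_counitLeft (fun a b => Psi P.coact₂ v (P.mulRight a) * ξ b) (by fun_prop)
    (by fun_prop), P.sw_comul₃_counitLeft_left v' hv' _ (by fun_prop)]
  have hP : ∀ r y, P.dPlus v ((TensorProduct.assoc K R R R).symm (r ⊗ₜ[K] y)) =
      sw (P.comul₂ y) fun a b => v a * v (r ⊗ₜ[K] P.mul b) := fun r y => by
    rw [dPlus, conv_eq_sw]
    have := P.sw_comul₃_counitLeft_left v hv (fun z => v (P.mulRight z)) (by fun_prop) r y
    simp only [mulRight_assoc_symm] at this
    exact this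
  simp only [mulRight_assoc_symm, Psi_assoc_symm, hP]
  have h₁ : ∀ a b, Psi P.coact₂ v (r ⊗ₜ[K] P.mul a) * ξ b = sw (P.coact r) fun k r₀ =>
      sw (P.coact (P.mul a)) fun l u => v (r₀ ⊗ₜ[K] u) • (k * (l * ξ b)) := fun a b => by
    rw [Psi_eq_sw, P.sw_coact₂ _ (by fun_prop) (by fun_prop), sw_mul]
    simp only [sw_mul, smul_mul_assoc, mul_assoc]
  simp only [h₁, sw_comm _ (P.coact r), smul_sw]
  refine IsLin.congr_sw fun k r₀ => ?_
  rw [hξ.sw_braid (fun l u => v (r₀ ⊗ₜ[K] u) • (k * l)) (by fun_prop) (by fun_prop)]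
  simp only [hξe, sw_mul, mul_sw, smul_sw, sw_smul]
  conv_lhs => enter [2, a, b]; rw [sw_comm]
  conv_rhs => enter [2, a, b]; rw [P.isComodCoalg₂.sw_comul_coact (fun p d b =>
    v' a • (v d * v (r₀ ⊗ₜ[K] P.mul b)) • (k * p)) (by fun_prop) (by fun_prop) (by fun_prop)]
  simp (disch := fun_prop) only [hC.sw_coassoc]
  refine IsLin.congr_sw fun a e => IsLin.congr_sw fun d b => ?_
  rw [sw_comm]
  refine IsLin.congr_sw fun p d₀ => IsLin.congr_sw fun q b₀ => ?_
  simp only [smul_mul_assoc, mul_smul_comm, smul_smul]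
  congr 1; ring

/-- The map (m ⊗ R)Φ(ξ) need not be colinear; ξ ⊗ ε measures the failure. The formula for Δ_H ξ and
the Yetter-Drinfeld condition move ξ past the coaction of t, and condition 3 moves it past the
coaction of the product. -/
theorem IsCocycle.conv_Psi_mulLeft (hξ : P.IsCocycle ξ) (v : R ⊗[K] R →ₗ[K] K) :
    conv P.comul₃ (Psi P.coact₂ v ∘ₗ P.mulLeft ξ) (ξ ∘ₗ counitRight) =
      conv P.comul₃ (ξ ∘ₗ counitRight) (Psi P.coact₃ (v ∘ₗ P.mulLeft ξ)) := by
  have hC := P.isCoalg₂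
  refine TensorProduct.ext' fun x t => ?_
  simp only [conv_eq_sw, LinearMap.comp_apply]
  rw [P.sw_comul₃_counitRight (fun a b => Psi P.coact₂ v (P.mulLeft ξ a) * ξ b) (by fun_prop)
    (by fun_prop), P.sw_comul₃_counitRight_left (fun a b => ξ a * 
      Psi P.coact₃ (v ∘ₗ P.mulLeft ξ) b) (by fun_prop) (by fun_prop)]
  simp only [mulLeft_tmul, map_sw, sw_mul, ← P.mul_act]
  conv_lhs => enter [2, a, b]; rw [sw_comm]
  simp (disch := fun_prop) only [hC.sw_coassoc]
  have h₁ : ∀ c e, (sw (P.comul₂ e) fun d b => sw (P.coact₂ b) fun k b₀ =>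
      Psi P.coact₂ v (P.mul c ⊗ₜ[K] P.act (ξ d * k) t) * ξ b₀) =
      sw (P.comul₂ e) fun d b => sw (P.coact (P.mul c)) fun l u => sw (P.coact₂ b) fun k b₀ =>
      sw (P.coact t) fun q t₀ => v (u ⊗ₜ[K] P.act (ξ b₀) t₀) • (l * ξ d * (k * q)) := by
    intro c e
    rw [← hξ.sw_comul (fun h k => Psi P.coact₂ v (P.mul c ⊗ₜ[K] P.act h t) * k) (by fun_prop)
      (by fun_prop)]
    simp (disch := fun_prop) only [Psi_eq_sw, P.sw_coact₂, sw_mul, smul_mul_assoc, mul_assoc]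
    rw [sw_comm]
    conv_rhs => rw [sw_comm]
    refine IsLin.congr_sw fun l u => ?_
    rw [P.isCompat.sw_compat (fun k t => v (u ⊗ₜ[K] t) • (l * k)) (by fun_prop) (by fun_prop),
      hξ.sw_comul _ (by fun_prop) (by fun_prop)]
    simp only [mul_assoc]
  simp only [h₁]
  simp (disch := fun_prop) only [← hC.sw_coassoc]
  have h₂ : ∀ a b, (sw (P.comul₂ a) fun c d => sw (P.coact (P.mul c)) fun l u =>
      sw (P.coact₂ b) fun k b₀ =>
      sw (P.coact t) fun q t₀ => v (u ⊗ₜ[K] P.act (ξ b₀) t₀) • (l * ξ d * (k * q))) =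
      sw (P.comul₂ a) fun c d => sw (P.coact₂ d) fun l u => sw (P.coact₂ b) fun k b₀ =>
      sw (P.coact t) fun q t₀ => v (P.mul u ⊗ₜ[K] P.act (ξ b₀) t₀) • (ξ c * l * (k * q)) :=
    fun a b => hξ.sw_braid (fun l u => sw (P.coact₂ b) fun k b₀ =>
      sw (P.coact t) fun q t₀ => v (u ⊗ₜ[K] P.act (ξ b₀) t₀) • (l * (k * q))) (by fun_prop)
      (by fun_prop) a
  simp only [h₂]
  simp (disch := fun_prop) only [hC.sw_coassoc, Psi_eq_sw, P.sw_coact₃, LinearMap.comp_apply,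
    mulLeft_tmul, map_sw, sw_smul, mul_sw]
  refine IsLin.congr_sw fun a b => ?_
  conv_rhs => enter [2, k, x₀]; rw [sw_comm]
  rw [P.isComodCoalg₂.sw_comul_coact _ (by fun_prop) (by fun_prop) (by fun_prop)]
  simp only [mul_smul_comm, mul_assoc]

/-- This is condition 5 as an identity of convolution products: by the formula for Δ_H ξ, one leg of
ξ acts on t inside Φ(ξ) and the other remains as a factor. -/
theorem IsCocycle.conv_mulRight_eq (hξ : P.IsCocycle ξ) :
    conv P.comul₃ (ξ ∘ₗ P.mulRight) (ξ ∘ₗ counitLeft) =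
      conv P.comul₃ (ξ ∘ₗ P.mulLeft ξ) (ξ ∘ₗ counitRight) := by
  have hC := P.isCoalg₂
  ext r s t
  have h := P.sw_comul₃_counitLeft (fun a b => ξ (P.mulRight a) * ξ b) (by fun_prop)
    (by fun_prop) r (s ⊗ₜ[K] t)
  simp only [mulRight_assoc_symm, assoc_symm_tmul] at h
  simp only [AlgebraTensorModule.curry_apply, LinearMap.restrictScalars_self, curry_apply,
    conv_eq_sw, LinearMap.comp_apply]
  rw [h, hξ.sw_cocycle]
  have h := P.sw_comul₃_counitRight (fun a b => ξ (P.mulLeft ξ a) * ξ b) (by fun_prop)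
    (by fun_prop) (r ⊗ₜ[K] s) t
  simp only [mulLeft_tmul, map_sw, sw_mul] at h
  rw [h]
  simp (disch := fun_prop) only [hξ.sw_comul, P.mul_act, ← hC.sw_coassoc]
  refine IsLin.congr_sw fun a b => ?_
  rw [sw_comm]

/-- The coboundary of v behaves like a colinear functional although its four factors need not be
colinear. This is the cocycle identity of ξ after both sides are separated into a scalar factor and
a value of Ψ. -/
theorem IsCocycle.Psi_coboundary (hlam : IsAdInvariantIntegral lam) (hξ : P.IsCocycle ξ)
    {v : R ⊗[K] R →ₗ[K] K} (h : IsConvInv P.comul₂ P.counit₂ (lam ∘ₗ ξ) v) :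
    Psi P.coact₃ (conv P.comul₃ (P.dPlus v) (P.dMinus ξ (lam ∘ₗ ξ))) =
      scalar H (conv P.comul₃ (P.dPlus v) (P.dMinus ξ (lam ∘ₗ ξ))) := by
  have hC := P.isCoalg₃
  have hL := hξ.isHLinear_integral hlam
  have hL' := hL.isConvInv P.isCoalg₂ P.isModCoalg₂ h
  have he := hξ.eq_conv_Psi hlam h
  have hR := hξ.isComulMap_mulLeft
  have hinv := hC.isConvInv_conv
    (h.comp P.isComulMap_counitLeft P.counit₂_counitLeft).symm
    (h.comp P.isComulMap_mulRight P.counit₂_mulRight).symm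
  have e₁ : ∀ {f : R ⊗[K] R ⊗[K] R →ₗ[K] R ⊗[K] R}, IsComulMap P.comul₃ P.comul₂ f →
      ξ ∘ₗ f = conv P.comul₃ (scalar H ((lam ∘ₗ ξ) ∘ₗ f)) (Psi P.coact₂ v ∘ₗ f) :=
    fun {f} hf => by
      conv_lhs => rw [he]
      rw [← hf.conv_comp]; rfl
  have h₁ : conv P.comul₃ (ξ ∘ₗ P.mulRight) (ξ ∘ₗ counitLeft) =
      conv P.comul₃ (scalar H (conv P.comul₃ ((lam ∘ₗ ξ) ∘ₗ P.mulRight)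
        ((lam ∘ₗ ξ) ∘ₗ counitLeft))) (Psi P.coact₃ (P.dPlus v)) := by
    rw [e₁ P.isComulMap_mulRight, hC.conv_assoc, hξ.conv_Psi_mulRight hL' hL he,
      ← hC.conv_assoc, conv_scalar]
  have h₂ : conv P.comul₃ (ξ ∘ₗ P.mulLeft ξ) (ξ ∘ₗ counitRight) =
      conv P.comul₃ (scalar H (P.dMinus ξ (lam ∘ₗ ξ)))
        (Psi P.coact₃ (conv P.comul₃ (v ∘ₗ counitRight) (v ∘ₗ P.mulLeft ξ))) := by
    rw [e₁ hR, hC.conv_assoc, hξ.conv_Psi_mulLeft, e₁ P.isComulMap_counitRight,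
      ← Psi_counitRight, hC.conv_assoc, P.isComodCoalg₃.conv_Psi, ← hC.conv_assoc, conv_scalar]
    rfl
  have hinv' := hC.isConvInv_conv
    (h.comp P.isComulMap_counitRight P.counit₂_counitRight).symm
    (h.comp hR hξ.counit₂_mulLeft).symm
  have h₃ := h₁.symm.trans (hξ.conv_mulRight_eq.trans h₂)
  -- `dPlus v` is inverse to L(R ⊗ m) * (ε ⊗ L), the scalar factor of `h₁`, where L is `lam ∘ₗ ξ`.
  -- Multiplying by it isolates Ψ(`dPlus v`).
  have h₄ := congrArg (fun z => conv P.comul₃ (scalar H (P.dPlus v)) z) h₃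
  have hinv₁ : conv P.comul₃ (P.dPlus v) _ = _ := hinv.1
  simp only [← hC.conv_assoc (B := H), conv_scalar, hinv₁, hC.scalar_counit_conv] at h₄
  rw [← P.isComodCoalg₃.conv_Psi, h₄, hC.conv_assoc, P.isComodCoalg₃.conv_Psi, dMinus, hinv'.1,
    P.isComodCoalg₃.Psi_counit, hC.conv_scalar_counit]

end PreBialgebra

end YD

/-! ### Descent of the differential from the bosonization to R. -/

namespace YD

set_option linter.unusedSectionVars false

section

variable {K : Type*} [Field K] {H : Type*} [Ring H] [HopfAlgebra K H]
variable {V W V' W' M : Type*} [AddCommMonoid V] [Module K V]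
  [AddCommMonoid W] [Module K W] [AddCommMonoid M] [Module K M]
  [AddCommMonoid V'] [Module K V'] [AddCommMonoid W'] [Module K W']
variable {ΔV : V →ₗ[K] V ⊗[K] V} {εV : V →ₗ[K] K} {ρV : V →ₗ[K] H ⊗[K] V}
variable {ΔW : W →ₗ[K] W ⊗[K] W} {εW : W →ₗ[K] K} {ρW : W →ₗ[K] H ⊗[K] W}
  {μW : H →ₗ[K] W →ₗ[K] W}
variable {ΔV' : V' →ₗ[K] V' ⊗[K] V'} {ΔW' : W' →ₗ[K] W' ⊗[K] W'}

/-- The comultiplication of the smash coproduct `V # H`. -/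
noncomputable abbrev smashH (ΔV : V →ₗ[K] V ⊗[K] V) (ρV : V →ₗ[K] H ⊗[K] V) :
    V ⊗[K] H →ₗ[K] (V ⊗[K] H) ⊗[K] (V ⊗[K] H) :=
  smashComul ΔV ρV Coalgebra.comul (LinearMap.mul K H)

variable (V) in
/-- The map `(v # h) ⊗ (w # l) ↦ (v ⊗ h₁ w) # h₂ l`. -/
noncomputable def smashMerge (μW : H →ₗ[K] W →ₗ[K] W) :
    (V ⊗[K] H) ⊗[K] (W ⊗[K] H) →ₗ[K] (V ⊗[K] W) ⊗[K] H :=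
  (TensorProduct.assoc K V W H).symm.toLinearMap ∘ₗ
    (TensorProduct.lift (tensorAct μW (LinearMap.mul K H))).lTensor V ∘ₗ
    (TensorProduct.assoc K V H (W ⊗[K] H)).toLinearMap

theorem smashMerge_tmul (v : V) (h : H) (w : W) (l : H) :
    smashMerge V μW ((v ⊗ₜ[K] h) ⊗ₜ[K] (w ⊗ₜ[K] l)) =
      sw (Coalgebra.comul (R := K) h) fun a b => (v ⊗ₜ[K] μW a w) ⊗ₜ[K] (b * l) := by
  simp [smashMerge, tensorAct_tmul, tmul_sw, equiv_sw]

/-- Collecting the two copies of H on the right is compatible with coproducts because of the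
Yetter-Drinfeld condition on `W`. Iterating it and then applying ε_H gives coalgebra maps from A ⊗ A
and A ⊗ A ⊗ A to the braided tensor powers of R. -/
theorem isComulMap_smashMerge (hVc : IsComodCoalg ΔV εV ρV)
    (hWm : IsModCoalg ΔW εW μW) (hc : IsCompat μW ρW) :
    IsComulMap (tensorComul (smashH ΔV ρV) (smashH ΔW ρW))
      (smashH (smashComul ΔV ρV ΔW μW) (tensorCoact ρV ρW)) (smashMerge V μW) := by
  have hH := isCoalg_coalgebra (K := K) H
  have key : ∀ v h w l, smashH (smashComul ΔV ρV ΔW μW) (tensorCoact ρV ρW)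
      (smashMerge V μW ((v ⊗ₜ[K] h) ⊗ₜ[K] (w ⊗ₜ[K] l))) =
      sw (tensorComul (smashH ΔV ρV) (smashH ΔW ρW) ((v ⊗ₜ[K] h) ⊗ₜ[K] (w ⊗ₜ[K] l)))
        fun a b => smashMerge V μW a ⊗ₜ[K] smashMerge V μW b := by
    intro v h w l
    simp (disch := fun_prop) only [smashMerge_tmul, map_sw, smashComul_tmul, tensorComul_tmul,
      tensorCoact_tmul, sw_sw, sw_tmul, sw_comul_mul, hWm.sw_comul_act, sw_tmul_right, tmul_sw,
      LinearMap.mul_apply']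
    simp only [sw_comm _ (ΔV v)]
    refine IsLin.congr_sw fun v₁ v₂ => ?_
    simp only [sw_comm _ (ΔW w)]
    refine IsLin.congr_sw fun w₁ w₂ => ?_
    simp only [sw_comm _ (Coalgebra.comul (R := K) l)]
    refine IsLin.congr_sw fun l₁ l₂ => ?_
    simp only [sw_comm _ (ρV v₂)]
    conv_lhs => enter [2, k, v₀]; simp only [sw_comm _ (ρV v₀)]
    conv_rhs => enter [2, k, v₀]; simp only [sw_comm _ (Coalgebra.comul (R := K) k)]
    simp (disch := fun_prop) only [hVc.sw_coassoc_coact]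
    refine IsLin.congr_sw fun k v₀ => IsLin.congr_sw fun k₁ k₂ => ?_
    simp (disch := fun_prop) only [hH.sw_coassoc]
    simp only [sw_comm _ (ρW w₂)]
    conv_rhs => enter [2, m, w₀, 2, a, b]; rw [sw_comm]
    simp (disch := fun_prop) only [hH.sw_coassoc]
    simp only [sw_comm (ρW w₂)]
    refine IsLin.congr_sw fun a b => ?_
    conv_lhs => enter [2, c, d]; rw [sw_comm]
    have := hc.sw_compat₃ (fun x u d => ((v₁ ⊗ₜ[K] μW (k₁ * a) w₁) ⊗ₜ[K] (k₂ * (x * l₁))) ⊗ₜ[K]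
      ((v₀ ⊗ₜ[K] u) ⊗ₜ[K] (d * l₂))) (by fun_prop) (by fun_prop) (by fun_prop) b w₂
    simp only [mul_assoc, ← hWm.mul_act] at this ⊢
    exact this
  intro z
  refine LinearMap.congr_fun (f := smashH (smashComul ΔV ρV ΔW μW) (tensorCoact ρV ρW) ∘ₗ
      smashMerge V μW) (g := map (smashMerge V μW) (smashMerge V μW) ∘ₗ
      (tensorComul (smashH ΔV ρV) (smashH ΔW ρW))) ?_ z |>.trans ?_
  · ext v h w l
    simp only [AlgebraTensorModule.curry_apply, LinearMap.restrictScalars_self, curry_apply,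
      LinearMap.comp_apply, key]
    rw [map_eq_sw (map _ _)]
    simp only [map_tmul]
  · rw [LinearMap.comp_apply, map_eq_sw]
    simp only [map_tmul]

theorem IsComulMap.tensor {f : V →ₗ[K] V'} {g : W →ₗ[K] W'} (hf : IsComulMap ΔV ΔV' f)
    (hg : IsComulMap ΔW ΔW' g) :
    IsComulMap (tensorComul ΔV ΔW) (tensorComul ΔV' ΔW') (TensorProduct.map f g) := by
  refine fun z => IsLin.eq_of_tmul
    (f := fun z => tensorComul ΔV' ΔW' (TensorProduct.map f g z))
    (g := fun z => sw (tensorComul ΔV ΔW z) fun a b =>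
      TensorProduct.map f g a ⊗ₜ[K] TensorProduct.map f g b)
    (by fun_prop) (by fun_prop) (fun v w => ?_) z
  simp (disch := fun_prop) only [map_tmul, tensorComul_tmul, sw_sw, sw_tmul, hf.sw_map,
    hg.sw_map]

theorem isComulMap_id : IsComulMap ΔV ΔV LinearMap.id := fun _ => (eq_sw _).symm

/-- The map `v # h ↦ v ε(h)`. -/
noncomputable def smashProj : V ⊗[K] H →ₗ[K] V :=
  (TensorProduct.rid K V).toLinearMap ∘ₗ (Coalgebra.counit (R := K) (A := H)).lTensor V

theorem smashProj_tmul (v : V) (h : H) :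
    smashProj (v ⊗ₜ[K] h) = Coalgebra.counit (R := K) h • v := by
  simp [smashProj]

theorem isComulMap_smashProj (hVc : IsComodCoalg ΔV εV ρV) :
    IsComulMap (smashH ΔV ρV) ΔV smashProj := by
  have hH := isCoalg_coalgebra (K := K) H
  refine fun z => IsLin.eq_of_tmul (f := fun z => ΔV (smashProj z))
    (g := fun z => sw (smashH ΔV ρV z) fun a b => smashProj a ⊗ₜ[K] smashProj b)
    (by fun_prop) (by fun_prop) (fun v h => ?_) z
  simp (disch := fun_prop) only [sw_smashComul, smashProj_tmul, map_smul,
    LinearMap.mul_apply', Bialgebra.counit_mul]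
  conv_lhs => rw [← eq_sw (ΔV v)]
  rw [smul_sw]
  refine IsLin.congr_sw fun v₁ v₂ => ?_
  rw [← hVc.sw_counit_coact (fun v₂ => Coalgebra.counit (R := K) h • v₁ ⊗ₜ[K] v₂) (by fun_prop)]
  refine IsLin.congr_sw fun k v₀ => ?_
  rw [← hH.sw_counit_left (fun h => Coalgebra.counit (R := K) k •
    Coalgebra.counit (R := K) h • v₁ ⊗ₜ[K] v₀) (by fun_prop)]
  refine IsLin.congr_sw fun h₁ h₂ => ?_
  simp only [tmul_smul, ← smul_tmul', smul_smul]
  congr 1; ring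

end

namespace PreBialgebra

variable {K H R : Type*} [Field K] [Ring H] [HopfAlgebra K H]
  [AddCommGroup R] [Module K R] [Coalgebra K R] (P : PreBialgebra K H R)

theorem isCoalg_smash : IsCoalg P.smashΔ P.smashε :=
  isCoalg_smashComul (isCoalg_coalgebra R) P.isComodCoalg (isCoalg_coalgebra H) isModCoalg_mul

theorem isCoalg_smash₂ : IsCoalg P.smashΔ₂ P.smashε₂ :=
  isCoalg_tensorComul P.isCoalg_smash P.isCoalg_smash

/-- The map `(r # h) ⊗ (s # l) ↦ r ⊗ h s ε(l)`. -/
noncomputable def proj₂ : (R ⊗[K] H) ⊗[K] (R ⊗[K] H) →ₗ[K] R ⊗[K] R :=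
  smashProj ∘ₗ smashMerge R P.act

/-- The map `(r # h) ⊗ (s # l) ⊗ (t # k) ↦ r ⊗ h₁ s ⊗ h₂ l t ε(k)`. -/
noncomputable def proj₃ :
    (R ⊗[K] H) ⊗[K] (R ⊗[K] H) ⊗[K] (R ⊗[K] H) →ₗ[K] R ⊗[K] R ⊗[K] R :=
  smashProj ∘ₗ smashMerge (R ⊗[K] R) P.act ∘ₗ
    TensorProduct.map (smashMerge R P.act) LinearMap.id

theorem isComulMap_proj₂ : IsComulMap P.smashΔ₂ P.comul₂ P.proj₂ :=
  (isComulMap_smashProj P.isComodCoalg₂).comp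
    (isComulMap_smashMerge P.isComodCoalg P.isModCoalg P.isCompat)

theorem isComulMap_proj₃ : IsComulMap P.smashΔ₃ P.comul₃ P.proj₃ :=
  (isComulMap_smashProj P.isComodCoalg₃).comp
    ((isComulMap_smashMerge P.isComodCoalg₂ P.isModCoalg P.isCompat).comp
      ((isComulMap_smashMerge P.isComodCoalg P.isModCoalg P.isCompat).tensor isComulMap_id))

theorem proj₂_tmul (r s : R) (h l : H) :
    P.proj₂ ((r ⊗ₜ[K] h) ⊗ₜ[K] (s ⊗ₜ[K] l)) =
      Coalgebra.counit (R := K) l • r ⊗ₜ[K] P.act h s := by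
  rw [proj₂, LinearMap.comp_apply, smashMerge_tmul, map_sw]
  simp only [smashProj_tmul, Bialgebra.counit_mul, mul_smul]
  exact (isCoalg_coalgebra H).sw_counit_right (fun h => Coalgebra.counit (R := K) l •
    r ⊗ₜ[K] P.act h s) (by fun_prop) h

theorem proj₃_tmul (r s t : R) (h l k : H) :
    P.proj₃ ((r ⊗ₜ[K] h) ⊗ₜ[K] (s ⊗ₜ[K] l) ⊗ₜ[K] (t ⊗ₜ[K] k)) =
      sw (Coalgebra.comul (R := K) h) fun a b =>
        Coalgebra.counit (R := K) k • (r ⊗ₜ[K] P.act a s) ⊗ₜ[K] P.act (b * l) t := by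
  simp only [proj₃, LinearMap.comp_apply, map_tmul, LinearMap.id_apply, smashMerge_tmul,
    sw_tmul_right, map_sw, smashProj_tmul, Bialgebra.counit_mul, mul_smul]
  refine IsLin.congr_sw fun a b => ?_
  exact (isCoalg_coalgebra H).sw_counit_right (fun h => Coalgebra.counit (R := K) k •
    (r ⊗ₜ[K] P.act a s) ⊗ₜ[K] P.act h t) (by fun_prop) _

/-- Since `proj₂` is a coalgebra map, ℧² respects convolution products and inverses. -/
theorem mho₂_eq (v : R ⊗[K] R →ₗ[K] K) : P.mho₂ v = v ∘ₗ P.proj₂ := by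
  ext r h s l
  simp [mho₂, proj₂_tmul, tensorFun_tmul, mul_comm]

theorem counit₂_proj₂ : P.counit₂ ∘ₗ P.proj₂ = P.smashε₂ := by
  ext r h s l
  simp only [proj₂_tmul, counit₂_tmul, smashε₂, smashε, tensorFun_tmul, P.isModCoalg.counit_act,
    AlgebraTensorModule.curry_apply, LinearMap.restrictScalars_self, curry_apply,
    LinearMap.comp_apply, map_smul, smul_eq_mul]
  ring

theorem isConvInv_mho₂ {v v' : R ⊗[K] R →ₗ[K] K} (h : IsConvInv P.comul₂ P.counit₂ v v') :
    IsConvInv P.smashΔ₂ P.smashε₂ (P.mho₂ v) (P.mho₂ v') := by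
  rw [mho₂_eq, mho₂_eq]
  exact h.comp P.isComulMap_proj₂ P.counit₂_proj₂

theorem Omega₃_proj₃ (γ : R ⊗[K] R ⊗[K] R →ₗ[K] K) : P.Omega₃ (γ ∘ₗ P.proj₃) = γ := by
  ext r s t
  simp only [Omega₃, AlgebraTensorModule.curry_apply, LinearMap.restrictScalars_self,
    curry_apply, LinearMap.comp_apply, map_tmul, LinearMap.flip_apply, mk_apply, proj₃_tmul,
    Bialgebra.comul_one, Algebra.TensorProduct.one_def, Bialgebra.counit_one]
  rw [sw_tmul _ _ _ (by fun_prop) (by fun_prop)]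
  simp [P.one_act]

theorem hom_ext_smash₃ {M : Type*} [AddCommMonoid M] [Module K M]
    {f g : (R ⊗[K] H) ⊗[K] (R ⊗[K] H) ⊗[K] (R ⊗[K] H) →ₗ[K] M}
    (h : ∀ r h s l t k, f ((r ⊗ₜ[K] h) ⊗ₜ[K] (s ⊗ₜ[K] l) ⊗ₜ[K] (t ⊗ₜ[K] k)) =
      g ((r ⊗ₜ[K] h) ⊗ₜ[K] (s ⊗ₜ[K] l) ⊗ₜ[K] (t ⊗ₜ[K] k))) : f = g := by
  ext r a s b t c
  exact h r a s b t c

theorem smashMul_tmul (ξ : R ⊗[K] R →ₗ[K] H) (r s : R) (h l : H) :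
    P.smashMul ξ ((r ⊗ₜ[K] h) ⊗ₜ[K] (s ⊗ₜ[K] l)) =
      sw (Coalgebra.comul (R := K) h) fun a b => sw (P.comul₂ (r ⊗ₜ[K] P.act a s)) fun x y =>
        P.mul x ⊗ₜ[K] (ξ y * (b * l)) := by
  simp only [smashMul, LinearMap.comp_apply, LinearEquiv.coe_coe, assoc_tmul,
    LinearMap.lTensor_tmul, assoc_symm_tmul, LinearMap.rTensor_tmul, braidHR, braid_tmul,
    sw_tmul_right, tmul_sw, map_sw, map_tmul]
  refine IsLin.congr_sw fun a b => ?_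
  rw [map_eq_sw (TensorProduct.map P.mul ξ)]
  simp only [map_tmul, sw_tmul_right, equiv_sw, assoc_tmul, map_sw, LinearMap.lTensor_tmul,
    LinearMap.mul'_apply]

/-- The element h attached to the first factor acts on s ⊗ lt under `proj₃`, but is only counted by
ε_A on the left. H-linearity of `v` reconciles the two. -/
theorem counitLeft_proj₃ {v : R ⊗[K] R →ₗ[K] K} (hv : IsHLinear P.act₂ v) :
    tensorFun P.smashε (P.mho₂ v) ∘ₗ
      (TensorProduct.assoc K (R ⊗[K] H) (R ⊗[K] H) (R ⊗[K] H)).toLinearMap =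
    (v ∘ₗ counitLeft) ∘ₗ P.proj₃ := by
  refine hom_ext_smash₃ fun r h s l t k => ?_
  simp only [LinearMap.comp_apply, LinearEquiv.coe_coe, assoc_tmul, tensorFun_tmul, mho₂_eq,
    proj₂_tmul, proj₃_tmul, map_sw, map_smul, smashε]
  have h₁ := hv h (s ⊗ₜ[K] P.act l t)
  simp only [act₂, tensorAct_tmul, map_sw, ← P.mul_act] at h₁
  have h₂ : ∀ s t, counitLeft ((r ⊗ₜ[K] s) ⊗ₜ[K] t) = Coalgebra.counit (R := K) r • s ⊗ₜ[K] t :=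
    fun s t => by simp [counitLeft]
  simp only [h₂, map_smul, smul_eq_mul, ← mul_sw, h₁]
  ring

/-- H-linearity of m pulls the action of h out of the product, and ε_H ξ = ε removes the ξ that the
product of A leaves in its H-component. -/
theorem mulRight_proj₃ {ξ : R ⊗[K] R →ₗ[K] H} (hξ : P.IsCocycle ξ) (v : R ⊗[K] R →ₗ[K] K) :
    P.mho₂ v ∘ₗ (P.smashMul ξ).lTensor (R ⊗[K] H) ∘ₗ
      (TensorProduct.assoc K (R ⊗[K] H) (R ⊗[K] H) (R ⊗[K] H)).toLinearMap =
    (v ∘ₗ P.mulRight) ∘ₗ P.proj₃ := by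
  refine hom_ext_smash₃ fun r h s l t k => ?_
  simp only [LinearMap.comp_apply, LinearEquiv.coe_coe, assoc_tmul, LinearMap.lTensor_tmul,
    smashMul_tmul, mho₂_eq, proj₂_tmul, proj₃_tmul, map_sw, map_smul, tmul_sw,
    Bialgebra.counit_mul, hξ.counit_apply]
  have h₁ := P.mul_linear h (s ⊗ₜ[K] P.act l t)
  simp only [tensorAct_tmul, map_sw, ← P.mul_act] at h₁
  have h₂ : ∀ s t, P.mulRight ((r ⊗ₜ[K] s) ⊗ₜ[K] t) = r ⊗ₜ[K] P.mul (s ⊗ₜ[K] t) :=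
    fun s t => by simp [mulRight]
  simp only [h₂, ← smul_sw, ← map_sw, ← tmul_sw, h₁]
  have h₃ : ∀ (b : H) (y : R ⊗[K] R), (sw (P.comul₂ y) fun x y => (P.counit₂ y * (Coalgebra.counit (R := K) b *
      Coalgebra.counit (R := K) k)) • v (r ⊗ₜ[K] P.act h (P.mul x))) =
      Coalgebra.counit (R := K) b • Coalgebra.counit (R := K) k •
        v (r ⊗ₜ[K] P.act h (P.mul y)) := fun b y => by
    simp only [mul_smul]
    exact P.isCoalg₂.sw_counit_right (fun x => Coalgebra.counit (R := K) b •
      Coalgebra.counit (R := K) k • v (r ⊗ₜ[K] P.act h (P.mul x))) (by fun_prop) y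
  simp only [h₃]
  exact (isCoalg_coalgebra H).sw_counit_right (fun a => Coalgebra.counit (R := K) k •
    v (r ⊗ₜ[K] P.act h (P.mul (s ⊗ₜ[K] P.act a t)))) (by fun_prop) l

/-- The ξ in the H-component of the product of the first two factors acts on the third factor; this
is how Φ(ξ) arises. -/
theorem mulLeft_proj₃ (ξ : R ⊗[K] R →ₗ[K] H) (v : R ⊗[K] R →ₗ[K] K) :
    P.mho₂ v ∘ₗ (P.smashMul ξ).rTensor (R ⊗[K] H) = (v ∘ₗ P.mulLeft ξ) ∘ₗ P.proj₃ := by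
  refine hom_ext_smash₃ fun r h s l t k => ?_
  simp only [LinearMap.comp_apply, LinearMap.rTensor_tmul,
    smashMul_tmul, mho₂_eq, proj₂_tmul, proj₃_tmul, map_sw, map_smul, sw_tmul_right,
    mulLeft_tmul, smul_sw, P.mul_act]

theorem counitRight_proj₃ (v : R ⊗[K] R →ₗ[K] K) :
    tensorFun (P.mho₂ v) P.smashε = (v ∘ₗ counitRight) ∘ₗ P.proj₃ := by
  refine hom_ext_smash₃ fun r h s l t k => ?_
  simp only [LinearMap.comp_apply, tensorFun_tmul, mho₂_eq,
    proj₂_tmul, proj₃_tmul, map_sw, map_smul, smashε, counitRight_tmul,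
    P.isModCoalg.counit_act, Bialgebra.counit_mul]
  have h₁ := (isCoalg_coalgebra H).sw_counit_right (fun a => (Coalgebra.counit (R := K) l *
    (Coalgebra.counit (R := K) t * Coalgebra.counit (R := K) k)) • v (r ⊗ₜ[K] P.act a s))
    (by fun_prop) h
  simp only [smul_eq_mul] at h₁ ⊢
  rw [mul_right_comm, ← h₁]
  refine IsLin.congr_sw fun a b => ?_
  ring

/-- All four factors of ∂²_A(℧²v) factor through the coalgebra map `proj₃`, hence so does their
convolution product, and Ω³ undoes composition with `proj₃`. -/
theorem dR_eq {ξ : R ⊗[K] R →ₗ[K] H} (hξ : P.IsCocycle ξ) {v v' : R ⊗[K] R →ₗ[K] K}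
    (hv : IsHLinear P.act₂ v) (h : IsConvInv P.comul₂ P.counit₂ v v') :
    P.dR ξ v = conv P.comul₃ (P.dPlus v) (P.dMinus ξ v') := by
  rw [dR, dA, P.isCoalg_smash₂.convInv_eq (P.isConvInv_mho₂ h), dPlusA, dMinusA,
    P.counitLeft_proj₃ hv, P.mulRight_proj₃ hξ, mulLeft_proj₃, counitRight_proj₃,
    P.isComulMap_proj₃.conv_comp, P.isComulMap_proj₃.conv_comp, P.isComulMap_proj₃.conv_comp,
    Omega₃_proj₃]
  rfl

end PreBialgebra

end YD

/-! ### Artinian rings with a largest proper two-sided ideal. -/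

namespace YD

set_option linter.unusedSectionVars false

section RingTheory

/-- In an Artinian ring with a largest proper two-sided ideal, this ideal is contained in the
Jacobson radical. -/
theorem le_jacobson_of_forall_isTwoSided_le {B : Type*} [Ring B] [IsArtinianRing B] (I : Ideal B)
    [I.IsTwoSided] (hI : I ≠ ⊤) (h : ∀ T : Ideal B, T.IsTwoSided → T ≠ ⊤ → T ≤ I) :
    I ≤ Ring.jacobson B := by
  have : Nontrivial B := by
    by_contra hB
    rw [not_nontrivial_iff_subsingleton] at hB
    exact hI (Subsingleton.elim _ _)
  set J := Ring.jacobson B with hJ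
  have hJtop : J ≠ ⊤ := (Ring.jacobson_lt_top B).ne
  have hJI : J ≤ I := h J inferInstance hJtop
  have : IsSemisimpleModule B (B ⧸ J) := (IsArtinian.isSemisimpleModule_iff_jacobson B _).2
    (Module.jacobson_quotient_jacobson B B)
  -- B/J is semisimple, so the image of I has a complement as a left submodule. Its preimage L
  -- satisfies I ∩ L ≤ J and I + L = B.
  obtain ⟨C, hC⟩ := exists_isCompl (Submodule.map J.mkQ I)
  have hC₁ : I ⊓ Submodule.comap J.mkQ C ≤ J := fun x hx => by
    have h₁ : J.mkQ x ∈ Submodule.map J.mkQ I ⊓ C := ⟨Submodule.mem_map_of_mem hx.1, hx.2⟩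
    rw [hC.inf_eq_bot, Submodule.mem_bot] at h₁
    exact (Submodule.Quotient.mk_eq_zero J).1 h₁
  have hC₂ : I ⊔ Submodule.comap J.mkQ C = ⊤ := by
    have := congrArg (Submodule.comap J.mkQ) hC.sup_eq_top
    rw [Submodule.comap_top] at this
    rw [eq_top_iff, ← this]
    intro x hx
    obtain ⟨_, ⟨y, hy, rfl⟩, z, hz, e⟩ := Submodule.mem_sup.1 hx
    refine Submodule.mem_sup.2 ⟨y, hy, x - y, ?_, by abel⟩
    rw [Submodule.mem_comap, map_sub, ← e]
    simpa using hz
  -- T = {q | Iq ⊆ J} is two-sided and contains L, because IL ≤ I ∩ L ≤ J. Were T proper, it would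
  -- lie in I, and I + L = B would force I = B. So 1 ∈ T, that is, I ≤ J.
  let T : Ideal B :=
    { carrier := {q | ∀ i ∈ I, i * q ∈ J}
      add_mem' := fun ha hb i hi => by rw [mul_add]; exact J.add_mem (ha i hi) (hb i hi)
      zero_mem' := fun i _ => by rw [mul_zero]; exact J.zero_mem
      smul_mem' := fun c q hq i hi => by
        rw [smul_eq_mul, ← mul_assoc]; exact hq _ (I.mul_mem_right c hi) }
  have hT : T.IsTwoSided := ⟨fun {q} b hq i hi => by
    rw [← mul_assoc]; exact J.mul_mem_right b (hq i hi)⟩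
  have hLT : Submodule.comap J.mkQ C ≤ T := fun x hx i hi =>
    hC₁ ⟨I.mul_mem_right x hi, (Submodule.comap J.mkQ C).smul_mem i hx⟩
  by_cases hTtop : T = ⊤
  · intro i hi
    have : (1 : B) ∈ T := hTtop ▸ Submodule.mem_top
    simpa using this i hi
  · exact absurd (eq_top_iff.2 (hC₂ ▸ sup_le le_rfl (hLT.trans (h T hT hTtop)))) hI

/-- Let `A → B` be a surjection on an Artinian ring and `I` the largest proper two-sided ideal of
`A` above its kernel. Then the image of `I` is nilpotent. -/
theorem exists_list_prod_eq_zero {A B : Type*} [Ring A] [Ring B] [IsArtinianRing B] (ρ : A →+* B)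
    (hρ : Function.Surjective ρ) (I : Ideal A) [hI₂ : I.IsTwoSided] (hI : I ≠ ⊤)
    (h : ∀ T : Ideal A, T.IsTwoSided → RingHom.ker ρ ≤ T → T ≠ ⊤ → T ≤ I) :
    ∃ n : ℕ, ∀ l : List A, (∀ a ∈ l, a ∈ I) → l.length = n → ρ l.prod = 0 := by
  rcases subsingleton_or_nontrivial B with hB | hB
  · exact ⟨0, fun l _ _ => Subsingleton.elim _ _⟩
  have hker : RingHom.ker ρ ≤ I := h _ inferInstance le_rfl (RingHom.ker_ne_top ρ)
  -- I contains the kernel, so it is the full preimage of its image. This transfers two-sidedness,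
  -- properness and maximality to B.
  have hmem : ∀ a, ρ a ∈ I.map ρ ↔ a ∈ I := fun a => by
    rw [← Ideal.mem_comap, Ideal.comap_map_of_surjective ρ hρ]
    rw [sup_eq_left.2]
    exact hker
  have hT₂ : (I.map ρ).IsTwoSided := ⟨fun {q} b hq => by
    obtain ⟨q, rfl⟩ := hρ q
    obtain ⟨b, rfl⟩ := hρ b
    rw [← map_mul, hmem]
    exact I.mul_mem_right b ((hmem q).1 hq)⟩
  have hIm : I.map ρ ≠ ⊤ := fun e => hI <| by
    rw [Ideal.eq_top_iff_one, ← hmem, e]; exact Submodule.mem_top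
  have hle := le_jacobson_of_forall_isTwoSided_le (I.map ρ) hIm fun T hT hTtop t ht => by
    obtain ⟨t, rfl⟩ := hρ t
    rw [hmem]
    refine h (T.comap ρ) inferInstance (Ideal.comap_mono bot_le) (fun e => hTtop ?_) ht
    rw [Ideal.eq_top_iff_one, ← map_one ρ, ← Ideal.mem_comap, e]; exact Submodule.mem_top
  obtain ⟨n, hn⟩ := IsSemiprimaryRing.isNilpotent (R := B)
  have key : ∀ l : List A, (∀ a ∈ l, a ∈ I) → ρ l.prod ∈ (Ring.jacobson B) ^ l.length := by
    intro l
    induction l with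
    | nil =>
      intro _
      rw [List.prod_nil, map_one, List.length_nil, Submodule.pow_zero, Ideal.one_eq_top]
      exact Submodule.mem_top
    | cons a l ih =>
      intro hl
      rw [List.prod_cons, map_mul, List.length_cons, Ideal.IsTwoSided.pow_succ]
      exact Ideal.mul_mem_mul (hle ((hmem a).2 (hl a (by simp))))
        (ih fun b hb => hl b (by simp [hb]))
  refine ⟨n, fun l hl e => ?_⟩
  have := key l hl
  rw [e, hn] at this
  simpa using this

theorem exists_list_prod_eq_zero_of_finiteDimensional {K A E : Type*} [Field K] [Ring A]
    [Algebra K A] [Ring E] [Algebra K E] [FiniteDimensional K E] (ρ : A →ₐ[K] E) (I : Ideal A)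
    [I.IsTwoSided] (hI : I ≠ ⊤)
    (h : ∀ T : Ideal A, T.IsTwoSided → RingHom.ker ρ ≤ T → T ≠ ⊤ → T ≤ I) :
    ∃ n : ℕ, ∀ l : List A, (∀ a ∈ l, a ∈ I) → l.length = n → ρ l.prod = 0 := by
  have : IsArtinianRing ρ.range := IsArtinianRing.of_finite K ρ.range
  obtain ⟨n, hn⟩ := exists_list_prod_eq_zero (B := ρ.range) (ρ.rangeRestrict : A →+* ρ.range)
    ρ.rangeRestrict_surjective I hI fun T hT hker => h T hT fun f hf => hker <| by
      rw [RingHom.mem_ker] at hf ⊢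
      exact Subtype.ext hf
  exact ⟨n, fun l hl hlen => congrArg Subtype.val (hn l hl hlen)⟩

end RingTheory

end YD

/-! ### Slices of tensors. -/

namespace YD

set_option linter.unusedSectionVars false

section Slices

variable {K : Type*} [Field K] {V W : Type*} [AddCommGroup V] [Module K V] [AddCommGroup W]
  [Module K W]

variable (K V W) in
/-- The slices `a ⊗ b ↦ f(b) a` of a tensor. -/
noncomputable def slice : V ⊗[K] W →ₗ[K] (W →ₗ[K] K) →ₗ[K] V :=
  TensorProduct.lift (LinearMap.mk₂ K
    (fun a b => LinearMap.toSpanSingleton K V a ∘ₗ Module.Dual.eval K W b)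
    (fun a a' b => by ext; simp) (fun c a b => by ext; simp [smul_comm c])
    (fun a b b' => by ext; simp [add_smul]) (fun c a b => by ext; simp [mul_smul]))

theorem slice_tmul (a : V) (b : W) (f : W →ₗ[K] K) : slice K V W (a ⊗ₜ[K] b) f = f b • a := by
  simp [slice]

theorem slice_eq_sw (t : V ⊗[K] W) (f : W →ₗ[K] K) :
    slice K V W t f = sw t fun a b => f b • a := by
  rw [map_eq_sw (slice K V W) t, sw_apply]
  simp only [slice_tmul]

theorem finiteDimensional_range_slice (t : V ⊗[K] W) :
    FiniteDimensional K (LinearMap.range (slice K V W t)) := by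
  induction t with
  | zero => rw [map_zero, LinearMap.range_zero]; infer_instance
  | tmul a b =>
    refine Submodule.finiteDimensional_of_le (S₂ := Submodule.span K {a}) ?_
    rintro _ ⟨f, rfl⟩
    rw [slice_tmul]
    exact Submodule.smul_mem _ _ (Submodule.mem_span_singleton_self a)
  | add s t hs ht =>
    refine Submodule.finiteDimensional_of_le
      (S₂ := LinearMap.range (slice K V W s) ⊔ LinearMap.range (slice K V W t)) ?_
    rintro _ ⟨f, rfl⟩
    rw [map_add, LinearMap.add_apply]
    exact Submodule.add_mem_sup ⟨f, rfl⟩ ⟨f, rfl⟩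

theorem slice_eq_rid (t : V ⊗[K] W) (f : W →ₗ[K] K) :
    slice K V W t f = TensorProduct.rid K V (f.lTensor V t) := by
  induction t with
  | zero => simp
  | tmul a b => simp [slice_tmul]
  | add s t hs ht => simp [hs, ht]

theorem slice_rTensor {V' : Type*} [AddCommGroup V'] [Module K V'] (S : V →ₗ[K] V')
    (t : V ⊗[K] W) (f : W →ₗ[K] K) :
    slice K V' W (S.rTensor W t) f = S (slice K V W t f) := by
  induction t with
  | zero => simp
  | tmul a b => simp [slice_tmul]
  | add s t hs ht => simp [hs, ht]

theorem slice_comm_rTensor {V' : Type*} [AddCommGroup V'] [Module K V'] (S : V →ₗ[K] V')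
    (t : V ⊗[K] W) (f : V' →ₗ[K] K) :
    slice K W V' (TensorProduct.comm K V' W (S.rTensor W t)) f =
      slice K W V (TensorProduct.comm K V W t) (f ∘ₗ S) := by
  induction t with
  | zero => simp
  | tmul a b => simp [slice_tmul]
  | add s t hs ht => simp [hs, ht]

/-- The slices along the coordinate functionals of a basis of `W` are the coordinates of `t`. -/
theorem eq_zero_of_slice_eq_zero {t : V ⊗[K] W} (h : ∀ f, slice K V W t f = 0) : t = 0 := by
  classical
  let b := Module.Basis.ofVectorSpace K W
  refine (TensorProduct.equivFinsuppOfBasisRight (M := V) b).injective ?_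
  rw [map_zero]
  ext i
  rw [Finsupp.zero_apply, TensorProduct.equivFinsuppOfBasisRight_apply, ← slice_eq_rid, h]

theorem mem_range_rTensor_of_slice_mem {F : Submodule K V} {t : V ⊗[K] W}
    (h : ∀ f, slice K V W t f ∈ F) : t ∈ LinearMap.range (F.subtype.rTensor W) := by
  have hex := rTensor_exact W (LinearMap.exact_subtype_mkQ F) F.mkQ_surjective
  refine (hex t).1 (eq_zero_of_slice_eq_zero fun f => ?_)
  rw [slice_rTensor]
  simpa using h f

/-- The left slices put `t` in F ⊗ V. Every functional on F extends to V, so the right slices of the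
lift to F ⊗ V are right slices of `t` itself. -/
theorem mem_range_map_of_slice_mem {F : Submodule K V} {t : V ⊗[K] V}
    (h : ∀ f, slice K V V t f ∈ F) (h' : ∀ f, slice K V V (TensorProduct.comm K V V t) f ∈ F) :
    t ∈ LinearMap.range (TensorProduct.map F.subtype F.subtype) := by
  obtain ⟨s, rfl⟩ := mem_range_rTensor_of_slice_mem h
  obtain ⟨u, hu⟩ : TensorProduct.comm K F V s ∈ LinearMap.range (F.subtype.rTensor F) := by
    refine mem_range_rTensor_of_slice_mem fun f => ?_
    obtain ⟨g, rfl⟩ := LinearMap.exists_extend f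
    rw [← slice_comm_rTensor]
    exact h' g
  refine ⟨TensorProduct.comm K F F u, ?_⟩
  have hs : s = F.subtype.lTensor F (TensorProduct.comm K F F u) := by
    refine (TensorProduct.comm K F V).injective ?_
    rw [← hu, LinearMap.lTensor_comm]
    exact ((TensorProduct.comm K V F).symm_apply_apply _).symm
  rw [hs, ← LinearMap.comp_apply, LinearMap.rTensor_comp_lTensor]

end Slices

end YD

/-! ### Actions of functionals on a coalgebra and its finite-dimensional subcoalgebras. -/

namespace YD

set_option linter.unusedSectionVars false

section Hit

variable {K : Type*} [Field K] {V : Type*} [AddCommGroup V] [Module K V]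

/-- The action `f ⇀ x = f(x₂) x₁` of functionals on a coalgebra. -/
noncomputable def hit (Δ : V →ₗ[K] V ⊗[K] V) : (V →ₗ[K] K) →ₗ[K] V →ₗ[K] V :=
  (slice K V V ∘ₗ Δ).flip

theorem hit_eq_sw (Δ : V →ₗ[K] V ⊗[K] V) (f : V →ₗ[K] K) (x : V) :
    hit Δ f x = sw (Δ x) fun a b => f b • a :=
  slice_eq_sw _ _

theorem IsCoalg.hit_counit {Δ : V →ₗ[K] V ⊗[K] V} {η : V →ₗ[K] K} (hV : IsCoalg Δ η) (x : V) :
    hit Δ η x = x := by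
  rw [hit_eq_sw]
  exact hV.counit_right x

theorem IsCoalg.hit_hit {Δ : V →ₗ[K] V ⊗[K] V} {η : V →ₗ[K] K} (hV : IsCoalg Δ η)
    (f g : V →ₗ[K] K) (x : V) : hit Δ f (hit Δ g x) = hit Δ (conv Δ f g) x := by
  rw [hit_eq_sw _ g x, map_sw]
  simp only [map_smul, hit_eq_sw, conv_eq_sw, smul_sw, sw_smul]
  rw [← hV.sw_coassoc (fun a b c => (f b * g c) • a) (by fun_prop) (by fun_prop) (by fun_prop)]
  simp only [smul_smul, mul_comm]

theorem apply_hit (Δ : V →ₗ[K] V ⊗[K] V) (f g : V →ₗ[K] K) (x : V) :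
    f (hit Δ g x) = conv Δ f g x := by
  rw [hit_eq_sw, map_sw, conv_eq_sw]
  simp [mul_comm]

end Hit

section HitCoalgebra

variable {K : Type*} [Field K] {V : Type*} [AddCommGroup V] [Module K V] [Coalgebra K V]

local notation "δ" => Coalgebra.comul (R := K) (A := V)
local notation "ε" => Coalgebra.counit (R := K) (A := V)

variable (K V) in
/-- The action `x ↼ f = f(x₁) x₂` of functionals on a coalgebra. -/
noncomputable def hit' : (V →ₗ[K] K) →ₗ[K] V →ₗ[K] V :=
  (slice K V V ∘ₗ (TensorProduct.comm K V V).toLinearMap ∘ₗ Coalgebra.comul).flip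

theorem hit'_eq_slice (f : V →ₗ[K] K) (x : V) :
    hit' K V f x = slice K V V (TensorProduct.comm K V V (δ x)) f := rfl

theorem hit'_eq_sw (f : V →ₗ[K] K) (x : V) : hit' K V f x = sw (δ x) fun a b => f a • b := by
  have := map_eq_sw ((slice K V V).flip f ∘ₗ (TensorProduct.comm K V V).toLinearMap) (δ x)
  rw [hit'_eq_slice]
  simpa [slice_tmul] using this

theorem hit_counit (x : V) : hit δ ε x = x :=
  (isCoalg_coalgebra (K := K) V).hit_counit x

theorem hit'_counit (x : V) : hit' K V ε x = x := by
  rw [hit'_eq_sw]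
  exact (isCoalg_coalgebra (K := K) V).sw_counit_left (fun a => a) (by fun_prop) x

theorem hit_hit (f g : V →ₗ[K] K) (x : V) : hit δ f (hit δ g x) = hit δ (conv δ f g) x :=
  (isCoalg_coalgebra (K := K) V).hit_hit f g x

theorem hit'_hit' (f g : V →ₗ[K] K) (x : V) :
    hit' K V f (hit' K V g x) = hit' K V (conv δ g f) x := by
  rw [hit'_eq_sw g x, map_sw]
  simp only [map_smul, hit'_eq_sw, conv_eq_sw, smul_sw, sw_smul]
  rw [(isCoalg_coalgebra (K := K) V).sw_coassoc (fun a b c => (g a * f b) • c) (by fun_prop)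
    (by fun_prop) (by fun_prop)]
  simp only [smul_smul]

theorem hit_hit' (f g : V →ₗ[K] K) (x : V) :
    hit δ f (hit' K V g x) = hit' K V g (hit δ f x) := by
  rw [hit'_eq_sw g x, hit_eq_sw _ f x, map_sw, map_sw]
  simp only [map_smul, hit_eq_sw, hit'_eq_sw, smul_sw]
  rw [(isCoalg_coalgebra (K := K) V).sw_coassoc (fun a b c => f c • g a • b) (by fun_prop)
    (by fun_prop) (by fun_prop)]
  simp only [smul_smul, mul_comm]

theorem apply_hit' (f g : V →ₗ[K] K) (x : V) : f (hit' K V g x) = conv δ g f x := by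
  rw [hit'_eq_sw, map_sw, conv_eq_sw]
  simp

theorem isSubcoalgebra_of_hit_mem {D : Submodule K V} (h : ∀ f, ∀ x ∈ D, hit δ f x ∈ D)
    (h' : ∀ f, ∀ x ∈ D, hit' K V f x ∈ D) : IsSubcoalgebra D := fun x hx =>
  mem_range_map_of_slice_mem (fun f => h f x hx) (fun f => h' f x hx)

/-- If the orbits of vectors under a family of endomorphisms are finite-dimensional, so are
the orbits of finite-dimensional subspaces. -/
theorem finiteDimensional_map₂_top {U : Type*} [AddCommGroup U] [Module K U]
    (L : U →ₗ[K] V →ₗ[K] V) (h : ∀ x, FiniteDimensional K (LinearMap.range (L.flip x)))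
    (M : Submodule K V) [FiniteDimensional K M] :
    FiniteDimensional K (Submodule.map₂ L ⊤ M) := by
  have hM : M.FG := Module.Finite.iff_fg.1 inferInstance
  refine Submodule.fg_induction (motive := fun M _ => FiniteDimensional K (Submodule.map₂ L ⊤ M))
    (fun x => ?_) (fun M₁ M₂ _ _ h₁ h₂ => ?_) M hM
  · rw [Submodule.map₂_span_singleton_eq_map_flip, Submodule.map_top]
    exact h x
  · rw [Submodule.map₂_sup_right]
    infer_instance

theorem map₂_top_stable {U : Type*} [AddCommGroup U] [Module K U]
    {L : U →ₗ[K] V →ₗ[K] V} {S : V →ₗ[K] V} {M N : Submodule K V}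
    (h : ∀ g, ∀ m ∈ M, S (L g m) ∈ N) : ∀ y ∈ Submodule.map₂ L ⊤ M, S y ∈ N := fun _ hy =>
  (Submodule.map₂_le (r := Submodule.comap S N)).2 (fun g _ m hm => h g m hm) hy

theorem finiteDimensional_orbit_hit (M : Submodule K V) [FiniteDimensional K M] :
    FiniteDimensional K (Submodule.map₂ (hit δ) ⊤ M) := by
  refine finiteDimensional_map₂_top (hit δ) (fun x => ?_) M
  have : (hit δ).flip x = slice K V V (δ x) := rfl
  rw [this]
  exact finiteDimensional_range_slice _

theorem finiteDimensional_orbit_hit' (M : Submodule K V) [FiniteDimensional K M] :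
    FiniteDimensional K (Submodule.map₂ (hit' K V) ⊤ M) := by
  refine finiteDimensional_map₂_top (hit' K V) (fun x => ?_) M
  have : (hit' K V).flip x = slice K V V (TensorProduct.comm K V V (δ x)) := rfl
  rw [this]
  exact finiteDimensional_range_slice _

/-- The fundamental theorem of coalgebras: every element lies in a finite-dimensional subspace
which is stable under both actions of functionals. -/
theorem exists_finiteDimensional_stable (x : V) : ∃ C : Submodule K V, FiniteDimensional K C ∧
    x ∈ C ∧ (∀ f, ∀ y ∈ C, hit δ f y ∈ C) ∧ ∀ f, ∀ y ∈ C, hit' K V f y ∈ C := by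
  have h₁ := finiteDimensional_orbit_hit (Submodule.span K {x})
  have h₂ := finiteDimensional_orbit_hit' (Submodule.map₂ (hit δ) ⊤ (Submodule.span K {x}))
  -- The subspace is the orbit of x under ⇀, followed by its orbit under ↼. The two actions commute,
  -- so it is stable under both.
  refine ⟨_, h₂, ?_, fun f y hy => ?_, fun f y hy => ?_⟩
  · have := Submodule.apply_mem_map₂ (hit δ) (Submodule.mem_top (x := ε))
      (Submodule.mem_span_singleton_self (R := K) x)
    have := Submodule.apply_mem_map₂ (hit' K V) (Submodule.mem_top (x := ε)) this
    rwa [hit_counit, hit'_counit] at this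
  · refine map₂_top_stable (L := hit' K V) (fun g m hm => ?_) y hy
    rw [hit_hit']
    refine Submodule.apply_mem_map₂ _ Submodule.mem_top ?_
    refine map₂_top_stable (L := hit δ) (fun g m hm => ?_) m hm
    rw [hit_hit]
    exact Submodule.apply_mem_map₂ _ Submodule.mem_top hm
  · refine map₂_top_stable (L := hit' K V) (fun g m hm => ?_) y hy
    rw [hit'_hit']
    exact Submodule.apply_mem_map₂ _ Submodule.mem_top hm

/-- A nonzero finite-dimensional subcoalgebra contains a simple one. -/
theorem exists_isSimpleSubcoalgebra_le {D : Submodule K V} [FiniteDimensional K D]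
    (hD : IsSubcoalgebra D) (h : D ≠ ⊥) : ∃ E ≤ D, IsSimpleSubcoalgebra E := by
  induction hn : Module.finrank K D using Nat.strong_induction_on generalizing D with
  | _ n ih =>
    by_cases hs : ∀ E : Submodule K V, IsSubcoalgebra E → E ≤ D → E = ⊥ ∨ E = D
    · exact ⟨D, le_rfl, hD, h, hs⟩
    · push Not at hs
      obtain ⟨E, hE, hle, h₁, h₂⟩ := hs
      have : FiniteDimensional K E := Submodule.finiteDimensional_of_le hle
      obtain ⟨E', hE', hs'⟩ := ih _ (hn ▸ Submodule.finrank_lt_finrank_of_lt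
        (lt_of_le_of_ne hle h₂)) hE h₁ rfl
      exact ⟨E', hE'.trans hle, hs'⟩

/-- A simple subcoalgebra inside D lies in the coradical, which is the line through e, and a nonzero
subspace of that line contains e. -/
theorem mem_of_coradical_eq {e : V} (he : coradical K V = Submodule.span K {e})
    {D : Submodule K V} [FiniteDimensional K D] (hD : IsSubcoalgebra D) (h : D ≠ ⊥) : e ∈ D := by
  obtain ⟨E, hle, hE⟩ := exists_isSimpleSubcoalgebra_le hD h
  have h₁ : E ≤ Submodule.span K {e} := he ▸ le_sSup hE
  obtain ⟨y, hy, hy₀⟩ := E.exists_mem_ne_zero_of_ne_bot hE.2.1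
  obtain ⟨c, rfl⟩ := Submodule.mem_span_singleton.1 (h₁ hy)
  have hc : c ≠ 0 := fun hc => hy₀ (by rw [hc, zero_smul])
  have := D.smul_mem c⁻¹ (hle hy)
  rwa [inv_smul_smul₀ hc] at this

end HitCoalgebra

end YD

/-! ### Local nilpotence in a connected coalgebra. -/

namespace YD

set_option linter.unusedSectionVars false

section Connected

variable {K : Type*} [Field K] {V : Type*} [AddCommGroup V] [Module K V] [Coalgebra K V]

local notation "δ" => Coalgebra.comul (R := K) (A := V)
local notation "ε" => Coalgebra.counit (R := K) (A := V)

theorem ofConv_mul (f g : WithConv (V →ₗ[K] K)) : (f * g).ofConv = conv δ f.ofConv g.ofConv := rfl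

theorem ofConv_one : (1 : WithConv (V →ₗ[K] K)).ofConv = ε := by
  ext x
  simp

/-- The action of the convolution algebra on a stable subspace. -/
noncomputable def hitAlgHom (C : Submodule K V) (hC : ∀ f, ∀ y ∈ C, hit δ f y ∈ C) :
    WithConv (V →ₗ[K] K) →ₐ[K] Module.End K C :=
  AlgHom.ofLinearMap
    { toFun := fun f => (hit δ f.ofConv).restrict (hC f.ofConv)
      map_add' := fun f g => by ext; simp
      map_smul' := fun c f => by ext; simp }
    (by ext y; simp [ofConv_one, hit_counit])
    (fun f g => by
      ext y
      simp [ofConv_mul, hit_hit])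

theorem coe_hitAlgHom {C : Submodule K V} (hC : ∀ f, ∀ y ∈ C, hit δ f y ∈ C)
    (f : WithConv (V →ₗ[K] K)) (y : C) : (hitAlgHom C hC f y : V) = hit δ f.ofConv y := rfl

theorem hitAlgHom_list_prod {C : Submodule K V} (hC : ∀ f, ∀ y ∈ C, hit δ f y ∈ C)
    (l : List (V →ₗ[K] K)) (y : C) :
    (hitAlgHom C hC (l.map WithConv.toConv).prod y : V) =
      l.foldr (fun f x => hit δ f x) (y : V) := by
  induction l with
  | nil => simp
  | cons f l ih =>
    rw [List.map_cons, List.prod_cons, map_mul, Module.End.mul_apply, coe_hitAlgHom, ih,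
      List.foldr_cons]

/-- The functionals vanishing at a group-like element. -/
noncomputable def vanishingIdeal (e : V) (he : δ e = e ⊗ₜ[K] e) : Ideal (WithConv (V →ₗ[K] K)) where
  carrier := {f | f.ofConv e = 0}
  add_mem' := fun {f g} hf hg => by
    simp only [Set.mem_ofPred_eq] at hf hg ⊢
    simp [hf, hg]
  zero_mem' := by simp
  smul_mem' := fun f g hg => by
    simp only [Set.mem_ofPred_eq] at hg ⊢
    rw [smul_eq_mul, ofConv_mul, conv]
    simp [he, hg]

theorem mem_vanishingIdeal {e : V} (he : δ e = e ⊗ₜ[K] e) (f : WithConv (V →ₗ[K] K)) :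
    f ∈ vanishingIdeal e he ↔ f.ofConv e = 0 := Iff.rfl

instance {e : V} (he : δ e = e ⊗ₜ[K] e) : (vanishingIdeal e he).IsTwoSided := ⟨fun {f} g hf => by
  rw [mem_vanishingIdeal] at hf ⊢
  rw [ofConv_mul, conv]
  simp [he, hf]⟩

/-- If T had no common zero in C other than 0, its restrictions would fill the dual of the
finite-dimensional C. Some t ∈ T would then agree with ε on C, making 1 − t act as zero on C, so 1 −
t ∈ T and 1 ∈ T. -/
theorem exists_ne_zero_of_isTwoSided {C : Submodule K V} [FiniteDimensional K C]
    (hC : ∀ f, ∀ y ∈ C, hit δ f y ∈ C) (hC' : ∀ f, ∀ y ∈ C, hit' K V f y ∈ C)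
    {T : Ideal (WithConv (V →ₗ[K] K))} (hker : RingHom.ker (hitAlgHom C hC) ≤ T) (hT : T ≠ ⊤) :
    ∃ y ∈ C, y ≠ 0 ∧ ∀ t ∈ T, t.ofConv y = 0 := by
  by_contra! hne
  let W : Submodule K (Module.Dual K C) :=
    { carrier := {w | ∃ t ∈ T, w = t.ofConv ∘ₗ C.subtype}
      add_mem' := by
        rintro _ _ ⟨t, ht, rfl⟩ ⟨s, hs, rfl⟩
        exact ⟨t + s, T.add_mem ht hs, by ext; simp⟩
      zero_mem' := ⟨0, T.zero_mem, by ext; simp⟩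
      smul_mem' := by
        rintro c _ ⟨t, ht, rfl⟩
        exact ⟨c • t, by rw [Algebra.smul_def]; exact T.mul_mem_left _ ht, by ext; simp⟩ }
  have hW : W.dualCoannihilator = ⊥ := by
    rw [eq_bot_iff]
    intro y hy
    by_contra hy₀
    obtain ⟨t, ht, ht₀⟩ := hne y y.2 fun h => hy₀ (by simpa using h)
    exact ht₀ ((Submodule.mem_dualCoannihilator _).1 hy _ ⟨t, ht, rfl⟩)
  have hW' : W = ⊤ := by
    rw [← Subspace.dualCoannihilator_dualAnnihilator_eq (W := W), hW,
      Submodule.dualAnnihilator_bot]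
  obtain ⟨t, ht, hte⟩ : ε ∘ₗ C.subtype ∈ W := hW' ▸ Submodule.mem_top
  refine hT ((Ideal.eq_top_iff_one T).2 ?_)
  have h : 1 - t ∈ T := hker <| by
    rw [RingHom.mem_ker]
    ext y
    rw [coe_hitAlgHom]
    have hz : ∀ z ∈ C, (1 - t).ofConv z = 0 := fun z hz => by
      have := LinearMap.congr_fun hte ⟨z, hz⟩
      simp only [LinearMap.comp_apply, Submodule.subtype_apply] at this
      rw [WithConv.ofConv_sub, LinearMap.sub_apply, ofConv_one, this, sub_self]
    -- Testing against g exchanges the two actions: g(f ⇀ y) = f(y ↼ g), and y ↼ g stays in C, where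
    -- 1 − t vanishes.
    refine (Module.forall_dual_apply_eq_zero_iff K _).1 fun g => ?_
    rw [apply_hit, ← apply_hit', hz _ (hC' g _ y.2)]
  simpa using T.add_mem h ht

/-- In a connected coalgebra, functionals vanishing at the group-like element act locally
nilpotently. -/
theorem exists_foldr_hit_eq_zero {e : V} (he : δ e = e ⊗ₜ[K] e) (hε : ε e = 1)
    (hconn : coradical K V = Submodule.span K {e}) (x : V) :
    ∃ n : ℕ, ∀ l : List (V →ₗ[K] K), (∀ f ∈ l, f e = 0) → l.length = n →
      l.foldr (fun f y => hit δ f y) x = 0 := by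
  obtain ⟨C, hfd, hx, hC, hC'⟩ := exists_finiteDimensional_stable (K := K) x
  have hI : vanishingIdeal e he ≠ ⊤ := fun h => by
    have : (1 : WithConv (V →ₗ[K] K)) ∈ vanishingIdeal e he := h ▸ Submodule.mem_top
    rw [mem_vanishingIdeal, ofConv_one, hε] at this
    exact one_ne_zero this
  -- The functionals vanishing at e form the largest proper two-sided ideal above the kernel: the
  -- common zeros in C of another such ideal form a nonzero subcoalgebra, which contains e by
  -- connectedness.
  have key : ∀ T : Ideal (WithConv (V →ₗ[K] K)), T.IsTwoSided →
      RingHom.ker (hitAlgHom C hC) ≤ T →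
      T ≠ ⊤ → T ≤ vanishingIdeal e he := by
    intro T hT₂ hker hT
    obtain ⟨y, hy, hy₀, hyT⟩ := exists_ne_zero_of_isTwoSided hC hC' (T := T) hker hT
    let D : Submodule K V :=
      { carrier := {y | y ∈ C ∧ ∀ t ∈ T, t.ofConv y = 0}
        add_mem' := fun ha hb => ⟨C.add_mem ha.1 hb.1, fun t ht => by
          rw [map_add, ha.2 t ht, hb.2 t ht, add_zero]⟩
        zero_mem' := ⟨C.zero_mem, fun t _ => map_zero _⟩
        smul_mem' := fun c a ha => ⟨C.smul_mem c ha.1, fun t ht => by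
          rw [map_smul, ha.2 t ht, smul_zero]⟩ }
    have : FiniteDimensional K D := Submodule.finiteDimensional_of_le (S₂ := C) fun z hz => hz.1
    have hD : IsSubcoalgebra D := isSubcoalgebra_of_hit_mem
      (fun f z hz => ⟨hC f z hz.1, fun t ht => by
        rw [apply_hit]; exact hz.2 _ (T.mul_mem_right (WithConv.toConv f) ht)⟩)
      (fun f z hz => ⟨hC' f z hz.1, fun t ht => by
        rw [apply_hit']; exact hz.2 _ (T.mul_mem_left (WithConv.toConv f) ht)⟩)
    have hDe := mem_of_coradical_eq hconn hD fun h => hy₀ (by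
      rw [← Submodule.mem_bot K, ← h]; exact ⟨hy, hyT⟩)
    exact fun t ht => hDe.2 t ht
  obtain ⟨n, hn⟩ := exists_list_prod_eq_zero_of_finiteDimensional (hitAlgHom C hC)
    (vanishingIdeal e he) hI key
  refine ⟨n, fun l hl hlen => ?_⟩
  have h₁ := hn (l.map WithConv.toConv) (by simpa [mem_vanishingIdeal] using hl) (by simpa)
  have h₂ : hitAlgHom C hC (l.map WithConv.toConv).prod = 0 := h₁
  rw [← hitAlgHom_list_prod hC l ⟨x, hx⟩, h₂]
  rfl

end Connected

end YD

/-! ### The coradical filtration and convolution invertibility on R ⊗ R. -/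

namespace YD

set_option linter.unusedSectionVars false

section Filtration

variable {K : Type*} [Field K] {V : Type*} [AddCommGroup V] [Module K V]

theorem sw_mem {W M : Type*} [AddCommGroup W] [Module K W] [AddCommGroup M] [Module K M]
    {F : Submodule K M} (t : V ⊗[K] W) {f : V → W → M} (h : ∀ a b, f a b ∈ F) : sw t f ∈ F := by
  refine multiset_sum_mem _ fun m hm => ?_
  obtain ⟨p, _, rfl⟩ := Multiset.mem_map.1 hm
  exact h _ _

/-- The inverse is ε composed with the inverse φ⁻¹ of f ⇀ (–). It is a left inverse by construction;
for the other side, evaluate f * (ε φ⁻¹) on elements f ⇀ y, which exhaust V. -/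
theorem IsCoalg.isReg_of_bijective_hit {ΔV : V →ₗ[K] V ⊗[K] V} {εV : V →ₗ[K] K}
    (hV : IsCoalg ΔV εV) {f : V →ₗ[K] K} (hf : Function.Bijective (hit ΔV f)) :
    IsReg ΔV εV f := by
  let φ := LinearEquiv.ofBijective (hit ΔV f) hf
  have h₁ : conv ΔV (εV ∘ₗ φ.symm.toLinearMap) f = εV := by
    ext z
    rw [← apply_hit]
    exact congrArg εV (φ.symm_apply_apply z)
  refine ⟨εV ∘ₗ φ.symm.toLinearMap, ?_, h₁⟩
  have h₂ : ∀ z, hit ΔV (εV ∘ₗ φ.symm.toLinearMap) (hit ΔV f z) = z := fun z => by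
    rw [hV.hit_hit, h₁, hV.hit_counit]
  ext z
  obtain ⟨y, rfl⟩ := hf.2 z
  have h₃ := apply_hit ΔV (conv ΔV f (εV ∘ₗ φ.symm.toLinearMap)) f y
  rw [h₃, hV.conv_assoc, h₁, hV.conv_counit, apply_hit, hV.counit_conv]

/-- On each vector the geometric series of T is finite and gives a preimage; a fixed vector of T is
killed by some power of T, hence is zero. -/
theorem bijective_one_sub_of_locally_nilpotent {T : Module.End K V}
    (h : ∀ z, ∃ n : ℕ, (T ^ n) z = 0) : Function.Bijective (1 - T : Module.End K V) := by
  constructor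
  · rw [← LinearMap.ker_eq_bot, eq_bot_iff]
    intro z hz
    have hz : T z = z := by
      rw [LinearMap.mem_ker, LinearMap.sub_apply, sub_eq_zero] at hz
      exact hz.symm
    have key : ∀ n : ℕ, (T ^ n) z = z := fun n => by
      induction n with
      | zero => rfl
      | succ n ih => rw [pow_succ, Module.End.mul_apply, hz, ih]
    obtain ⟨n, hn⟩ := h z
    rw [key] at hn
    simpa using hn
  · intro z
    obtain ⟨n, hn⟩ := h z
    refine ⟨(∑ i ∈ Finset.range n, T ^ i) z, ?_⟩
    rw [← Module.End.mul_apply, mul_neg_geom_sum, LinearMap.sub_apply, hn, sub_zero]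
    rfl

variable [Coalgebra K V]

local notation "δ" => Coalgebra.comul (R := K) (A := V)
local notation "ε" => Coalgebra.counit (R := K) (A := V)

/-- The coradical filtration of a connected coalgebra with group-like element `e`, starting with
`0`. -/
noncomputable def filtration (e : V) : ℕ → Submodule K V
  | 0 => ⊥
  | n + 1 => ⨅ f : {f : V →ₗ[K] K // f e = 0}, Submodule.comap (hit δ f) (filtration e n)

theorem mem_filtration_zero {e x : V} : x ∈ filtration (K := K) e 0 ↔ x = 0 := by
  rw [filtration, Submodule.mem_bot]

theorem mem_filtration_succ {e : V} {n : ℕ} {x : V} : x ∈ filtration (K := K) e (n + 1) ↔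
    ∀ f : V →ₗ[K] K, f e = 0 → hit δ f x ∈ filtration (K := K) e n := by
  rw [filtration]
  simp [Submodule.mem_iInf]

theorem mem_filtration {e : V} {n : ℕ} {x : V} (h : ∀ l : List (V →ₗ[K] K),
    (∀ f ∈ l, f e = 0) → l.length = n → l.foldr (fun f y => hit δ f y) x = 0) :
    x ∈ filtration (K := K) e n := by
  induction n generalizing x with
  | zero =>
    rw [mem_filtration_zero]
    exact h [] (by simp) rfl
  | succ n ih =>
    rw [mem_filtration_succ]
    refine fun f hf => ih fun l hl hlen => ?_
    have := h (l ++ [f]) (fun g hg => by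
      rcases List.mem_append.1 hg with hg | hg
      · exact hl g hg
      · rw [List.mem_singleton.1 hg, hf]) (by simp [hlen])
    simpa using this

theorem filtration_le_succ (e : V) (n : ℕ) :
    filtration (K := K) e n ≤ filtration (K := K) e (n + 1) := by
  induction n with
  | zero => rw [filtration]; exact bot_le
  | succ n ih =>
    intro x hx
    rw [mem_filtration_succ] at hx ⊢
    exact fun f hf => ih (hx f hf)

/-- Subtracting f(e)ε from f produces a functional vanishing at e, and those lower the filtration
degree. -/
theorem hit_sub_mem_filtration {e : V} (he : ε e = 1) (f : V →ₗ[K] K) {n : ℕ} {x : V}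
    (hx : x ∈ filtration (K := K) e (n + 1)) : hit δ f x - f e • x ∈ filtration (K := K) e n := by
  have := mem_filtration_succ.1 hx (f - f e • ε) (by simp [he])
  simpa [hit_counit] using this

theorem hit_mem_filtration {e : V} (he : ε e = 1) (f : V →ₗ[K] K) {n : ℕ} {x : V}
    (hx : x ∈ filtration (K := K) e n) : hit δ f x ∈ filtration (K := K) e n := by
  cases n with
  | zero => rw [mem_filtration_zero] at hx ⊢; rw [hx, map_zero]
  | succ n =>
    have := (filtration (K := K) e (n + 1)).add_mem
      (filtration_le_succ e n (hit_sub_mem_filtration he f hx))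
      ((filtration (K := K) e (n + 1)).smul_mem (f e) hx)
    simpa using this

theorem comul_sub_mem_range {e : V} (he : ε e = 1) {n : ℕ} {x : V} (hx : x ∈ filtration (K := K) e (n + 1)) :
    δ x - x ⊗ₜ[K] e ∈ LinearMap.range ((filtration (K := K) e n).subtype.rTensor V) := by
  refine mem_range_rTensor_of_slice_mem fun f => ?_
  rw [map_sub, LinearMap.sub_apply, slice_tmul]
  exact hit_sub_mem_filtration he f hx

end Filtration

namespace PreBialgebra

variable {K H R : Type*} [Field K] [Ring H] [HopfAlgebra K H]
  [AddCommGroup R] [Module K R] [Coalgebra K R] (P : PreBialgebra K H R)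

/-- A functional f acts on hx through the functionals f(h₂ –), which still vanish at 1_R because H
acts trivially on it. -/
theorem act_mem_filtration {n : ℕ} {x : R} (hx : x ∈ filtration (K := K) P.one n) (h : H) :
    P.act h x ∈ filtration (K := K) P.one n := by
  induction n generalizing x h with
  | zero => rw [mem_filtration_zero] at hx ⊢; rw [hx, map_zero]
  | succ n ih =>
    rw [mem_filtration_succ]
    intro f hf
    have : hit Coalgebra.comul f (P.act h x) = sw (Coalgebra.comul (R := K) h) fun a b =>
        P.act a (hit Coalgebra.comul (f ∘ₗ P.act b) x) := by
      rw [hit_eq_sw, P.isModCoalg.sw_comul_act _ (by fun_prop) (by fun_prop)]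
      simp [hit_eq_sw, map_sw]
    rw [this]
    refine sw_mem _ fun a b => ih (mem_filtration_succ.1 hx _ ?_) a
    rw [LinearMap.comp_apply, P.act_one, map_smul, hf, smul_zero]

theorem hit_comul₂_tmul (g : R ⊗[K] R →ₗ[K] K) (x y : R) :
    hit P.comul₂ g (x ⊗ₜ[K] y) = sw (Coalgebra.comul (R := K) x) fun a b =>
      sw (P.coact b) fun k c => a ⊗ₜ[K] P.act k
        (hit Coalgebra.comul (g ∘ₗ TensorProduct.mk K R R c) y) := by
  rw [hit_eq_sw, P.sw_comul₂ _ (by fun_prop) (by fun_prop)]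
  simp [hit_eq_sw, map_sw, tmul_sw]

/-- Each application of g lowers the total degree i + j. Write Δx as x ⊗ 1 plus terms whose left leg
has smaller degree. In the latter the degree of x drops and that of y does not grow. For x ⊗ 1, the
functional g(1 ⊗ –) vanishes at 1, so the degree of y drops. The coaction is applied only to the
right leg of Δx, whose degree is not tracked, so it need not respect the filtration. -/
theorem pow_hit_comul₂_tmul_eq_zero {g : R ⊗[K] R →ₗ[K] K} (hg : g (P.one ⊗ₜ[K] P.one) = 0)
    (n : ℕ) {i j : ℕ} (hij : i + j ≤ n) {x y : R} (hx : x ∈ filtration (K := K) P.one i)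
    (hy : y ∈ filtration (K := K) P.one j) :
    ((hit P.comul₂ g : Module.End K (R ⊗[K] R)) ^ n) (x ⊗ₜ[K] y) = 0 := by
  induction n generalizing i j x y with
  | zero =>
    obtain rfl : i = 0 := by omega
    rw [mem_filtration_zero.1 hx, zero_tmul, map_zero]
  | succ n ih =>
    cases i with
    | zero => rw [mem_filtration_zero.1 hx, zero_tmul, map_zero]
    | succ i =>
    cases j with
    | zero => rw [mem_filtration_zero.1 hy, tmul_zero, map_zero]
    | succ j =>
    set F : R → R → R ⊗[K] R := fun a b => sw (P.coact b) fun k c => a ⊗ₜ[K] P.act k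
      (hit Coalgebra.comul (g ∘ₗ TensorProduct.mk K R R c) y) with hF
    have h₁ : ∀ b, IsLin K fun a => F a b := fun b => by simp only [hF]; fun_prop
    have h₂ : ∀ a, IsLin K fun b => F a b := fun a => by
      simp only [hF, hit_eq_sw, LinearMap.comp_apply, TensorProduct.mk_apply]; fun_prop
    have h₃ : F x P.one = x ⊗ₜ[K] hit Coalgebra.comul (g ∘ₗ TensorProduct.mk K R R P.one) y := by
      simp only [hF, P.coact_one]
      rw [sw_tmul, P.one_act]
      · fun_prop
      · intro k
        simp only [hit_eq_sw, LinearMap.comp_apply, TensorProduct.mk_apply]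
        fun_prop
    obtain ⟨s, hs⟩ := comul_sub_mem_range P.counit_one hx
    have e : sw (Coalgebra.comul (R := K) x) F = (sw s fun a b => F a b) + F x P.one := by
      rw [sub_eq_iff_eq_add.1 hs.symm, (IsLin.sw_left F IsLin.id' h₁ h₂).add,
        sw_tmul _ _ _ h₁ h₂, rTensor_eq_sw, sw_sw _ _ _ h₁ h₂]
      simp only [sw_tmul _ _ F h₁ h₂, Submodule.subtype_apply]
    rw [pow_succ, Module.End.mul_apply, hit_comul₂_tmul, e, h₃, map_add, ih (i := i + 1) (j := j)
      (by omega) hx (mem_filtration_succ.1 hy _ (by simpa using hg)), add_zero, map_sw]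
    refine (Submodule.mem_bot K).1 (sw_mem s fun a b => ?_)
    rw [hF, map_sw]
    refine sw_mem _ fun k c => ?_
    rw [ih (i := i) (j := j + 1) (by omega) a.2
      (P.act_mem_filtration (hit_mem_filtration P.counit_one _ hy) k)]
    exact Submodule.zero_mem _

/-- The functional ε − f vanishes at 1 ⊗ 1, so it acts locally nilpotently on R ⊗ R, and f acts as
the identity minus this operator. -/
theorem isReg_of_isConnected (hP : P.IsConnected) {f : R ⊗[K] R →ₗ[K] K}
    (hf : f (P.one ⊗ₜ[K] P.one) = 1) : IsReg P.comul₂ P.counit₂ f := by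
  refine P.isCoalg₂.isReg_of_bijective_hit ?_
  have e : (hit P.comul₂ f : Module.End K (R ⊗[K] R)) =
      1 - hit P.comul₂ (P.counit₂ - f) := by
    refine LinearMap.ext fun z => ?_
    rw [map_sub, LinearMap.sub_apply, LinearMap.sub_apply, P.isCoalg₂.hit_counit,
      Module.End.one_apply, sub_sub_cancel]
  rw [e]
  refine bijective_one_sub_of_locally_nilpotent fun z => ?_
  have hg : (P.counit₂ - f) (P.one ⊗ₜ[K] P.one) = 0 := by
    simp [counit₂_tmul, P.counit_one, hf]
  have hR := fun x => exists_foldr_hit_eq_zero P.comul_one P.counit_one hP x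
  induction z with
  | zero => exact ⟨0, rfl⟩
  | tmul x y =>
    obtain ⟨i, hi⟩ := hR x
    obtain ⟨j, hj⟩ := hR y
    exact ⟨i + j, P.pow_hit_comul₂_tmul_eq_zero hg _ le_rfl (mem_filtration hi)
      (mem_filtration hj)⟩
  | add s t hs ht =>
    obtain ⟨i, hi⟩ := hs
    obtain ⟨j, hj⟩ := ht
    refine ⟨i + j, ?_⟩
    rw [map_add]
    have h₁ := congrArg (hit P.comul₂ (P.counit₂ - f) ^ j : Module.End K (R ⊗[K] R)) hi
    have h₂ := congrArg (hit P.comul₂ (P.counit₂ - f) ^ i : Module.End K (R ⊗[K] R)) hj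
    rw [← Module.End.mul_apply, ← pow_add, map_zero] at h₁ h₂
    rw [h₂, add_comm i, h₁, add_zero]

end PreBialgebra

end YD

/-! ### Unitality, coinvariants and the equivalence of the four conditions. -/

namespace YD

set_option linter.unusedSectionVars false

namespace PreBialgebra

variable {K H R : Type*} [Field K] [Ring H] [HopfAlgebra K H]
  [AddCommGroup R] [Module K R] [Coalgebra K R] {P : PreBialgebra K H R}
variable {lam : H →ₗ[K] K}  {ξ : R ⊗[K] R →ₗ[K] H}

variable (P) in
theorem isComulMap_tmul_one :
    IsComulMap Coalgebra.comul P.comul₂ ((TensorProduct.mk K R R).flip P.one) := fun r => by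
  rw [← eq_sw (P.comul₂ _), LinearMap.flip_apply, TensorProduct.mk_apply,
    P.sw_comul₂ _ (by fun_prop) (by fun_prop)]
  refine IsLin.congr_sw fun a b => ?_
  simp (disch := fun_prop) only [P.comul_one, sw_tmul, P.act_one, tmul_smul,
    ← smul_tmul']
  exact P.isComodCoalg.sw_counit_coact (fun c => (a ⊗ₜ[K] P.one) ⊗ₜ[K] (c ⊗ₜ[K] P.one))
    (by fun_prop) b

variable (P) in
theorem isComulMap_one_tmul :
    IsComulMap Coalgebra.comul P.comul₂ (TensorProduct.mk K R R P.one) := fun r => by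
  rw [← eq_sw (P.comul₂ _), TensorProduct.mk_apply,
    P.sw_comul₂ _ (by fun_prop) (by fun_prop)]
  simp (disch := fun_prop) only [P.comul_one, sw_tmul, P.coact_one, P.one_act]
  rfl

/-- Restriction along a coalgebra map preserves inverses, and the inverse of the counit is the
counit. Applied to r ↦ r ⊗ 1 and r ↦ 1 ⊗ r, this gives unitality of v. -/
theorem eq_counit_of_isConvInv {W : Type*} [AddCommMonoid W] [Module K W]
    {ΔW : W →ₗ[K] W ⊗[K] W} {εW : W →ₗ[K] K} {π : R →ₗ[K] W}
    (hπ : IsComulMap Coalgebra.comul ΔW π)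
    (hε : εW ∘ₗ π = Coalgebra.counit) {f g : W →ₗ[K] K} (h : IsConvInv ΔW εW f g)
    (hf : f ∘ₗ π = Coalgebra.counit) : g ∘ₗ π = Coalgebra.counit := by
  have hC := isCoalg_coalgebra (K := K) R
  have h' := h.comp hπ hε
  rw [hf] at h'
  rw [← h'.1, hC.counit_conv]

theorem IsCocycle.isConvInv_apply_one (hlam : IsAdInvariantIntegral lam) (hξ : P.IsCocycle ξ)
    {v : R ⊗[K] R →ₗ[K] K} (h : IsConvInv P.comul₂ P.counit₂ (lam ∘ₗ ξ) v) (r : R) :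
    v (r ⊗ₜ[K] P.one) = Coalgebra.counit r ∧ v (P.one ⊗ₜ[K] r) = Coalgebra.counit r := by
  constructor
  · refine LinearMap.congr_fun (eq_counit_of_isConvInv P.isComulMap_tmul_one ?_ h ?_) r
    · ext; simp [counit₂_tmul, P.counit_one]
    · ext; simp [hξ.map_one_right, Algebra.algebraMap_eq_smul_one, hlam.map_one]
  · refine LinearMap.congr_fun (eq_counit_of_isConvInv P.isComulMap_one_tmul ?_ h ?_) r
    · ext; simp [counit₂_tmul, P.counit_one]
    · ext; simp [hξ.map_one_left, Algebra.algebraMap_eq_smul_one, hlam.map_one]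

/-- Linearity and unitality of v are automatic. The remaining equation equates `dPlus v` with (v ⊗
ε) * v(m ⊗ R)Φ(ξ), which is the convolution inverse of `dMinus ξ (lam ∘ₗ ξ)`. -/
theorem IsCocycle.mem_Z₂_iff (hlam : IsAdInvariantIntegral lam) (hξ : P.IsCocycle ξ)
    {v : R ⊗[K] R →ₗ[K] K} (h : IsConvInv P.comul₂ P.counit₂ (lam ∘ₗ ξ) v) :
    v ∈ P.Z₂ ξ ↔ conv P.comul₃ (P.dPlus v) (P.dMinus ξ (lam ∘ₗ ξ)) = P.counit₃ := by
  have hC := P.isCoalg₃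
  have hL := (hξ.isHLinear_integral hlam).isConvInv P.isCoalg₂ P.isModCoalg₂ h
  have hinv := hC.isConvInv_conv
    (h.comp P.isComulMap_counitRight P.counit₂_counitRight).symm
    (h.comp hξ.isComulMap_mulLeft hξ.counit₂_mulLeft).symm
  have key : v ∈ P.Z₂ ξ ↔ P.dPlus v =
      conv P.comul₃ (v ∘ₗ counitRight) (v ∘ₗ P.mulLeft ξ) := by
    rw [Z₂, Set.mem_ofPred_eq, tensorFun_counit_left, tensorFun_counit_right]
    exact ⟨fun hz => hz.2.2.2, fun hz => ⟨hL, fun r => (hξ.isConvInv_apply_one hlam h r).1,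
      fun r => (hξ.isConvInv_apply_one hlam h r).2, hz⟩⟩
  rw [key]
  constructor
  · intro e
    rw [e]; exact hinv.1
  · intro e
    have := congrArg (fun z => conv P.comul₃ z
      (conv P.comul₃ (v ∘ₗ counitRight) (v ∘ₗ P.mulLeft ξ))) e
    simp only [hC.conv_assoc, hC.counit_conv] at this
    rw [← this, dMinus, hinv.2, hC.conv_counit]

end PreBialgebra

section Coinvariants

variable {K H : Type*} [Field K] [Ring H] [HopfAlgebra K H]
variable {V : Type*} [AddCommGroup V] [Module K V] {ΔV : V →ₗ[K] V ⊗[K] V} {εV : V →ₗ[K] K}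
  {ρV : V →ₗ[K] H ⊗[K] V} {lam : H →ₗ[K] K}

/-- Coassociativity of the coaction turns ρ(λ(z₋₁)z₀) into λ applied to the first leg of Δ(z₋₁), and
the right integral property replaces the second leg by 1. -/
theorem IsAdInvariantIntegral.sw_mem_coinvariants (hlam : IsAdInvariantIntegral lam)
    (hV : IsComodCoalg ΔV εV ρV) (z : V) :
    (sw (ρV z) fun k z₀ => lam k • z₀) ∈ coinvariants ρV := by
  rw [coinvariants, LinearMap.mem_eqLocus, map_sw, TensorProduct.mk_apply, tmul_sw]
  have e : ∀ k z₀, ρV (lam k • z₀) = sw (ρV z₀) fun l y => lam k • (l ⊗ₜ[K] y) := fun k z₀ => by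
    rw [map_smul, ← smul_sw, eq_sw]
  simp only [e]
  rw [hV.sw_coassoc_coact (fun k l y => lam k • (l ⊗ₜ[K] y)) (by fun_prop) (by fun_prop)
    (by fun_prop)]
  refine IsLin.congr_sw fun k y => ?_
  rw [hlam.sw_right (fun l => l ⊗ₜ[K] y) (by fun_prop), tmul_smul]

/-- The functional λΨ(α) is α composed with z ↦ λ(z₋₁)z₀. That map has values in the coinvariants,
fixes them since λ(1) = 1, and preserves ε. -/
theorem IsAdInvariantIntegral.comp_Psi_eq_iff (hlam : IsAdInvariantIntegral lam)
    (hV : IsComodCoalg ΔV εV ρV) (α : V →ₗ[K] K) :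
    lam ∘ₗ Psi ρV α = εV ↔ ∀ z ∈ coinvariants ρV, α z = εV z := by
  have e : ∀ z, lam (Psi ρV α z) = α (sw (ρV z) fun k z₀ => lam k • z₀) := fun z => by
    simp [Psi_eq_sw, map_sw, mul_comm]
  constructor
  · intro h z hz
    rw [← h, LinearMap.comp_apply, e]
    rw [coinvariants, LinearMap.mem_eqLocus] at hz
    rw [hz, TensorProduct.mk_apply, sw_tmul _ _ _ (by fun_prop) (by fun_prop), hlam.map_one,
      one_smul]
  · intro h
    ext z
    rw [LinearMap.comp_apply, e, h _ (hlam.sw_mem_coinvariants hV z), map_sw]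
    have := hV.sw_counit_colinear (fun k => lam k) (by fun_prop) z
    rw [hlam.map_one, smul_eq_mul, _root_.mul_one] at this
    rw [← this]
    refine IsLin.congr_sw fun k z₀ => ?_
    simp [mul_comm]

end Coinvariants

namespace PreBialgebra

variable {K H R : Type*} [Field K] [Ring H] [HopfAlgebra K H]
  [AddCommGroup R] [Module K R] [Coalgebra K R] {P : PreBialgebra K H R}
variable {lam : H →ₗ[K] K}  {ξ : R ⊗[K] R →ₗ[K] H}

theorem IsCocycle.tfae_mem_Z₂ (hlam : IsAdInvariantIntegral lam) (hξ : P.IsCocycle ξ)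
    {v : R ⊗[K] R →ₗ[K] K} (h : IsConvInv P.comul₂ P.counit₂ (lam ∘ₗ ξ) v) :
    List.TFAE [
      v ∈ P.Z₂ ξ,
      P.dR ξ v = P.counit₃,
      lam ∘ₗ Psi P.coact₃ (P.dR ξ v) = P.counit₃,
      ∀ z ∈ coinvariants P.coact₃, P.dR ξ v z = P.counit₃ z] := by
  have hL := (hξ.isHLinear_integral hlam).isConvInv P.isCoalg₂ P.isModCoalg₂ h
  have hd := P.dR_eq hξ hL h.symm
  tfae_have 1 ↔ 2 := by rw [hd]; exact hξ.mem_Z₂_iff hlam h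
  tfae_have 2 ↔ 3 := by
    -- Ψ of the coboundary is the coboundary times 1_H, and λ(1) = 1.
    have : lam ∘ₗ Psi P.coact₃ (P.dR ξ v) = P.dR ξ v := by
      rw [hd, hξ.Psi_coboundary hlam h]
      refine LinearMap.ext fun z => ?_
      simp [scalar_apply, hlam.map_one]
    rw [this]
  tfae_have 3 ↔ 4 := hlam.comp_Psi_eq_iff P.isComodCoalg₃ _
  tfae_finish

end PreBialgebra

end YD

theorem mainTheorem8 {K H R : Type*} [Field K] [CharZero K] [Ring H] [HopfAlgebra K H]
    [AddCommGroup R] [Module K R] [Coalgebra K R]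
    (lam : H →ₗ[K] K) (hlam : YD.IsAdInvariantIntegral lam)
    (P : YD.PreBialgebra K H R) (hconn : P.IsConnected)
    (ξ : R ⊗[K] R →ₗ[K] H) (hξ : P.IsCocycle ξ)
    (v : R ⊗[K] R →ₗ[K] K) (hv : v = P.G lam ξ) :
    YD.IsReg P.comul₂ P.counit₂ (lam ∘ₗ ξ) ∧
    YD.IsReg P.smashΔ₂ P.smashε₂ (P.mho₂ v) ∧
    List.TFAE [
      v ∈ P.Z₂ ξ,
      P.dR ξ v = P.counit₃,
      lam ∘ₗ YD.Psi P.coact₃ (P.dR ξ v) = P.counit₃,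
      ∀ z ∈ YD.coinvariants P.coact₃, P.dR ξ v z = P.counit₃ z] := by
  have hreg : YD.IsReg P.comul₂ P.counit₂ (lam ∘ₗ ξ) :=
    -- The value of λξ at 1 ⊗ 1 is 1, by unitality of ξ and λ(1) = 1.
    P.isReg_of_isConnected hconn (by
      rw [LinearMap.comp_apply, hξ.map_one_right, P.counit_one, map_one, hlam.map_one])
  have h : YD.IsConvInv P.comul₂ P.counit₂ (lam ∘ₗ ξ) v := hv ▸ hreg.isConvInv_convInv
  exact ⟨hreg, ⟨_, P.isConvInv_mho₂ h.symm⟩, hξ.tfae_mem_Z₂ hlam h⟩
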